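/- Conventions. A category with cofibrations is a category with a zero object and a class of morphisms (cofibrations, $\rightarrowtail$) that contains all morphisms out of a zero object and all isomorphisms, is closed under composition, and is such that pushouts of cofibrations along arbitrary morphisms exist and are cofibrations. A cofibration sequence $A\rightarrowtail B\twoheadrightarrow B/A$ is a cofibration followed by its cokernel. A Waldhausen category is a category with cofibrations together with a class $w$ of weak equivalences that contains the isomorphisms, is closed under composition and satisfies the gluing axiom for pushouts along cofibrations. $S_n\mathcal C$ is the full subcategory of $\mathrm{Fun}(\mathrm{Ar}[n],\mathcal C)$ on the functors $(a,b)\mapsto A_{a,b}$ ($0\le a\le b\le n$) such that every $A_{a,a}$ is a zero object and $A_{a,b}\rightarrowtail A_{a,c}\twoheadrightarrow A_{b,c}$ is a cofibration sequence for all $a<b<c$; $wS_n\mathcal C$ is its subcategory of componentwise weak equivalences. These form simplicial categories $S_\bullet\mathcal C$ and $wS_\bullet\mathcal C$. For a simplicial object $X$ and a nonempty $I\subseteq\{0,\dots,n\}$ write $X_I=X_{|I|-1}$, with the maps induced by inclusions of vertex sets. Let $P_n$ ($n\ge 2$) be the convex $(n+1)$-gon with vertices cyclically labelled $0,\dots,n$.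 For a polygonal subdivision $\mathcal P$ of $P_n$ the $2$-Segal map of $X$ is the canonical map $f_{\mathcal P}\colon X_n\to \operatorname{holim}_I X_I$, where $I$ runs through the vertex sets of the polygons and of the diagonals of $\mathcal P$, ordered by inclusion. For simplicial categories the homotopy limit is the projective $2$-limit (families of objects with coherent isomorphisms) and the weak equivalences are the equivalences of categories; for simplicial spaces it is the usual homotopy limit, with weak homotopy equivalences. $X$ is $2$-Segal if all $f_{\mathcal P}$ are weak equivalences. A triangulation is a subdivision all of whose polygons are triangles. Let $\mathcal R_f$ be the category of finite based CW complexes (base point a $0$-cell) and based cellular maps, whose cofibrations are the cellular inclusions, i.e. the injective maps carrying open cells onto open cells. A subcategory with cofibrations of $\mathcal R_f$ is a replete (not necessarily full) subcategory $\mathcal A$ that is a category with cofibrations, with cofibrations the morphisms of $\mathcal A$ that are cofibrations of $\mathcal R_f$ and have a cokernel in $\mathcal A$, and whose inclusion into $\mathcal R_f$ preserves zero objects and pushouts along these cofibrations. Let $T^2$ be the torus $(\mathbb R/\mathbb Z)^2$ with the CW structure with one $0$-cell, three $1$-cells and two $2$-cells obtained from the unit square by cutting it along the diagonal $x=y$ and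 identifying opposite sides; let $S^1\subset T^2$ be the image of the vertical sides, $\hat\Delta\subset T^2/S^1$ the image of the closed triangle $0\le x\le y\le 1$, and $S^2=(T^2/S^1)/\hat\Delta$. Let $\mathcal D$ be the category with cofibrations generated in $\mathcal R_f$ by the two cofibration sequences $$S^1\rightarrowtail T^2\twoheadrightarrow T^2/S^1,\qquad \hat\Delta\rightarrowtail T^2/S^1\twoheadrightarrow S^2,$$ that is, the intersection of all subcategories with cofibrations of $\mathcal R_f$ that contain these four morphisms. Statement. $\mathcal D$ is a subcategory with cofibrations of $\mathcal R_f$, hence a category with cofibrations, and: (1) For every $n\ge 3$ the canonical functor $S_n\mathcal D\to S_{\{0,1,n\}}\mathcal D\times_{S_{\{1,n\}}\mathcal D}S_{\{1,\dots,n\}}\mathcal D$ to the (strict) fibre product is not essentially surjective. (2) For every $n$ and every triangulation $\mathcal T$ of $P_n$ in which some triangle does not contain the vertex $0$, the $2$-Segal map $f_{\mathcal T}$ of $S_\bullet\mathcal D$ is not an equivalence of categories. (3) The isomorphisms make $\mathcal D$ a Waldhausen category, and for every class $w$ of weak equivalences making $\mathcal D$ (with its cofibrations) a Waldhausen category and every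 triangulation $\mathcal T$ as in (2), the $2$-Segal map $f_{\mathcal T}$ of $wS_\bullet\mathcal D$ is not an equivalence of categories. (4) The simplicial category $S_\bullet\mathcal D$ is not $2$-Segal, but its levelwise geometric realization $|S_\bullet\mathcal D|$ is a $2$-Segal simplicial space. -/

import Mathlib

open CategoryTheory CategoryTheory.Limits Opposite Topology

noncomputable section

namespace TwoSegal

universe w v u

/-! ## Categories with cofibrations and Waldhausen categories -/

section Cofibrations

variable {C : Type u} [Category.{v} C]

/-- A category with cofibrations: the category has a zero object, and the class `cof` contains
all morphisms out of zero objects and all isomorphisms, is closed under composition, and pushouts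
of cofibrations along arbitrary morphisms exist and are cofibrations. -/
class IsCatWithCof (cof : MorphismProperty C) : Prop where
  exists_zero : ∃ Z : C, IsZero Z
  of_isZero : ∀ {Z A : C} (f : Z ⟶ A), IsZero Z → cof f
  of_isIso : ∀ {A B : C} (f : A ⟶ B), IsIso f → cof f
  comp : ∀ {A₁ A₂ A₃ : C} (f : A₁ ⟶ A₂) (g : A₂ ⟶ A₃), cof f → cof g → cof (f ≫ g)
  exists_pushout : ∀ {A B A' : C} (f : A ⟶ B) (g : A ⟶ A'), cof f →
    ∃ (B' : C) (h : B ⟶ B') (k : A' ⟶ B'), IsPushout f g h k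
  of_isPushout : ∀ {A B A' B' : C} {f : A ⟶ B} {g : A ⟶ A'} {h : B ⟶ B'} {k : A' ⟶ B'},
    IsPushout f g h k → cof f → cof k

/-- `wEq` makes the category with cofibrations `(C, cof)` a Waldhausen category: it is closed
under composition, contains all isomorphisms, and satisfies the gluing axiom. -/
class IsWaldhausen (cof : MorphismProperty C) (wEq : MorphismProperty C) : Prop
    extends wEq.IsMultiplicative where
  of_isIso : ∀ {A B : C} (f : A ⟶ B), IsIso f → wEq f
  gluing : ∀ {A B X P A' B' X' P' : C}
    {f : A ⟶ B} {g : A ⟶ X} {h : B ⟶ P} {k : X ⟶ P}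
    {f' : A' ⟶ B'} {g' : A' ⟶ X'} {h' : B' ⟶ P'} {k' : X' ⟶ P'}
    {a : A ⟶ A'} {b : B ⟶ B'} {x : X ⟶ X'} {p : P ⟶ P'},
    IsPushout f g h k → IsPushout f' g' h' k' → cof f → cof f' →
    f ≫ b = a ≫ f' → g ≫ x = a ≫ g' → h ≫ p = b ≫ h' → k ≫ p = x ≫ k' →
    wEq a → wEq b → wEq x → wEq p

/-- `p` is a cokernel of `f`: the square `f, p` with a zero object in the remaining corner is a
pushout. -/
def IsCokernelOf {A B Q : C} (f : A ⟶ B) (p : B ⟶ Q) : Prop :=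
  ∃ (Z : C) (t : A ⟶ Z) (s : Z ⟶ Q), IsZero Z ∧ IsPushout f t p s

/-- A (not necessarily full) subcategory of `C`. -/
structure Subcat (C : Type u) [Category.{v} C] where
  obj : C → Prop
  hom : MorphismProperty C
  source : ∀ {X Y : C} {f : X ⟶ Y}, hom f → obj X
  target : ∀ {X Y : C} {f : X ⟶ Y}, hom f → obj Y
  id : ∀ {X : C}, obj X → hom (𝟙 X)
  comp : ∀ {X Y Z : C} {f : X ⟶ Y} {g : Y ⟶ Z}, hom f → hom g → hom (f ≫ g)

namespace Subcat

/-- The objects of a subcategory. -/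
structure Obj (A : Subcat C) where
  val : C
  prop : A.obj val

/-- The morphisms of a subcategory. -/
@[ext]
structure Hom {A : Subcat C} (X Y : A.Obj) where
  val : X.val ⟶ Y.val
  prop : A.hom val

instance (A : Subcat C) : Category.{v} A.Obj where
  Hom X Y := Hom X Y
  id X := ⟨𝟙 X.val, A.id X.prop⟩
  comp f g := ⟨f.val ≫ g.val, A.comp f.prop g.prop⟩
  id_comp f := Hom.ext (Category.id_comp f.val)
  comp_id f := Hom.ext (Category.comp_id f.val)
  assoc f g h := Hom.ext (Category.assoc f.val g.val h.val)

/-- The inclusion functor of a subcategory. -/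
def incl (A : Subcat C) : A.Obj ⥤ C where
  obj X := X.val
  map f := Hom.val f

/-- The cofibrations of a subcategory `A`: the morphisms of `A` which are cofibrations of the
ambient category and have a cokernel in `A`. -/
def cof (A : Subcat C) (amb : MorphismProperty C) : MorphismProperty A.Obj :=
  fun _ Y f => amb (A.incl.map f) ∧
    ∃ (Q : A.Obj) (p : Y ⟶ Q), IsCokernelOf (A.incl.map f) (A.incl.map p)

end Subcat

/-- `A` is a subcategory with cofibrations of `(C, amb)`: with the class `A.cof amb` it is a
category with cofibrations, and the inclusion is exact (it preserves cofibrations by the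
definition of `A.cof amb`). Subcategories with cofibrations are understood to be replete. -/
structure IsSubcatWithCof (amb : MorphismProperty C) (A : Subcat C) : Prop where
  replete : ∀ {X Y : C} (e : X ≅ Y), A.obj X → A.hom e.hom
  isCatWithCof : IsCatWithCof (A.cof amb)
  preserves_zero : ∀ Z : A.Obj, IsZero Z → IsZero (A.incl.obj Z)
  preserves_pushout : ∀ {X Y X' Y' : A.Obj} {f : X ⟶ Y} {g : X ⟶ X'} {h : Y ⟶ Y'} {k : X' ⟶ Y'},
    A.cof amb f → IsPushout f g h k →
      IsPushout (A.incl.map f) (A.incl.map g) (A.incl.map h) (A.incl.map k)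

/-- The category with cofibrations generated in `(C, amb)` by a class `S` of morphisms: the
intersection of all subcategories with cofibrations that contain `S`. (Each of these contains
the sources and targets of the members of `S`, a zero object, and all morphisms between these
objects and zero objects.) -/
def generated (amb : MorphismProperty C) (S : MorphismProperty C) : Subcat C where
  obj X := ∀ A : Subcat C, IsSubcatWithCof amb A → S ≤ A.hom → A.obj X
  hom := fun _ _ f => ∀ A : Subcat C, IsSubcatWithCof amb A → S ≤ A.hom → A.hom f
  source hf A hA hS := A.source (hf A hA hS)
  target hf A hA hS := A.target (hf A hA hS)
  id hX A hA hS := A.id (hX A hA hS)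
  comp hf hg A hA hS := A.comp (hf A hA hS) (hg A hA hS)

end Cofibrations

/-! ## Finite based CW complexes -/

/-- A finite CW complex with a specified CW structure and a base point in its 0-skeleton. -/
structure FinCW where
  carrier : Type
  [top : TopologicalSpace carrier]
  [t2 : T2Space carrier]
  [cw : CWComplex (Set.univ : Set carrier)]
  [fin : CWComplex.Finite (Set.univ : Set carrier)]
  base : carrier
  base_mem : base ∈ CWComplex.skeleton (Set.univ : Set carrier) 0

namespace FinCW

instance : CoeSort FinCW Type := ⟨carrier⟩

instance (X : FinCW) : TopologicalSpace X := X.top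
instance (X : FinCW) : T2Space X := X.t2
instance (X : FinCW) : CWComplex (Set.univ : Set X) := X.cw
instance (X : FinCW) : CWComplex.Finite (Set.univ : Set X) := X.fin

/-- The `n`-skeleton as a set. -/
def skel (X : FinCW) (n : ℕ) : Set X := CWComplex.skeleton (Set.univ : Set X) n

/-- Based cellular maps. -/
@[ext]
structure Hom (X Y : FinCW) where
  toMap : C(X, Y)
  map_base : toMap X.base = Y.base
  cellular : ∀ n, Set.MapsTo toMap (X.skel n) (Y.skel n)

/-- The category of finite based CW complexes and based cellular maps. -/
instance : Category.{0} FinCW where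
  Hom X Y := Hom X Y
  id X := ⟨ContinuousMap.id X, rfl, fun n => Set.mapsTo_id (X.skel n)⟩
  comp f g := ⟨g.toMap.comp f.toMap, (congrArg g.toMap f.map_base).trans g.map_base,
    fun n => (g.cellular n).comp (f.cellular n)⟩

/-- The underlying continuous map of a morphism. -/
def toFun {X Y : FinCW} (f : X ⟶ Y) : C(X, Y) := Hom.toMap f

/-- The cofibrations: the cellular inclusions, that is, the injective maps which carry every open
cell onto an open cell. -/
def cof : MorphismProperty FinCW := fun X Y f =>
  Function.Injective (toFun f) ∧
    ∀ (n : ℕ) (e : RelCWComplex.cell (Set.univ : Set X) n),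
      ∃ e' : RelCWComplex.cell (Set.univ : Set Y) n,
        toFun f '' RelCWComplex.openCell n e = RelCWComplex.openCell n e'

/-- The torus `(ℝ/ℤ) × (ℝ/ℤ)`. -/
abbrev Torus : Type := UnitAddCircle × UnitAddCircle

/-- The union of the images in the torus of the four sides and of one diagonal of the unit
square. -/
def torusOneSkeleton : Set Torus := {p | p.1 = 0 ∨ p.2 = 0 ∨ p.1 = p.2}

/-- The image in the torus of one of the two closed triangles into which that diagonal cuts the
unit square. -/
def torusTriangle : Set Torus :=
  {p | ∃ x y : ℝ, 0 ≤ x ∧ x ≤ y ∧ y ≤ 1 ∧ p = ((x : UnitAddCircle), (y : UnitAddCircle))}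

/-- The diagram consisting of two cofibration sequences `S¹ ↣ T² ↠ T²/S¹` (morphisms `i`, `q`)
and `Δ̂ ↣ T²/S¹ ↠ S²` (morphisms `j`, `r`). Here `T²` is the torus, with one 0-cell, three
1-cells and two 2-cells coming from the unit square cut by a diagonal, `S¹` is the image of the
vertical sides of the square, and `Δ̂` is the image in `T²/S¹` of one of the two closed
triangles. -/
structure IsTorusDiagram {S T Q H R : FinCW} (i : S ⟶ T) (q : T ⟶ Q) (j : H ⟶ Q) (r : Q ⟶ R) :
    Prop where
  cof_i : cof i
  coker_q : IsCokernelOf i q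
  cof_j : cof j
  coker_r : IsCokernelOf j r
  torus : ∃ φ : T ≃ₜ Torus,
    φ '' T.skel 0 = {0} ∧ φ '' T.skel 1 = torusOneSkeleton ∧ T.skel 2 = Set.univ ∧
    φ '' Set.range (toFun i) = {p | p.1 = 0} ∧
    Set.range (toFun j) = toFun q '' (φ ⁻¹' torusTriangle)

/-- The class consisting of the four morphisms of a diagram `S ⟶ T ⟶ Q ⟵ H`, `Q ⟶ R`. -/
inductive Arrows {S T Q H R : FinCW} (i : S ⟶ T) (q : T ⟶ Q) (j : H ⟶ Q) (r : Q ⟶ R) :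
    MorphismProperty FinCW
  | i : Arrows i q j r i
  | q : Arrows i q j r q
  | j : Arrows i q j r j
  | r : Arrows i q j r r

end FinCW

/-! ## The `S_•`-construction -/

section SConstruction

/-- The arrow poset `Ar[n]`: pairs `(a, b)` with `0 ≤ a ≤ b ≤ n`, ordered componentwise. -/
abbrev Ar (n : SimplexCategory) : Type :=
  {p : Fin (n.len + 1) × Fin (n.len + 1) // p.1 ≤ p.2}

/-- The map `Ar[m] → Ar[n]` induced by a map `[m] → [n]`. -/
def arMap {m n : SimplexCategory} (α : m ⟶ n) : Ar m ⥤ Ar n :=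
  Monotone.functor (f := fun p : Ar m =>
      (⟨(α.toOrderHom p.1.1, α.toOrderHom p.1.2), α.toOrderHom.monotone p.2⟩ : Ar n))
    (fun _ _ h => ⟨α.toOrderHom.monotone h.1, α.toOrderHom.monotone h.2⟩)

/-- The morphism `(a, b) ⟶ (a', b')` of `Ar[n]`. -/
def arHom {n : SimplexCategory} {a b a' b' : Fin (n.len + 1)} (h : a ≤ b) (h' : a' ≤ b')
    (ha : a ≤ a') (hb : b ≤ b') : (⟨(a, b), h⟩ : Ar n) ⟶ ⟨(a', b'), h'⟩ :=
  homOfLE ⟨ha, hb⟩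

variable {C : Type u} [Category.{v} C] (cof : MorphismProperty C)

/-- The objects of `S_n C`: functors `A : Ar[n] ⥤ C` such that `A_{a,a}` is a zero object and
`A_{a,b} ↣ A_{a,c} ↠ A_{b,c}` is a cofibration sequence for all `a < b < c` (the zero object
`A_{b,b}` is the fourth corner of the pushout square). -/
def IsSObj (n : SimplexCategory) : ObjectProperty (Ar n ⥤ C) := fun A =>
  (∀ a, IsZero (A.obj ⟨(a, a), le_refl a⟩)) ∧
  ∀ (a b c : Fin (n.len + 1)) (hab : a < b) (hbc : b < c),
    cof (A.map (arHom hab.le (hab.trans hbc).le le_rfl hbc.le)) ∧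
    IsPushout
      (A.map (arHom hab.le (hab.trans hbc).le le_rfl hbc.le))
      (A.map (arHom hab.le le_rfl hab.le le_rfl))
      (A.map (arHom (hab.trans hbc).le hbc.le hab.le le_rfl))
      (A.map (arHom (le_refl b) hbc.le le_rfl hbc.le))

lemma isIso_of_le {n : SimplexCategory} {x y : Ar n} (f : x ⟶ y) (h : y ≤ x) : IsIso f :=
  ⟨homOfLE h, Subsingleton.elim _ _, Subsingleton.elim _ _⟩

lemma IsSObj.of_le {cof} [IsCatWithCof cof] {n : SimplexCategory} {A : Ar n ⥤ C}
    (hA : IsSObj cof n A) {a b c : Fin (n.len + 1)} (hab : a ≤ b) (hbc : b ≤ c) :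
    cof (A.map (arHom hab (hab.trans hbc) le_rfl hbc)) ∧
    IsPushout
      (A.map (arHom hab (hab.trans hbc) le_rfl hbc))
      (A.map (arHom hab le_rfl hab le_rfl))
      (A.map (arHom (hab.trans hbc) hbc hab le_rfl))
      (A.map (arHom (le_refl b) hbc le_rfl hbc)) := by
  have sq : CommSq
      (A.map (arHom hab (hab.trans hbc) le_rfl hbc))
      (A.map (arHom hab le_rfl hab le_rfl))
      (A.map (arHom (hab.trans hbc) hbc hab le_rfl))
      (A.map (arHom (le_refl b) hbc le_rfl hbc)) :=
    ⟨by rw [← A.map_comp, ← A.map_comp]; rfl⟩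
  rcases hab.eq_or_lt with rfl | hab'
  · refine ⟨IsCatWithCof.of_isZero _ (hA.1 a), ?_⟩
    have := isIso_of_le (arHom hab le_rfl hab le_rfl) ⟨le_rfl, le_rfl⟩
    have := isIso_of_le (arHom (hab.trans hbc) hbc hab le_rfl) ⟨le_rfl, le_rfl⟩
    exact IsPushout.of_vert_isIso sq
  · rcases hbc.eq_or_lt with rfl | hbc'
    · have := isIso_of_le (arHom hab (hab.trans hbc) le_rfl hbc) ⟨le_rfl, le_rfl⟩
      have := isIso_of_le (arHom (le_refl b) hbc le_rfl hbc) ⟨le_rfl, le_rfl⟩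
      exact ⟨IsCatWithCof.of_isIso _ inferInstance, IsPushout.of_horiz_isIso sq⟩
    · exact hA.2 a b c hab' hbc'

lemma IsSObj.restrict [IsCatWithCof cof] {m n : SimplexCategory} (α : m ⟶ n) {A : Ar n ⥤ C}
    (hA : IsSObj cof n A) : IsSObj cof m (arMap α ⋙ A) :=
  ⟨fun a => hA.1 (α.toOrderHom a), fun _ _ _ hab hbc =>
    hA.of_le (α.toOrderHom.monotone hab.le) (α.toOrderHom.monotone hbc.le)⟩

/-- The category `S_n C`. -/
abbrev SCat (n : SimplexCategory) : Type (max u v) := (IsSObj cof n).FullSubcategory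

/-- The functor `S_n C ⥤ S_m C` induced by `[m] → [n]`, given by precomposition. -/
def SMap [IsCatWithCof cof] {m n : SimplexCategory} (α : m ⟶ n) : SCat cof n ⥤ SCat cof m :=
  (IsSObj cof m).lift ((IsSObj cof n).ι ⋙ (Functor.whiskeringLeft _ _ C).obj (arMap α))
    (fun A => IsSObj.restrict cof α A.property)

/-- The simplicial category `S_• C`. -/
def SDot [IsCatWithCof cof] : SimplicialObject Cat.{v, max u v} where
  obj n := Cat.of (SCat cof n.unop)
  map α := (SMap cof α.unop).toCatHom
  map_id _ := rfl
  map_comp _ _ := rfl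

/-- The componentwise weak equivalences of `S_n C`. -/
def SWeq (wEq : MorphismProperty C) (n : SimplexCategory) : MorphismProperty (SCat cof n) :=
  fun _ _ f => ∀ x : Ar n, wEq (f.hom.app x)

instance (wEq : MorphismProperty C) [wEq.IsMultiplicative] (n : SimplexCategory) :
    (SWeq cof wEq n).IsMultiplicative where
  id_mem A x := wEq.id_mem (A.obj.obj x)
  comp_mem f g hf hg x := wEq.comp_mem (f.hom.app x) (g.hom.app x) (hf x) (hg x)

/-- The category `w S_n C`: the subcategory of `S_n C` of componentwise weak equivalences. -/
abbrev WSCat (wEq : MorphismProperty C) [wEq.IsMultiplicative] (n : SimplexCategory) :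
    Type (max u v) :=
  WideSubcategory (SWeq cof wEq n)

/-- The functor `w S_n C ⥤ w S_m C` induced by `[m] → [n]`. -/
def WSMap [IsCatWithCof cof] (wEq : MorphismProperty C) [wEq.IsMultiplicative]
    {m n : SimplexCategory} (α : m ⟶ n) : WSCat cof wEq n ⥤ WSCat cof wEq m where
  obj A := ⟨(SMap cof α).obj A.obj⟩
  map f := ⟨(SMap cof α).map f.hom, fun x => f.property ((arMap α).obj x)⟩

/-- The simplicial category `w S_• C`. -/
def WSDot [IsCatWithCof cof] (wEq : MorphismProperty C) [wEq.IsMultiplicative] :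
    SimplicialObject Cat.{v, max u v} where
  obj n := Cat.of (WSCat cof wEq n.unop)
  map α := (WSMap cof wEq α.unop).toCatHom
  map_id _ := rfl
  map_comp _ _ := rfl

end SConstruction

/-! ## Polygonal subdivisions -/

/-- A polygonal subdivision of the convex `(n+1)`-gon `P_n` with cyclically labelled vertices
`0, …, n`, given by its diagonals: a set of pairwise non-crossing diagonals `(a, b)`, `a < b`. -/
structure PolySubdiv (n : ℕ) where
  diagonals : Set (Fin (n + 1) × Fin (n + 1))
  isDiagonal : ∀ d ∈ diagonals, d.1.val + 1 < d.2.val ∧ ¬ (d.1.val = 0 ∧ d.2.val = n)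
  noncrossing : ∀ d ∈ diagonals, ∀ e ∈ diagonals, ¬ (d.1 < e.1 ∧ e.1 < d.2 ∧ d.2 < e.2)

namespace PolySubdiv

variable {n : ℕ} (P : PolySubdiv n)

/-- No diagonal of the subdivision has members of `I` strictly on both of its sides. -/
def Unsplit (I : Finset (Fin (n + 1))) : Prop :=
  ∀ d ∈ P.diagonals, (∀ x ∈ I, d.1 ≤ x ∧ x ≤ d.2) ∨ (∀ x ∈ I, x ≤ d.1 ∨ d.2 ≤ x)

/-- The vertex sets of the polygons of the subdivision, that is, of the regions into which the
diagonals cut `P_n`: the maximal sets of vertices which are not split by a diagonal. -/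
def polygons : Set (Finset (Fin (n + 1))) := {I | Maximal P.Unsplit I}

/-- A triangulation is a polygonal subdivision all of whose polygons are triangles. -/
def IsTriangulation : Prop := ∀ I ∈ P.polygons, I.card = 3

/-- The poset of vertex sets appearing in the subdivision: those of the polygons and those of the
diagonals along which the polygons are glued. -/
structure Cells where
  verts : Finset (Fin (n + 1))
  mem : verts ∈ P.polygons ∨ ∃ d ∈ P.diagonals, verts = {d.1, d.2}

instance : Preorder P.Cells := Preorder.lift Cells.verts

lemma nonempty_of_mem_polygons {I : Finset (Fin (n + 1))} (h : I ∈ P.polygons) : I.Nonempty := by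
  rw [Finset.nonempty_iff_ne_empty]
  rintro rfl
  have h1 : P.Unsplit {0} := by
    intro d _
    rcases le_total (0 : Fin (n + 1)) d.1 with h | h
    · right; simp
    · left
      intro x hx
      rw [Finset.mem_singleton] at hx
      subst hx
      exact ⟨h, Fin.zero_le _⟩
  exact absurd (h.2 h1 (Finset.empty_subset _) (Finset.mem_singleton_self 0))
    (Finset.notMem_empty _)

lemma Cells.nonempty {P : PolySubdiv n} (I : P.Cells) : I.verts.Nonempty := by
  rcases I.mem with h | ⟨d, -, h⟩
  · exact P.nonempty_of_mem_polygons h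
  · rw [h]; exact ⟨d.1, by simp⟩

end PolySubdiv

/-! ## Faces of simplices indexed by vertex sets -/

section Faces

variable {n : ℕ}

/-- The simplex with vertex set `I ⊆ [n]`. -/
def faceObj (I : Finset (Fin (n + 1))) : SimplexCategory := SimplexCategory.mk (I.card - 1)

lemma card_eq {I : Finset (Fin (n + 1))} (hI : I.Nonempty) : I.card = I.card - 1 + 1 :=
  (Nat.sub_add_cancel hI.card_pos).symm

/-- The order-preserving injection `[|I| - 1] → [n]` with image `I`. -/
def faceIncl (I : Finset (Fin (n + 1))) (hI : I.Nonempty) : faceObj I ⟶ SimplexCategory.mk n :=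
  SimplexCategory.Hom.mk (I.orderEmbOfFin (card_eq hI)).toOrderHom

/-- The map `[|I| - 1] → [|J| - 1]` corresponding to an inclusion `I ⊆ J`. -/
def faceMap {I J : Finset (Fin (n + 1))} (hI : I.Nonempty) (hJ : J.Nonempty) (h : I ⊆ J) :
    faceObj I ⟶ faceObj J :=
  SimplexCategory.Hom.mk
    { toFun := fun x => (J.orderIsoOfFin (card_eq hJ)).symm
        ⟨I.orderEmbOfFin (card_eq hI) x, h (I.orderEmbOfFin_mem (card_eq hI) x)⟩
      monotone' := fun _ _ hxy => (J.orderIsoOfFin (card_eq hJ)).symm.monotone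
        (Subtype.mk_le_mk.2 ((I.orderEmbOfFin (card_eq hI)).monotone hxy)) }

lemma faceMap_incl {I J : Finset (Fin (n + 1))} (hI : I.Nonempty) (hJ : J.Nonempty) (h : I ⊆ J) :
    faceMap hI hJ h ≫ faceIncl J hJ = faceIncl I hI := by
  apply SimplexCategory.Hom.ext
  ext x : 2
  change J.orderEmbOfFin (card_eq hJ) ((J.orderIsoOfFin (card_eq hJ)).symm _) = _
  rw [← Finset.coe_orderIsoOfFin_apply, OrderIso.apply_symm_apply]
  rfl

instance (I : Finset (Fin (n + 1))) (hI : I.Nonempty) : Mono (faceIncl I hI) := by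
  rw [SimplexCategory.mono_iff_injective]
  exact (I.orderEmbOfFin (card_eq hI)).injective

/-- The diagram of simplices `I ↦ [|I| - 1]` on the poset of vertex sets of a subdivision. -/
def faceFunctor (P : PolySubdiv n) : P.Cells ⥤ SimplexCategory where
  obj I := faceObj I.verts
  map {I J} f := faceMap I.nonempty J.nonempty (show I.verts ⊆ J.verts from leOfHom f)
  map_id I := by rw [← cancel_mono (faceIncl I.verts I.nonempty), faceMap_incl, Category.id_comp]
  map_comp {I J K} f g := by
    rw [← cancel_mono (faceIncl K.verts K.nonempty), Category.assoc, faceMap_incl, faceMap_incl,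
      faceMap_incl]

/-- For a simplicial object `X`, the cone from `X_n` over the diagram `I ↦ X_I`, given by the
inclusions of the vertex sets of a subdivision into `[n]`. -/
def faceCone {E : Type u} [Category.{v} E] (X : SimplicialObject E) (P : PolySubdiv n) :
    Cone ((faceFunctor P).op ⋙ X) where
  pt := X.obj (op (SimplexCategory.mk n))
  π :=
    { app := fun I => X.map (faceIncl I.unop.verts I.unop.nonempty).op
      naturality := fun I J f => by
        have h := faceMap_incl J.unop.nonempty I.unop.nonempty
          (show J.unop.verts ⊆ I.unop.verts from leOfHom f.unop)
        refine (Category.id_comp _).trans ?_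
        exact (congrArg (fun g => X.map g.op) h).symm.trans (X.map_comp _ _) }

end Faces

/-! ## Projective 2-limits and strict fibre products of categories -/

section TwoLim

variable {J : Type w} [Category.{w} J]

/-- The projective 2-limit of a diagram of categories (a model of its homotopy limit in the
canonical model structure): an object is a family of objects `y_a` with isomorphisms
`y_f : f_* y_a ≅ y_b` for `f : a ⟶ b` such that `y_{gf} = y_g ∘ g_* y_f`. -/
structure TwoLim (F : J ⥤ Cat.{v, u}) where
  obj : ∀ a : J, F.obj a
  iso : ∀ {a b : J} (f : a ⟶ b), (F.map f).toFunctor.obj (obj a) ≅ obj b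
  iso_comp : ∀ {a b c : J} (f : a ⟶ b) (g : b ⟶ c),
    (iso (f ≫ g)).hom = eqToHom (by rw [F.map_comp]; rfl) ≫
      (F.map g).toFunctor.map (iso f).hom ≫ (iso g).hom

namespace TwoLim

variable {F : J ⥤ Cat.{v, u}}

/-- Morphisms in the projective 2-limit: families of morphisms compatible with the structural
isomorphisms. -/
@[ext]
structure Hom (y z : TwoLim F) where
  app : ∀ a : J, y.obj a ⟶ z.obj a
  comm : ∀ {a b : J} (f : a ⟶ b),
    (F.map f).toFunctor.map (app a) ≫ (z.iso f).hom = (y.iso f).hom ≫ app b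

instance : Category (TwoLim F) where
  Hom y z := Hom y z
  id y := ⟨fun a => 𝟙 (y.obj a), fun f => by simp⟩
  comp s t := ⟨fun a => s.app a ≫ t.app a, fun f => by
    rw [Functor.map_comp, Category.assoc, t.comm, ← Category.assoc, s.comm, Category.assoc]⟩
  id_comp s := Hom.ext (funext fun a => Category.id_comp (s.app a))
  comp_id s := Hom.ext (funext fun a => Category.comp_id (s.app a))
  assoc s t r := Hom.ext (funext fun a => Category.assoc (s.app a) (t.app a) (r.app a))

end TwoLim

lemma cone_obj_eq {F : J ⥤ Cat.{v, u}} (c : Cone F) {a b : J} (f : a ⟶ b) (x : c.pt) :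
    (F.map f).toFunctor.obj ((c.π.app a).toFunctor.obj x) = (c.π.app b).toFunctor.obj x := by
  rw [← c.w f]; rfl

/-- The functor from the apex of a cone to the projective 2-limit. -/
def twoLimLift {F : J ⥤ Cat.{v, u}} (c : Cone F) : c.pt ⥤ TwoLim F where
  obj x :=
    { obj := fun a => (c.π.app a).toFunctor.obj x
      iso := fun f => eqToIso (cone_obj_eq c f x)
      iso_comp := fun f g => by simp [eqToHom_map] }
  map {x y} s :=
    { app := fun a => (c.π.app a).toFunctor.map s
      comm := fun {a b} f => by
        have := Functor.congr_hom (congrArg Cat.Hom.toFunctor (c.w f)) s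
        simp only [Cat.Hom.comp_toFunctor, Functor.comp_map] at this
        simp [this] }
  map_id x := TwoLim.Hom.ext (funext fun a => (c.π.app a).toFunctor.map_id x)
  map_comp s t := TwoLim.Hom.ext (funext fun a => (c.π.app a).toFunctor.map_comp s t)

/-- The strict fibre product of two functors: its objects are the pairs of objects with equal
images, its morphisms the pairs of morphisms with equal images. -/
structure StrictPullback {A B E : Type u} [Category.{v} A] [Category.{v} B] [Category.{v} E]
    (F : A ⥤ E) (G : B ⥤ E) where
  fst : A
  snd : B
  eq : F.obj fst = G.obj snd

namespace StrictPullback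

variable {A B E : Type u} [Category.{v} A] [Category.{v} B] [Category.{v} E]
  {F : A ⥤ E} {G : B ⥤ E}

/-- Morphisms in the strict fibre product. -/
@[ext]
structure Hom (x y : StrictPullback F G) where
  fst : x.fst ⟶ y.fst
  snd : x.snd ⟶ y.snd
  eq : F.map fst ≫ eqToHom y.eq = eqToHom x.eq ≫ G.map snd

instance : Category (StrictPullback F G) where
  Hom x y := Hom x y
  id x := ⟨𝟙 x.fst, 𝟙 x.snd, by simp⟩
  comp s t := ⟨s.fst ≫ t.fst, s.snd ≫ t.snd, by
    rw [Functor.map_comp, Category.assoc, t.eq, ← Category.assoc, s.eq, Category.assoc,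
      ← Functor.map_comp]⟩
  id_comp s := Hom.ext (Category.id_comp s.fst) (Category.id_comp s.snd)
  comp_id s := Hom.ext (Category.comp_id s.fst) (Category.comp_id s.snd)
  assoc s t r := Hom.ext (Category.assoc s.fst t.fst r.fst) (Category.assoc s.snd t.snd r.snd)

end StrictPullback

/-- For a simplicial category `X` and vertex sets `K ⊆ I` and `K ⊆ J` in `[n]`, the canonical
functor from `X_n` to the strict fibre product of `X_I` and `X_J` over `X_K`. -/
def toStrictPullback (X : SimplicialObject Cat.{v, u}) {n : ℕ} {I J K : Finset (Fin (n + 1))}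
    (hI : I.Nonempty) (hJ : J.Nonempty) (hK : K.Nonempty) (hKI : K ⊆ I) (hKJ : K ⊆ J) :
    X.obj (op (SimplexCategory.mk n)) ⥤
      StrictPullback (X.map (faceMap hK hI hKI).op).toFunctor
        (X.map (faceMap hK hJ hKJ).op).toFunctor :=
  have e : X.map (faceIncl I hI).op ≫ X.map (faceMap hK hI hKI).op =
      X.map (faceIncl J hJ).op ≫ X.map (faceMap hK hJ hKJ).op := by
    rw [← X.map_comp, ← X.map_comp, ← op_comp, ← op_comp, faceMap_incl, faceMap_incl]
  { obj := fun x =>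
      { fst := (X.map (faceIncl I hI).op).toFunctor.obj x
        snd := (X.map (faceIncl J hJ).op).toFunctor.obj x
        eq := Functor.congr_obj (congrArg Cat.Hom.toFunctor e) x }
    map := fun {x y} s =>
      { fst := (X.map (faceIncl I hI).op).toFunctor.map s
        snd := (X.map (faceIncl J hJ).op).toFunctor.map s
        eq := by
          have := Functor.congr_hom (congrArg Cat.Hom.toFunctor e) s
          simp only [Cat.Hom.comp_toFunctor, Functor.comp_map] at this
          simp [this] }
    map_id := fun x => StrictPullback.Hom.ext
      ((X.map (faceIncl I hI).op).toFunctor.map_id x)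
      ((X.map (faceIncl J hJ).op).toFunctor.map_id x)
    map_comp := fun s t => StrictPullback.Hom.ext
      ((X.map (faceIncl I hI).op).toFunctor.map_comp s t)
      ((X.map (faceIncl J hJ).op).toFunctor.map_comp s t) }

end TwoLim

/-! ## Homotopy limits of spaces and weak homotopy equivalences -/

section Spaces

variable {J : Type} [SmallCategory J]

/-- The realization of the nerve of the category `J/a`. -/
def overSpace (a : J) : TopCat.{0} := SSet.toTop.obj (nerve (Over a))

/-- The map of realizations induced by the functor `J/a ⥤ J/b` for `f : a ⟶ b`. -/
def overSpaceMap {a b : J} (f : a ⟶ b) : overSpace a ⟶ overSpace b :=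
  SSet.toTop.map (nerveMap (Over.map f))

/-- The homotopy limit of a diagram of spaces (Bousfield-Kan formula): the space of families of
continuous maps `σ_a : |N(J/a)| → F a` which are natural in `a`. -/
def Holim (F : J ⥤ TopCat.{u}) : Type u :=
  {σ : ∀ a : J, C(overSpace a, F.obj a) //
    ∀ (a b : J) (f : a ⟶ b), (F.map f).hom.comp (σ a) = (σ b).comp (overSpaceMap f).hom}

instance (F : J ⥤ TopCat.{u}) : TopologicalSpace (Holim F) :=
  inferInstanceAs (TopologicalSpace (Subtype _))

/-- The map from the apex of a cone to the homotopy limit, given by constant maps. -/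
def holimLift {F : J ⥤ TopCat.{u}} (c : Cone F) : C(c.pt, Holim F) where
  toFun x := ⟨fun a => ContinuousMap.const _ ((c.π.app a).hom x), fun a b f => by
    ext y
    exact congrArg (fun g => g.hom x) (c.w f)⟩
  continuous_toFun := Continuous.subtype_mk (continuous_pi fun a =>
    ContinuousMap.continuous_const'.comp (c.π.app a).hom.continuous) _

variable {X : Type u} {Y : Type v} [TopologicalSpace X] [TopologicalSpace Y]

/-- The map induced on path components. -/
def mapPi0 (f : C(X, Y)) : ZerothHomotopy X → ZerothHomotopy Y :=
  Quotient.map f fun _ _ ⟨p⟩ => ⟨p.map f.continuous⟩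

/-- The map induced on homotopy groups. -/
def mapPi (f : C(X, Y)) (n : ℕ) (x : X) :
    HomotopyGroup.Pi n X x → HomotopyGroup.Pi n Y (f x) :=
  Quotient.map (fun p => ⟨f.comp p.1, fun y hy => congrArg f (p.2 y hy)⟩)
    fun _ _ h => h.map fun H => H.compContinuousMap f

/-- Weak homotopy equivalences: bijective on path components and on all homotopy groups at all
base points. -/
def IsWeakEquiv (f : C(X, Y)) : Prop :=
  Function.Bijective (mapPi0 f) ∧ ∀ (n : ℕ) (x : X), 1 ≤ n → Function.Bijective (mapPi f n x)

end Spaces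

/-! ## 2-Segal maps -/

/-- The 2-Segal map `f_P` of a simplicial category: the canonical functor from `X_n` to the
homotopy limit of the categories `X_I`, for `I` a vertex set appearing in the subdivision `P`. -/
def segalFunctor (X : SimplicialObject Cat.{v, u}) {n : ℕ} (P : PolySubdiv n) :
    X.obj (op (SimplexCategory.mk n)) ⥤ TwoLim ((faceFunctor P).op ⋙ X) :=
  twoLimLift (faceCone X P)

/-- A simplicial category is 2-Segal if all its 2-Segal maps are equivalences of categories. -/
def IsTwoSegalCat (X : SimplicialObject Cat.{v, u}) : Prop :=
  ∀ n : ℕ, 2 ≤ n → ∀ P : PolySubdiv n, (segalFunctor X P).IsEquivalence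

/-- The 2-Segal map `f_P` of a simplicial space. -/
def segalMap (X : SimplicialObject TopCat.{u}) {n : ℕ} (P : PolySubdiv n) :
    C(X.obj (op (SimplexCategory.mk n)), Holim ((faceFunctor P).op ⋙ X)) :=
  holimLift (faceCone X P)

/-- A simplicial space is 2-Segal if all its 2-Segal maps are weak homotopy equivalences. -/
def IsTwoSegalTop (X : SimplicialObject TopCat.{u}) : Prop :=
  ∀ n : ℕ, 2 ≤ n → ∀ P : PolySubdiv n, IsWeakEquiv (segalMap X P)

/-- The levelwise geometric realization of a simplicial category. -/
def realization (X : SimplicialObject Cat.{v, u}) : SimplicialObject TopCat.{max v u} :=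
  X ⋙ nerveFunctor ⋙ SSet.toTop

/-- For a simplicial category `X` and `n ≥ 1`, the canonical functor
`X_n ⥤ X_{0,1,n} ×_{X_{1,n}} X_{1,…,n}` to the strict fibre product. -/
def cornerFunctor (X : SimplicialObject Cat.{v, u}) (n : ℕ) (hn : 1 ≤ n) :=
  toStrictPullback X (n := n)
    (I := {0, ⟨1, Nat.lt_succ_of_le hn⟩, Fin.last n})
    (J := Finset.Ici ⟨1, Nat.lt_succ_of_le hn⟩)
    (K := {⟨1, Nat.lt_succ_of_le hn⟩, Fin.last n})
    ⟨0, by simp⟩ ⟨Fin.last n, by simp [Fin.le_last]⟩ ⟨Fin.last n, by simp⟩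
    (by intro x hx; simp only [Finset.mem_insert, Finset.mem_singleton] at hx ⊢; tauto)
    (by
      intro x hx
      simp only [Finset.mem_insert, Finset.mem_singleton] at hx
      rcases hx with rfl | rfl
      · simp
      · simp [Fin.le_last])

end TwoSegal

end

/-!
The two cofibration sequences `S¹ ↣ T² ↠ T²/S¹` and `Δ̂ ↣ T²/S¹ ↠ S²` look like the faces `{0,1,3}`
and `{1,2,3}` of a 3-simplex of `S_•`. The missing entry `(0,2)` of such a 3-simplex would be the
kernel of `T² ↠ S²`, that is, the closed triangle in the torus, and this complex is not in the
generated category `𝒟`.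

To see this, `𝒟` is compared with a subcategory which is defined explicitly. Say that a complex has
even boundaries (`EvenBdry`) if every set of at least three 1-cells is the boundary of an even
number of 2-cells, where the boundary of a 2-cell is the set of the 1-cells that meet its closure.
The torus has this property, since its two triangles are bounded by the same three edges, and so
have the circle, the pinched triangle, the pinched torus and the sphere. The property is inherited
by pushouts along cofibrations if the maps are cell-preserving (`evenBdry_po`), because the number
of 2-cells with given boundary is additive modulo 2 and boundaries do not grow under such maps.
Hence the complexes with even boundaries and the cell-preserving maps form a subcategory with
cofibrations (`isSubcatWithCof_evenSubcat`) which contains the four given morphisms (`arrows_le`).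
Therefore the intersection `𝒟` is a subcategory with cofibrations (`isSubcatWithCof_generated`), and
all its objects have even boundaries. A subcomplex of the torus with quotient `S²` has a single
2-cell, bounded by three edges, so there is no cofibration sequence in `𝒟` with middle term `T²` and
quotient `S²` (`not_isCokernelOf_of_evenBdry`, `torusSeqPair_obstructed`).

The partial 3-simplex (`SeqPair.diagram`) can be restricted along all maps to `[3]` which do not
hit both `0` and `2`. If some polygon of a subdivision does not contain the vertex `0`, let `(p,
r)` be a longest diagonal not ending at `0`. The map `[n] → [3]` which sends the vertices below
`p` to `0`, the vertices from `r` on to `3`, the vertex `r - 1` to `2` and the others to `1` has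
this property on each polygon, and it yields a compatible family on the polygons which does not
come from an `n`-simplex: the latter would contain a cofibration sequence as excluded above, with
`(0, r)` and `(r - 1, r)` both contained in polygons (`exists_not_restrict`). This family is
strictly compatible, so it is an object of the 2-limit and of the fibre product, and since
isomorphisms of such objects are levelwise isomorphisms, it is not in the essential image,
whatever the weak equivalences are.

In contrast, all the spaces `|S_n 𝒟|` are contractible, because `S_n 𝒟` has an initial object, the
constant diagram at a zero object. These initial objects are preserved strictly by the simplicial
operators. Consequently the contractions, which come from the extra degeneracies of the nerves
(`nerveConing`, `Coning.contraction`), are compatible with the simplicial structure, the homotopy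
limits are contractible as well (`Contraction.holim`), and every map between contractible spaces is
a weak homotopy equivalence (`Contraction.isWeakEquiv`).
-/

noncomputable section

namespace TwoSegal

universe w v u

/-! ### Cells of finite based CW complexes -/

/-- If `f` is continuous on the closed unit ball, injective on the open ball and does not map a
boundary point to the image of the open ball, then its inverse is continuous on that image. -/
lemma continuousOn_invFunOn_ball {n : ℕ} {X : Type*} [TopologicalSpace X] [T2Space X]
    {f : (Fin n → ℝ) → X} (hf : ContinuousOn f (Metric.closedBall 0 1))
    (hi : Set.InjOn f (Metric.ball 0 1))
    (hb : ∀ x ∈ Metric.sphere (0 : Fin n → ℝ) 1, f x ∉ f '' Metric.ball 0 1) :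
    ContinuousOn (Function.invFunOn f (Metric.ball 0 1)) (f '' Metric.ball 0 1) := by
  rw [continuousOn_iff_isClosed]
  intro C hC
  have hcl : IsClosed (f '' (C ∩ Metric.closedBall 0 1)) :=
    (((isCompact_closedBall (0 : Fin n → ℝ) 1).inter_left hC).image_of_continuousOn
      (hf.mono Set.inter_subset_right)).isClosed
  refine ⟨_, hcl, ?_⟩
  ext y
  constructor
  · rintro ⟨h, x, hx, rfl⟩
    refine ⟨⟨x, ⟨?_, Metric.ball_subset_closedBall hx⟩, rfl⟩, ⟨x, hx, rfl⟩⟩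
    rw [Set.mem_preimage, hi.leftInvOn_invFunOn hx] at h
    exact h
  · rintro ⟨⟨x, ⟨hxC, hxb⟩, rfl⟩, hx⟩
    have hxb' : x ∈ Metric.ball (0 : Fin n → ℝ) 1 := by
      rw [← Metric.ball_union_sphere] at hxb
      exact hxb.resolve_right fun h => hb x h hx
    refine ⟨?_, hx⟩
    rw [Set.mem_preimage, hi.leftInvOn_invFunOn hxb']
    exact hxC

/-- A decomposition of a space into finitely many open cells, given by characteristic maps. The
inverses of the characteristic maps are not part of the data, and boundary points are required to
lie in open cells of lower dimension. -/
structure CellDecomp (X : Type) [TopologicalSpace X] where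
  ι : ℕ → Type
  map : ∀ n, ι n → (Fin n → ℝ) → X
  finite : Finite (Σ n, ι n)
  cont : ∀ n i, ContinuousOn (map n i) (Metric.closedBall 0 1)
  inj : ∀ n i, Set.InjOn (map n i) (Metric.ball 0 1)
  unique : ∀ (a b : Σ n, ι n), ∀ x ∈ Metric.ball (0 : Fin a.1 → ℝ) 1,
    ∀ y ∈ Metric.ball (0 : Fin b.1 → ℝ) 1, map a.1 a.2 x = map b.1 b.2 y → a = b
  bdry : ∀ n i, ∀ x ∈ Metric.sphere (0 : Fin n → ℝ) 1,
    ∃ m < n, ∃ j, map n i x ∈ map m j '' Metric.ball 0 1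
  cover : ∀ x, ∃ n i, x ∈ map n i '' Metric.ball 0 1

namespace CellDecomp

variable {X : Type} [TopologicalSpace X] (K : CellDecomp X)

/-- The characteristic map of a cell as a partial equivalence defined on the open ball. -/
def pe (n : ℕ) (i : K.ι n) : PartialEquiv (Fin n → ℝ) X :=
  (K.inj n i).toPartialEquiv

lemma exists_bound : ∃ N, ∀ n, N ≤ n → IsEmpty (K.ι n) := by
  have := K.finite
  obtain ⟨N, hN⟩ := (Set.finite_range (fun a : Σ n, K.ι n => a.1)).bddAbove
  refine ⟨N + 1, fun n hn => ⟨fun i => ?_⟩⟩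
  have := hN ⟨⟨n, i⟩, rfl⟩
  simp only at this
  omega

lemma eventually_isEmpty : ∀ᶠ n in Filter.atTop, IsEmpty (K.ι n) :=
  Filter.eventually_atTop.2 K.exists_bound

lemma finite_ι (n : ℕ) : Finite (K.ι n) :=
  have := K.finite
  Finite.of_injective (fun i => (⟨n, i⟩ : Σ n, K.ι n)) sigma_mk_injective

lemma continuousOn_symm [T2Space X] (n : ℕ) (i : K.ι n) :
    ContinuousOn (K.pe n i).symm (K.pe n i).target := by
  refine continuousOn_invFunOn_ball (K.cont n i) (K.inj n i) fun x hx => ?_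
  rintro ⟨y, hy, hxy⟩
  obtain ⟨m, hm, j, z, hz, hzx⟩ := K.bdry n i x hx
  have := congrArg Sigma.fst (K.unique ⟨n, i⟩ ⟨m, j⟩ y hy z hz (hxy.trans hzx.symm))
  simp only at this
  omega

lemma pairwiseDisjoint : (Set.univ : Set (Σ n, K.ι n)).PairwiseDisjoint
    (fun ni ↦ K.pe ni.1 ni.2 '' Metric.ball 0 1) := by
  intro a _ b _ hab
  rw [Function.onFun, Set.disjoint_left]
  rintro _ ⟨x, hx, rfl⟩ ⟨y, hy, hxy⟩
  exact hab (K.unique a b x hx y hy hxy.symm)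

lemma mapsTo (n : ℕ) (i : K.ι n) : Set.MapsTo (K.pe n i) (Metric.sphere 0 1)
    (⋃ (m < n) (j : K.ι m), K.pe m j '' Metric.closedBall 0 1) := by
  intro x hx
  obtain ⟨m, hm, j, hj⟩ := K.bdry n i x hx
  simp only [Set.mem_iUnion]
  exact ⟨m, hm, j, Set.image_mono Metric.ball_subset_closedBall hj⟩

lemma union : ⋃ (n : ℕ) (j : K.ι n), K.pe n j '' Metric.closedBall 0 1 = Set.univ := by
  rw [Set.eq_univ_iff_forall]
  intro x
  obtain ⟨m, j, hj⟩ := K.cover x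
  simp only [Set.mem_iUnion]
  exact ⟨m, j, Set.image_mono Metric.ball_subset_closedBall hj⟩

/-- The CW structure given by a cell decomposition. -/
abbrev cw [T2Space X] : CWComplex (Set.univ : Set X) :=
  CWComplex.mkFinite _ K.ι K.pe K.eventually_isEmpty K.finite_ι (fun _ _ => rfl) K.cont
    K.continuousOn_symm K.pairwiseDisjoint K.mapsTo K.union

lemma cw_finite [T2Space X] : letI := K.cw; CWComplex.Finite (Set.univ : Set X) :=
  CWComplex.finite_mkFinite _ K.ι K.pe K.eventually_isEmpty K.finite_ι (fun _ _ => rfl) K.cont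
    K.continuousOn_symm K.pairwiseDisjoint K.mapsTo K.union

/-- The finite based CW complex given by a cell decomposition and a 0-cell `x`. Points of
`Fin 0 → ℝ` are all `0`, so `K.map 0 i 0` is the single point of the 0-cell `i`. -/
def toFinCW [T2Space X] (x : X) (hx : ∃ i, K.map 0 i 0 = x) : FinCW :=
  letI := K.cw
  haveI := K.cw_finite
  { carrier := X
    base := x
    base_mem := by
      obtain ⟨i, rfl⟩ := hx
      exact CWComplex.closedCell_subset_skeleton (C := Set.univ) 0 i ⟨0, by simp, rfl⟩ }

end CellDecomp

namespace FinCW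

variable {X Y Z : FinCW}

/-- The cells of all dimensions; the first component is the dimension. -/
abbrev Cell (X : FinCW) : Type := Σ n, RelCWComplex.cell (Set.univ : Set X) n

/-- The open cell as a subset. -/
def op (a : X.Cell) : Set X := RelCWComplex.openCell a.1 a.2

/-- The closed cell as a subset. -/
def cl (a : X.Cell) : Set X := RelCWComplex.closedCell a.1 a.2

instance (X : FinCW) : Finite X.Cell := CWComplex.finite_cells_of_finite (finite := X.fin)

lemma op_subset_cl (a : X.Cell) : op a ⊆ cl a := RelCWComplex.openCell_subset_closedCell _ _

lemma op_nonempty (a : X.Cell) : (op a).Nonempty := RelCWComplex.openCell_nonempty _ _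

lemma isCompact_cl (a : X.Cell) : IsCompact (cl a) := RelCWComplex.isCompact_closedCell

lemma closure_op (a : X.Cell) : closure (op a) = cl a :=
  RelCWComplex.closure_openCell_eq_closedCell

lemma exists_mem_op (x : X) : ∃ a : X.Cell, x ∈ op a := by
  have h : x ∈ ⋃ (n : ℕ) (j : RelCWComplex.cell (Set.univ : Set X) n),
      RelCWComplex.openCell n j := by
    rw [CWComplex.iUnion_openCell_eq_complex]; trivial
  simp only [Set.mem_iUnion] at h
  obtain ⟨n, j, h⟩ := h
  exact ⟨⟨n, j⟩, h⟩

lemma cell_unique {a b : X.Cell} {x : X} (ha : x ∈ op a) (hb : x ∈ op b) : a = b :=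
  RelCWComplex.eq_of_not_disjoint_openCell (Set.not_disjoint_iff.2 ⟨x, ha, hb⟩)

lemma op_injective : Function.Injective (op : X.Cell → Set X) := fun a b h => by
  obtain ⟨x, hx⟩ := op_nonempty a
  exact cell_unique hx (h ▸ hx)

lemma mem_skel {x : X} {n : ℕ} : x ∈ X.skel n ↔ ∃ a : X.Cell, a.1 ≤ n ∧ x ∈ op a := by
  rw [skel, SetLike.mem_coe, CWComplex.mem_skeleton_iff]
  constructor
  · rintro ⟨m, hm, j, h⟩
    exact ⟨⟨m, j⟩, by exact_mod_cast hm, h⟩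
  · rintro ⟨⟨m, j⟩, hm, h⟩
    exact ⟨m, by exact_mod_cast hm, j, h⟩

lemma mem_skel_iff_of_mem_op {x : X} {a : X.Cell} (ha : x ∈ op a) {n : ℕ} :
    x ∈ X.skel n ↔ a.1 ≤ n := by
  rw [mem_skel]
  exact ⟨fun ⟨b, hb, hx⟩ => cell_unique hx ha ▸ hb, fun h => ⟨a, h, ha⟩⟩

/-- The boundary of a cell lies in the open cells of lower dimension. -/
lemma mem_cl {a : X.Cell} {x : X} (hx : x ∈ cl a) :
    x ∈ op a ∨ ∃ b : X.Cell, b.1 < a.1 ∧ x ∈ op b := by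
  rw [cl, ← RelCWComplex.cellFrontier_union_openCell_eq_closedCell] at hx
  refine hx.symm.imp_right fun h => ?_
  have := RelCWComplex.cellFrontier_subset_skeletonLT a.1 a.2 h
  rw [SetLike.mem_coe, CWComplex.mem_skeletonLT_iff] at this
  obtain ⟨m, hm, j, h⟩ := this
  exact ⟨⟨m, j⟩, by exact_mod_cast hm, h⟩

lemma cl_subset_skel (a : X.Cell) : cl a ⊆ X.skel a.1 := fun x hx => by
  rcases mem_cl hx with h | ⟨b, hb, h⟩
  · exact mem_skel.2 ⟨a, le_rfl, h⟩
  · exact mem_skel.2 ⟨b, hb.le, h⟩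

instance (X : FinCW) : CompactSpace X where
  isCompact_univ := by
    have : (Set.univ : Set X) = ⋃ a : X.Cell, cl a := by
      symm
      rw [Set.eq_univ_iff_forall]
      intro x
      obtain ⟨a, ha⟩ := exists_mem_op x
      exact Set.mem_iUnion.2 ⟨a, op_subset_cl a ha⟩
    rw [this]
    exact isCompact_iUnion isCompact_cl

lemma op_zero {a : X.Cell} (ha : a.1 = 0) {x : X} (hx : x ∈ op a) : op a = {x} := by
  obtain ⟨n, a⟩ := a
  obtain rfl : n = 0 := ha
  obtain ⟨y, hy⟩ : ∃ y, op ⟨0, a⟩ = {y} := ⟨_, RelCWComplex.openCell_zero_eq_singleton⟩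
  rw [hy] at hx ⊢
  rw [hx]

lemma exists_base_cell (X : FinCW) : ∃ a : X.Cell, a.1 = 0 ∧ op a = {X.base} := by
  obtain ⟨a, ha, hx⟩ := mem_skel.1 (show X.base ∈ X.skel 0 from X.base_mem)
  exact ⟨a, by omega, op_zero (by omega) hx⟩

/-- The cell which is the base point. -/
def baseCell (X : FinCW) : X.Cell := X.exists_base_cell.choose

lemma baseCell_dim (X : FinCW) : X.baseCell.1 = 0 := X.exists_base_cell.choose_spec.1

lemma op_baseCell (X : FinCW) : op X.baseCell = {X.base} := X.exists_base_cell.choose_spec.2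

lemma toFun_comp (f : X ⟶ Y) (g : Y ⟶ Z) (x : X) : toFun (f ≫ g) x = toFun g (toFun f x) := rfl

lemma toFun_base (f : X ⟶ Y) : toFun f X.base = Y.base := Hom.map_base f

lemma hom_ext {f g : X ⟶ Y} (h : ∀ x, toFun f x = toFun g x) : f = g :=
  Hom.ext (ContinuousMap.ext h)

lemma image_cl {f : X ⟶ Y} {a : X.Cell} {b : Y.Cell} (h : toFun f '' op a = op b) :
    toFun f '' cl a = cl b := by
  rw [← closure_op, ← closure_op, ← h,
    (toFun f).continuous.isClosedMap.closure_image_eq_of_continuous (toFun f).continuous]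

/-- Cellular maps do not raise the dimension of the cell containing a point. -/
lemma dim_le (f : X ⟶ Y) {x : X} {a : X.Cell} {b : Y.Cell} (ha : x ∈ op a)
    (hb : toFun f x ∈ op b) : b.1 ≤ a.1 :=
  (mem_skel_iff_of_mem_op hb).1 (Hom.cellular f _ ((mem_skel_iff_of_mem_op ha).2 le_rfl))

lemma isConnected_op (a : X.Cell) : _root_.IsConnected (op a) := by
  have h1 : _root_.IsConnected (Metric.ball (0 : Fin a.1 → ℝ) 1) :=
    (convex_ball _ _).isConnected ⟨0, Metric.mem_ball_self one_pos⟩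
  exact h1.image _ ((RelCWComplex.continuousOn a.1 a.2).mono Metric.ball_subset_closedBall)

/-- The complement of an open cell in the skeleton of its dimension is closed. -/
lemma isClosed_skel_diff_op (a : X.Cell) : IsClosed (X.skel a.1 \ op a) := by
  have : X.skel a.1 \ op a = ⋃ b : {b : X.Cell // b.1 ≤ a.1 ∧ b ≠ a}, cl b.1 \ op a := by
    ext x
    simp only [Set.mem_sdiff, Set.mem_iUnion]
    constructor
    · rintro ⟨h, hx⟩
      obtain ⟨b, hb, hxb⟩ := mem_skel.1 h
      exact ⟨⟨b, hb, fun e => hx (e ▸ hxb)⟩, op_subset_cl b hxb, hx⟩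
    · rintro ⟨⟨b, hb, _⟩, h, hx⟩
      refine ⟨?_, hx⟩
      obtain ⟨c, hc, hxc⟩ := mem_skel.1 (cl_subset_skel b h)
      exact mem_skel.2 ⟨c, hc.trans hb, hxc⟩
  rw [this]
  refine isClosed_iUnion_of_finite ?_
  rintro ⟨b, hb, hne⟩
  have : cl b \ op a = cl b := by
    rw [sdiff_eq_left, Set.disjoint_left]
    intro x hx hxa
    rcases mem_cl hx with h | ⟨c, hc, h⟩
    · exact hne (cell_unique h hxa)
    · have := cell_unique h hxa
      subst this
      omega
  rw [this]
  exact (isCompact_cl b).isClosed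

/-- A connected set of points lying in open cells of dimension `n` lies in a single one. -/
lemma subset_op_of_isPreconnected {n : ℕ} {s : Set X} (hs : IsPreconnected s)
    (h : ∀ x ∈ s, ∃ a : X.Cell, a.1 = n ∧ x ∈ op a) {a : X.Cell} {x : X} (hx : x ∈ s)
    (hxa : x ∈ op a) : s ⊆ op a := by
  have ha : a.1 = n := by
    obtain ⟨b, hb, hxb⟩ := h x hx
    rw [cell_unique hxa hxb, hb]
  by_contra hcon
  obtain ⟨y, hy, hya⟩ := Set.not_subset.1 hcon
  have hmem : ∀ z ∈ s, z ∈ X.skel a.1 := fun z hz => by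
    obtain ⟨b, hb, hzb⟩ := h z hz
    exact mem_skel.2 ⟨b, (hb.trans ha.symm).le, hzb⟩
  obtain ⟨z, hz, hzu, hzv⟩ := isPreconnected_closed_iff.1 hs _ _ (isCompact_cl a).isClosed
    (isClosed_skel_diff_op a) (fun z hz => by
      by_cases hza : z ∈ op a
      · exact Or.inl (op_subset_cl a hza)
      · exact Or.inr ⟨hmem z hz, hza⟩) ⟨x, hx, op_subset_cl a hxa⟩ ⟨y, hy, hmem y hy, hya⟩
  obtain ⟨b, hb, hzb⟩ := h z hz
  rcases mem_cl hzu with h' | ⟨c, hc, h'⟩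
  · exact hzv.2 h'
  · have := cell_unique h' hzb
    subst this
    omega

/-- The dimension of the cell containing a point is invariant under isomorphisms. -/
lemma dim_eq_of_iso (e : X ≅ Y) {x : X} {a : X.Cell} {b : Y.Cell} (ha : x ∈ op a)
    (hb : toFun e.hom x ∈ op b) : b.1 = a.1 := by
  refine le_antisymm (dim_le e.hom ha hb) (dim_le e.inv hb ?_)
  rw [← toFun_comp, e.hom_inv_id]
  exact ha

/-- Isomorphisms carry an open cell into an open cell, because it is connected. -/
lemma image_subset_of_iso (e : X ≅ Y) {x : X} {a : X.Cell} {b : Y.Cell} (ha : x ∈ op a)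
    (hb : toFun e.hom x ∈ op b) : toFun e.hom '' op a ⊆ op b := by
  refine subset_op_of_isPreconnected (n := a.1)
    ((isConnected_op a).isPreconnected.image _ (toFun e.hom).continuous.continuousOn) ?_
    (Set.mem_image_of_mem _ ha) hb
  rintro _ ⟨y, hy, rfl⟩
  obtain ⟨c, hc⟩ := exists_mem_op (toFun e.hom y)
  exact ⟨c, dim_eq_of_iso e hy hc, hc⟩

/-- Isomorphisms carry open cells onto open cells. -/
lemma image_op_of_iso (e : X ≅ Y) (a : X.Cell) :
    ∃ b : Y.Cell, b.1 = a.1 ∧ toFun e.hom '' op a = op b := by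
  obtain ⟨x, hx⟩ := op_nonempty a
  obtain ⟨b, hb⟩ := exists_mem_op (toFun e.hom x)
  have hinv : ∀ y, toFun e.hom (toFun e.inv y) = y := fun y => by
    rw [← toFun_comp, e.inv_hom_id]; rfl
  have hx' : toFun e.inv (toFun e.hom x) ∈ op a := by
    rw [← toFun_comp, e.hom_inv_id]; exact hx
  refine ⟨b, dim_eq_of_iso e hx hb, (image_subset_of_iso e hx hb).antisymm fun y hy => ?_⟩
  exact ⟨toFun e.inv y, image_subset_of_iso e.symm hb hx' (Set.mem_image_of_mem _ hy), hinv y⟩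

lemma cof_iff {f : X ⟶ Y} : cof f ↔ Function.Injective (toFun f) ∧
    ∀ a : X.Cell, ∃ b : Y.Cell, b.1 = a.1 ∧ toFun f '' op a = op b := by
  refine and_congr_right fun _ => ⟨fun h a => ?_, fun h n a => ?_⟩
  · obtain ⟨e, he⟩ := h a.1 a.2
    exact ⟨⟨a.1, e⟩, rfl, he⟩
  · obtain ⟨⟨m, b⟩, rfl, he⟩ := h ⟨n, a⟩
    exact ⟨b, he⟩

lemma injective_of_iso (e : X ≅ Y) : Function.Injective (toFun e.hom) := fun x y h => by
  have := congrArg (toFun e.inv) h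
  rwa [← toFun_comp, ← toFun_comp, e.hom_inv_id] at this

lemma cof_of_iso (e : X ≅ Y) : cof e.hom :=
  cof_iff.2 ⟨injective_of_iso e, image_op_of_iso e⟩

lemma cof_comp {f : X ⟶ Y} {g : Y ⟶ Z} (hf : cof f) (hg : cof g) : cof (f ≫ g) := by
  rw [cof_iff] at *
  refine ⟨hg.1.comp hf.1, fun a => ?_⟩
  obtain ⟨b, hb, hab⟩ := hf.2 a
  obtain ⟨c, hc, hbc⟩ := hg.2 b
  refine ⟨c, hc.trans hb, ?_⟩
  rw [← hbc, ← hab, Set.image_image]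
  rfl

end FinCW

/-! ### Pushouts of finite based CW complexes along cofibrations -/

/-- The image of a compact Hausdorff space under a closed continuous map is Hausdorff. -/
lemma t2Space_of_isClosedMap {Z W : Type*} [TopologicalSpace Z] [TopologicalSpace W]
    [CompactSpace Z] [T2Space Z] {q : Z → W} (hc : Continuous q) (hs : Function.Surjective q)
    (hq : IsClosedMap q) : T2Space W := by
  have hpt : ∀ u : W, IsClosed (q ⁻¹' {u}) := fun u => by
    obtain ⟨z, rfl⟩ := hs u
    have := hq _ (isClosed_singleton (x := z))
    rw [Set.image_singleton] at this
    exact this.preimage hc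
  refine ⟨fun u v huv => ?_⟩
  obtain ⟨U, V, hU, hV, hu, hv, hUV⟩ := SeparatedNhds.of_isCompact_isCompact
    (hpt u).isCompact (hpt v).isCompact (Disjoint.preimage q (Set.disjoint_singleton.2 huv))
  refine ⟨(q '' Uᶜ)ᶜ, (q '' Vᶜ)ᶜ, (hq _ hU.isClosed_compl).isOpen_compl,
    (hq _ hV.isClosed_compl).isOpen_compl, ?_, ?_, ?_⟩
  · rintro ⟨z, hz, rfl⟩
    exact hz (hu rfl)
  · rintro ⟨z, hz, rfl⟩
    exact hz (hv rfl)
  · rw [Set.disjoint_left]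
    intro w hw1 hw2
    obtain ⟨z, rfl⟩ := hs w
    have h1 : z ∈ U := by by_contra h; exact hw1 ⟨z, h, rfl⟩
    have h2 : z ∈ V := by by_contra h; exact hw2 ⟨z, h, rfl⟩
    exact Set.disjoint_left.1 hUV h1 h2

namespace FinCW

section Pushout

variable {X Y X' : FinCW} (f : X ⟶ Y) (g : X ⟶ X')

open Classical in
/-- A normal form for the points of the adjunction space: a point of the image of `f` is replaced
by its image under `g`. -/
def glueNF : Y ⊕ X' → Y ⊕ X'
  | .inl y => if h : ∃ x, toFun f x = y then .inr (toFun g h.choose) else .inl y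
  | .inr x' => .inr x'

/-- The adjunction space `Y ∪_X X'`, as the quotient identifying points with equal normal form.
This is the right equivalence relation only if `f` is injective. -/
def Glue : Type := Quotient (Setoid.ker (glueNF f g))

instance : TopologicalSpace (Glue f g) := inferInstanceAs (TopologicalSpace (Quotient _))

/-- The quotient map onto the adjunction space. -/
def glueMk : Y ⊕ X' → Glue f g := Quotient.mk _

lemma continuous_glueMk : Continuous (glueMk f g) := continuous_quotient_mk'

lemma glueMk_surjective : Function.Surjective (glueMk f g) := Quotient.mk_surjective

lemma isQuotientMap_glueMk : IsQuotientMap (glueMk f g) := isQuotientMap_quotient_mk'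

variable {f g}

lemma glueMk_eq {z z' : Y ⊕ X'} : glueMk f g z = glueMk f g z' ↔ glueNF f g z = glueNF f g z' :=
  Quotient.eq

lemma glueNF_map (hf : Function.Injective (toFun f)) (x : X) :
    glueNF f g (.inl (toFun f x)) = .inr (toFun g x) := by
  have h : ∃ x', toFun f x' = toFun f x := ⟨x, rfl⟩
  simp only [glueNF, dif_pos h]
  rw [hf h.choose_spec]

lemma glueNF_inl {y : Y} (h : ∀ x, toFun f x ≠ y) : glueNF f g (.inl y) = .inl y := by
  simp only [glueNF]
  rw [dif_neg]
  exact fun ⟨x, hx⟩ => h x hx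

lemma glueNF_inr (x' : X') : glueNF f g (.inr x') = .inr x' := rfl

lemma glueMk_inr_injective : Function.Injective fun x' : X' => glueMk f g (.inr x') :=
  fun _ _ h => Sum.inr_injective (glueMk_eq.1 h)

lemma glueMk_map (hf : Function.Injective (toFun f)) (x : X) :
    glueMk f g (.inl (toFun f x)) = glueMk f g (.inr (toFun g x)) := by
  rw [glueMk_eq, glueNF_map hf, glueNF_inr]

lemma glueMk_inl_eq_inl {y y' : Y} (h : ∀ x, toFun f x ≠ y)
    (e : glueMk f g (.inl y) = glueMk f g (.inl y')) : y = y' := by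
  rw [glueMk_eq, glueNF_inl h] at e
  by_cases h' : ∀ x, toFun f x ≠ y'
  · rw [glueNF_inl h'] at e
    exact Sum.inl_injective e
  · push Not at h'
    simp only [glueNF] at e
    rw [dif_pos h'] at e
    simp at e

lemma glueMk_inl_ne_inr {y : Y} (h : ∀ x, toFun f x ≠ y) (x' : X') :
    glueMk f g (.inl y) ≠ glueMk f g (.inr x') := by
  intro e
  rw [glueMk_eq, glueNF_inl h, glueNF_inr] at e
  simp at e

/-- Every point of the adjunction space has a unique representative in `X'` or in the complement
of the image of `f`. -/
lemma glue_cases (hf : Function.Injective (toFun f)) (w : Glue f g) :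
    (∃ x', w = glueMk f g (.inr x')) ∨
      ∃ y, (∀ x, toFun f x ≠ y) ∧ w = glueMk f g (.inl y) := by
  obtain ⟨y | x', rfl⟩ := glueMk_surjective f g w
  · by_cases h : ∀ x, toFun f x ≠ y
    · exact Or.inr ⟨y, h, rfl⟩
    · push Not at h
      obtain ⟨x, rfl⟩ := h
      exact Or.inl ⟨_, glueMk_map hf x⟩
  · exact Or.inl ⟨x', rfl⟩

/-- The compactness of `X` enters here: the saturation of a closed set is closed. -/
lemma isClosedMap_glueMk (hf : Function.Injective (toFun f)) : IsClosedMap (glueMk f g) := by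
  intro C hC
  -- the saturation of `C`, computed on the two summands
  have hY : IsClosed (Sum.inl ⁻¹' C : Set Y) := hC.preimage continuous_inl
  have hX' : IsClosed (Sum.inr ⁻¹' C : Set X') := hC.preimage continuous_inr
  have hB : IsClosed (Sum.inr ⁻¹' C ∪ toFun g '' (toFun f ⁻¹' (Sum.inl ⁻¹' C)) : Set X') :=
    hX'.union (((hY.preimage (toFun f).continuous).isCompact.image (toFun g).continuous).isClosed)
  refine (isQuotientMap_glueMk f g).isClosed_preimage.1 ?_
  rw [isClosed_sum_iff]
  have key : ∀ z, z ∈ glueMk f g ⁻¹' (glueMk f g '' C) ↔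
      ∃ c ∈ C, glueMk f g c = glueMk f g z := fun z => Iff.rfl
  have hr : (Sum.inr ⁻¹' (glueMk f g ⁻¹' (glueMk f g '' C)) : Set X') =
      Sum.inr ⁻¹' C ∪ toFun g '' (toFun f ⁻¹' (Sum.inl ⁻¹' C)) := by
    ext x'
    rw [Set.mem_preimage, key]
    constructor
    · rintro ⟨y | x'', hc, e⟩
      · by_cases h : ∀ x, toFun f x ≠ y
        · exact absurd e (glueMk_inl_ne_inr h x')
        · push Not at h
          obtain ⟨x, rfl⟩ := h
          rw [glueMk_map hf] at e
          exact Or.inr ⟨x, hc, glueMk_inr_injective e⟩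
      · obtain rfl := glueMk_inr_injective e
        exact Or.inl hc
    · rintro (h | ⟨x, h, rfl⟩)
      · exact ⟨_, h, rfl⟩
      · exact ⟨_, h, glueMk_map hf x⟩
  have hl : (Sum.inl ⁻¹' (glueMk f g ⁻¹' (glueMk f g '' C)) : Set Y) =
      Sum.inl ⁻¹' C ∪ toFun f '' (toFun g ⁻¹'
        (Sum.inr ⁻¹' C ∪ toFun g '' (toFun f ⁻¹' (Sum.inl ⁻¹' C)))) := by
    rw [← hr]
    ext y
    rw [Set.mem_preimage, key]
    constructor
    · intro hy
      by_cases h : ∀ x, toFun f x ≠ y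
      · obtain ⟨y' | x', hc, e⟩ := hy
        · obtain rfl := glueMk_inl_eq_inl h e.symm
          exact Or.inl hc
        · exact absurd e.symm (glueMk_inl_ne_inr h x')
      · push Not at h
        obtain ⟨x, rfl⟩ := h
        refine Or.inr ⟨x, ?_, rfl⟩
        rw [glueMk_map hf] at hy
        exact hy
    · rintro (h | ⟨x, h, rfl⟩)
      · exact ⟨_, h, rfl⟩
      · rw [glueMk_map hf]
        exact h
  rw [hr, hl]
  exact ⟨hY.union ((hB.preimage (toFun g).continuous).isCompact.image
    (toFun f).continuous).isClosed, hB⟩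

lemma t2Space_glue (hf : Function.Injective (toFun f)) : T2Space (Glue f g) :=
  t2Space_of_isClosedMap (continuous_glueMk f g) (glueMk_surjective f g) (isClosedMap_glueMk hf)

/-- An open cell of the target of a cofibration is an open cell of the source or is disjoint from
the source. -/
lemma cof_cell_cases (hf : cof f) (b : Y.Cell) :
    (∃ a : X.Cell, a.1 = b.1 ∧ toFun f '' op a = op b) ∨ ∀ x, toFun f x ∉ op b := by
  by_cases h : ∀ x, toFun f x ∉ op b
  · exact Or.inr h
  · push Not at h
    obtain ⟨x, hx⟩ := h
    obtain ⟨a, ha⟩ := exists_mem_op x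
    obtain ⟨b', hb, hab⟩ := (cof_iff.1 hf).2 a
    have : b' = b := cell_unique (hab ▸ Set.mem_image_of_mem _ ha) hx
    subst this
    exact Or.inl ⟨a, hb.symm, hab⟩

variable (f) in
/-- The cells of `Y` outside of the image of `f`. -/
def NewCell (n : ℕ) : Type :=
  {e : RelCWComplex.cell (Set.univ : Set Y) n // ∀ x, toFun f x ∉ op (⟨n, e⟩ : Y.Cell)}

variable (f g) in
/-- The characteristic maps of the adjunction space. -/
def glueChar (n : ℕ) : RelCWComplex.cell (Set.univ : Set X') n ⊕ NewCell f n →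
    (Fin n → ℝ) → Glue f g
  | .inl i, v => glueMk f g (.inr (RelCWComplex.map n i v))
  | .inr i, v => glueMk f g (.inl (RelCWComplex.map n i.1 v))

lemma NewCell.ne {n : ℕ} (i : NewCell f n) {v : Fin n → ℝ} (hv : v ∈ Metric.ball 0 1) (x : X) :
    toFun f x ≠ RelCWComplex.map n i.1 v := fun h =>
  i.2 x (h ▸ Set.mem_image_of_mem _ hv)

lemma glueChar_cover (hf : cof f) (w : Glue f g) :
    ∃ n i, w ∈ glueChar f g n i '' Metric.ball 0 1 := by
  rcases glue_cases hf.1 w with ⟨x', rfl⟩ | ⟨y, hy, rfl⟩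
  · obtain ⟨⟨n, a⟩, v, hv, rfl⟩ := exists_mem_op x'
    exact ⟨n, .inl a, v, hv, rfl⟩
  · obtain ⟨b, hb⟩ := exists_mem_op y
    have hn : ∀ x, toFun f x ∉ op b := by
      refine (cof_cell_cases hf b).resolve_left ?_
      rintro ⟨a, _, hab⟩
      rw [← hab] at hb
      obtain ⟨x, _, hx⟩ := hb
      exact hy x hx
    obtain ⟨n, b⟩ := b
    obtain ⟨v, hv, rfl⟩ := hb
    exact ⟨n, .inr ⟨b, hn⟩, v, hv, rfl⟩

lemma glueChar_inr_of_lt {m n : ℕ} (hmn : m < n) (x' : X') (h : x' ∈ X'.skel m) :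
    ∃ m < n, ∃ j, glueMk f g (.inr x') ∈ glueChar f g m j '' Metric.ball 0 1 := by
  obtain ⟨⟨l, a⟩, hl, v, hv, rfl⟩ := mem_skel.1 h
  exact ⟨l, lt_of_le_of_lt hl hmn, .inl a, v, hv, rfl⟩

lemma mem_skel_of_sphere {n : ℕ} (i : RelCWComplex.cell (Set.univ : Set X) n) {v : Fin n → ℝ}
    (hv : v ∈ Metric.sphere 0 1) :
    ∃ b : X.Cell, b.1 < n ∧ RelCWComplex.map n i v ∈ op b := by
  have := RelCWComplex.cellFrontier_subset_skeletonLT n i (Set.mem_image_of_mem _ hv)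
  rw [SetLike.mem_coe, CWComplex.mem_skeletonLT_iff] at this
  obtain ⟨m, hm, j, h⟩ := this
  exact ⟨⟨m, j⟩, by exact_mod_cast hm, h⟩

lemma glueChar_bdry (hf : cof f) (n : ℕ) (i) (v : Fin n → ℝ) (hv : v ∈ Metric.sphere 0 1) :
    ∃ m < n, ∃ j, glueChar f g n i v ∈ glueChar f g m j '' Metric.ball 0 1 := by
  rcases i with i | i
  · obtain ⟨b, hb, h⟩ := mem_skel_of_sphere i hv
    exact glueChar_inr_of_lt hb _ (mem_skel.2 ⟨b, le_rfl, h⟩)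
  · obtain ⟨b, hb, h⟩ := mem_skel_of_sphere i.1 hv
    rcases cof_cell_cases hf b with ⟨a, ha, hab⟩ | hn
    · rw [← hab] at h
      obtain ⟨x, hx, hxv⟩ := h
      rw [glueChar, ← hxv, glueMk_map hf.1]
      exact glueChar_inr_of_lt (ha ▸ hb) _ (Hom.cellular g _ (mem_skel.2 ⟨a, le_rfl, hx⟩))
    · obtain ⟨m, b⟩ := b
      obtain ⟨u, hu, huv⟩ := h
      exact ⟨m, hb, .inr ⟨b, hn⟩, u, hu, congrArg (fun y => glueMk f g (.inl y)) huv⟩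

lemma glueChar_unique (a b : Σ n, RelCWComplex.cell (Set.univ : Set X') n ⊕ NewCell f n)
    (x : Fin a.1 → ℝ) (hx : x ∈ Metric.ball 0 1) (y : Fin b.1 → ℝ) (hy : y ∈ Metric.ball 0 1)
    (h : glueChar f g a.1 a.2 x = glueChar f g b.1 b.2 y) : a = b := by
  obtain ⟨n, i | i⟩ := a <;> obtain ⟨m, j | j⟩ := b
  · have h' := glueMk_inr_injective h
    have := cell_unique (a := (⟨n, i⟩ : X'.Cell)) (b := ⟨m, j⟩) ⟨x, hx, rfl⟩ ⟨y, hy, h'.symm⟩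
    cases this
    rfl
  · exact absurd h.symm (glueMk_inl_ne_inr (j.ne hy) _)
  · exact absurd h (glueMk_inl_ne_inr (i.ne hx) _)
  · have h' := glueMk_inl_eq_inl (i.ne hx) h
    obtain ⟨i, hi⟩ := i
    obtain ⟨j, hj⟩ := j
    have := cell_unique (a := (⟨n, i⟩ : Y.Cell)) (b := ⟨m, j⟩) ⟨x, hx, rfl⟩ ⟨y, hy, h'.symm⟩
    cases this
    rfl

lemma glueChar_inj (n : ℕ) (i) : Set.InjOn (glueChar f g n i) (Metric.ball 0 1) := by
  intro x hx y hy h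
  have hinj : ∀ {Z : FinCW} (i : RelCWComplex.cell (Set.univ : Set Z) n),
      Set.InjOn (RelCWComplex.map n i) (Metric.ball 0 1) := fun i => by
    rw [← RelCWComplex.source_eq n i]
    exact (RelCWComplex.map n i).injOn
  rcases i with i | i
  · exact hinj i hx hy (glueMk_inr_injective h)
  · exact hinj i.1 hx hy (glueMk_inl_eq_inl (i.ne hx) h)

lemma glueChar_cont (n : ℕ) (i) : ContinuousOn (glueChar f g n i) (Metric.closedBall 0 1) := by
  rcases i with i | i
  · exact ((continuous_glueMk f g).comp continuous_inr).comp_continuousOn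
      (RelCWComplex.continuousOn n i)
  · exact ((continuous_glueMk f g).comp continuous_inl).comp_continuousOn
      (RelCWComplex.continuousOn n i.1)

variable (g) in
/-- The cell decomposition of the adjunction space. -/
def glueDecomp (hf : cof f) : CellDecomp (Glue f g) where
  ι n := RelCWComplex.cell (Set.univ : Set X') n ⊕ NewCell f n
  map := glueChar f g
  finite := by
    refine Finite.of_injective (β := X'.Cell ⊕ Y.Cell) (fun a => match a with
      | ⟨n, .inl i⟩ => .inl ⟨n, i⟩
      | ⟨n, .inr i⟩ => .inr ⟨n, i.1⟩) ?_
    rintro ⟨n, i | ⟨i, hi⟩⟩ ⟨m, j | ⟨j, hj⟩⟩ h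
    · cases h; rfl
    · cases h
    · cases h
    · cases h; rfl
  cont := glueChar_cont
  inj := glueChar_inj
  unique := glueChar_unique
  bdry := glueChar_bdry hf
  cover := glueChar_cover hf

variable (g) in
/-- The pushout of a cofibration of finite based CW complexes. -/
def po (hf : cof f) : FinCW :=
  haveI := t2Space_glue (g := g) hf.1
  (glueDecomp g hf).toFinCW (glueMk f g (.inr X'.base)) (by
    obtain ⟨⟨n, i⟩, hn, h⟩ := X'.exists_base_cell
    obtain rfl : n = 0 := hn
    refine ⟨.inl i, congrArg (fun x => glueMk f g (.inr x)) ?_⟩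
    have : RelCWComplex.map 0 i 0 ∈ op (⟨0, i⟩ : X'.Cell) :=
      Set.mem_image_of_mem _ (Metric.mem_ball_self one_pos)
    rw [h] at this
    exact this)

variable (g) in
/-- The cell of the pushout given by a cell of `X'`. -/
def cellInr (hf : cof f) (a : X'.Cell) : (po g hf).Cell := ⟨a.1, .inl a.2⟩

variable (g) in
/-- The cell of the pushout given by a cell of `Y` outside of the image of `f`. -/
def cellInl (hf : cof f) (b : Y.Cell) (hb : ∀ x, toFun f x ∉ op b) : (po g hf).Cell :=
  ⟨b.1, .inr ⟨b.2, hb⟩⟩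

lemma op_cellInr (hf : cof f) (a : X'.Cell) :
    op (cellInr g hf a) = (fun x' => glueMk f g (.inr x')) '' op a := by
  change (fun v => glueMk f g (.inr (RelCWComplex.map a.1 a.2 v))) '' Metric.ball 0 1 = _
  rw [op, RelCWComplex.openCell, Set.image_image]

lemma op_cellInl (hf : cof f) (b : Y.Cell) (hb : ∀ x, toFun f x ∉ op b) :
    op (cellInl g hf b hb) = (fun y => glueMk f g (.inl y)) '' op b := by
  change (fun v => glueMk f g (.inl (RelCWComplex.map b.1 b.2 v))) '' Metric.ball 0 1 = _
  rw [op, RelCWComplex.openCell, Set.image_image]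

variable (g) in
/-- The map from `X'` to the pushout. -/
def poInr (hf : cof f) : X' ⟶ po g hf :=
  Hom.mk (Y := po g hf)
    ⟨fun x' => glueMk f g (.inr x'), (continuous_glueMk f g).comp continuous_inr⟩ rfl (by
    intro n x hx
    obtain ⟨a, ha, hxa⟩ := mem_skel.1 hx
    refine mem_skel.2 ⟨cellInr g hf a, ha, ?_⟩
    rw [op_cellInr]
    exact ⟨x, hxa, rfl⟩)

variable (g) in
/-- The map from `Y` to the pushout. -/
def poInl (hf : cof f) : Y ⟶ po g hf :=
  Hom.mk (Y := po g hf)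
    ⟨fun y => glueMk f g (.inl y), (continuous_glueMk f g).comp continuous_inl⟩ (by
      change glueMk f g (.inl Y.base) = glueMk f g (.inr X'.base)
      rw [← toFun_base f, glueMk_map hf.1, toFun_base]) (by
    intro n y hy
    obtain ⟨b, hb, hyb⟩ := mem_skel.1 hy
    rcases cof_cell_cases hf b with ⟨a, ha, hab⟩ | hn
    · rw [← hab] at hyb
      obtain ⟨x, hx, rfl⟩ := hyb
      change glueMk f g (.inl (toFun f x)) ∈ _
      rw [glueMk_map hf.1]
      exact Hom.cellular (poInr g hf) n (Hom.cellular g n (mem_skel.2 ⟨a, ha.trans_le hb, hx⟩))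
    · refine mem_skel.2 ⟨cellInl g hf b hn, hb, ?_⟩
      rw [op_cellInl]
      exact ⟨y, hyb, rfl⟩)

lemma po_cases (hf : cof f) (w : po g hf) :
    (∃ x', w = toFun (poInr g hf) x') ∨
      ∃ y, (∀ x, toFun f x ≠ y) ∧ w = toFun (poInl g hf) y := glue_cases hf.1 w

/-- The morphism from the pushout given by its universal property. -/
def poDesc (hf : cof f) {V : FinCW} (a : Y ⟶ V) (b : X' ⟶ V) (h : f ≫ a = g ≫ b) :
    po g hf ⟶ V :=
  have hcomp : ∀ x, toFun a (toFun f x) = toFun b (toFun g x) := fun x => by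
    rw [← toFun_comp, h, toFun_comp]
  have hnf : ∀ z : Y ⊕ X', Sum.elim (toFun a) (toFun b) (glueNF f g z) =
      Sum.elim (toFun a) (toFun b) z := by
    rintro (y | x')
    · by_cases hy : ∀ x, toFun f x ≠ y
      · rw [glueNF_inl hy]
      · push Not at hy
        obtain ⟨x, rfl⟩ := hy
        rw [glueNF_map hf.1]
        exact (hcomp x).symm
    · rfl
  Hom.mk (X := po g hf)
    { toFun := Quotient.lift (Sum.elim (toFun a) (toFun b)) (fun z z' e => by
        rw [← hnf z, ← hnf z']
        exact congrArg _ e)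
      continuous_toFun := Continuous.quotient_lift
        ((toFun a).continuous.sumElim (toFun b).continuous) _ }
    (toFun_base b) (by
      intro n w hw
      obtain ⟨⟨m, i | ⟨e, he⟩⟩, hc, h⟩ := mem_skel.1 hw
      · change w ∈ op (cellInr g hf ⟨m, i⟩) at h
        rw [op_cellInr] at h
        obtain ⟨x', hx', rfl⟩ := h
        exact Hom.cellular b n (mem_skel.2 ⟨_, hc, hx'⟩)
      · change w ∈ op (cellInl g hf ⟨m, e⟩ he) at h
        rw [op_cellInl] at h
        obtain ⟨y, hy, rfl⟩ := h
        exact Hom.cellular a n (mem_skel.2 ⟨_, hc, hy⟩))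

variable (g) in
lemma isPushout_po (hf : cof f) : IsPushout f g (poInl g hf) (poInr g hf) := by
  refine ⟨⟨hom_ext fun x => glueMk_map hf.1 x⟩, ⟨PushoutCocone.IsColimit.mk _
    (fun s => poDesc hf s.inl s.inr s.condition) (fun s => rfl) (fun s => rfl) ?_⟩⟩
  intro s m h1 h2
  refine hom_ext fun w => ?_
  obtain ⟨y | x', rfl⟩ := glueMk_surjective f g w
  · exact congrArg (fun u => toFun u y) h1
  · exact congrArg (fun u => toFun u x') h2

lemma cof_poInr (hf : cof f) : cof (poInr g hf) :=
  cof_iff.2 ⟨glueMk_inr_injective, fun a => ⟨cellInr g hf a, rfl, (op_cellInr hf a).symm⟩⟩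

lemma image_poInl (hf : cof f) (b : Y.Cell) (hb : ∀ x, toFun f x ∉ op b) :
    toFun (poInl g hf) '' op b = op (cellInl g hf b hb) := (op_cellInl hf b hb).symm

lemma image_poInr (hf : cof f) (a : X'.Cell) :
    toFun (poInr g hf) '' op a = op (cellInr g hf a) := (op_cellInr hf a).symm

/-- The cells of the pushout are the cells of `X'` and the cells of `Y` outside of `X`. -/
def poCellEquiv (hf : cof f) :
    (po g hf).Cell ≃ X'.Cell ⊕ {b : Y.Cell // ∀ x, toFun f x ∉ op b} where
  toFun
    | ⟨n, .inl i⟩ => .inl ⟨n, i⟩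
    | ⟨n, .inr i⟩ => .inr ⟨⟨n, i.1⟩, i.2⟩
  invFun := Sum.elim (cellInr g hf) fun b => cellInl g hf b.1 b.2
  left_inv := by rintro ⟨n, i | i⟩ <;> rfl
  right_inv := by rintro (a | b) <;> rfl

end Pushout
end FinCW

/-! ### Intersections of subcategories with cofibrations -/

section Generated

variable {C : Type u} [Category.{v} C]

namespace Subcat

variable {A : Subcat C}

lemma obj_ext {X Y : A.Obj} {f g : X ⟶ Y} (h : A.incl.map f = A.incl.map g) : f = g :=
  Hom.ext h

/-- A morphism of the ambient category which belongs to the subcategory. -/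
def homMk {X Y : A.Obj} (f : A.incl.obj X ⟶ A.incl.obj Y) (hf : A.hom f) : X ⟶ Y :=
  (⟨f, hf⟩ : Hom X Y)

lemma hom_incl_map {X Y : A.Obj} (f : X ⟶ Y) : A.hom (A.incl.map f) := Hom.prop f

/-- A square of a subcategory which is a pushout in the ambient category is a pushout in the
subcategory as soon as the morphisms induced by cocones of the subcategory belong to it. -/
lemma isPushout_of_incl {X Y X' P : A.Obj} {f : X ⟶ Y} {g : X ⟶ X'} {h : Y ⟶ P} {k : X' ⟶ P}
    (H : IsPushout (A.incl.map f) (A.incl.map g) (A.incl.map h) (A.incl.map k))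
    (hu : ∀ {V : C} (u : A.incl.obj P ⟶ V), A.hom (A.incl.map h ≫ u) → A.hom (A.incl.map k ≫ u) →
      A.hom u) : IsPushout f g h k := by
  have hw : ∀ s : PushoutCocone f g,
      A.incl.map f ≫ A.incl.map s.inl = A.incl.map g ≫ A.incl.map s.inr := fun s => by
    rw [← Functor.map_comp, ← Functor.map_comp, s.condition]
  refine ⟨⟨obj_ext H.w⟩, ⟨PushoutCocone.IsColimit.mk _
    (fun s => homMk (H.desc _ _ (hw s)) (hu _ ?_ ?_)) (fun s => obj_ext (H.inl_desc _ _ (hw s)))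
    (fun s => obj_ext (H.inr_desc _ _ (hw s))) fun s m h1 h2 => obj_ext (H.hom_ext ?_ ?_)⟩⟩
  · exact (congrArg (fun t => A.hom t) (H.inl_desc _ _ (hw s))).mpr (hom_incl_map _)
  · exact (congrArg (fun t => A.hom t) (H.inr_desc _ _ (hw s))).mpr (hom_incl_map _)
  · exact (congrArg A.incl.map h1).trans (H.inl_desc _ _ (hw s)).symm
  · exact (congrArg A.incl.map h2).trans (H.inr_desc _ _ (hw s)).symm

end Subcat

open Subcat

/-- If a functor preserves one pushout of a span, then it preserves all of them. -/
lemma isPushout_comparison {D : Type*} [Category* D] (F : D ⥤ C)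
    {X Y X' P P' : D} {f : X ⟶ Y} {g : X ⟶ X'} {h : Y ⟶ P} {k : X' ⟶ P} {h' : Y ⟶ P'}
    {k' : X' ⟶ P'} (H : IsPushout f g h k) (H' : IsPushout f g h' k')
    (HF : IsPushout (F.map f) (F.map g) (F.map h') (F.map k')) :
    IsPushout (F.map f) (F.map g) (F.map h) (F.map k) := by
  let e : P' ≅ P := H'.isoIsPushout _ _ H
  refine HF.of_iso (Iso.refl _) (Iso.refl _) (Iso.refl _) (F.mapIso e) (by simp) (by simp) ?_ ?_
  · simp only [Functor.mapIso_hom, ← F.map_comp, Iso.refl_hom, Category.id_comp]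
    rw [IsPushout.inl_isoIsPushout_hom]
  · simp only [Functor.mapIso_hom, ← F.map_comp, Iso.refl_hom, Category.id_comp]
    rw [IsPushout.inr_isoIsPushout_hom]

lemma isZero_of_iso_map {D : Type*} [Category* D] (F : D ⥤ C) {Z Z' : D} (hZ : IsZero Z)
    (hZ' : IsZero Z') (h : IsZero (F.obj Z')) : IsZero (F.obj Z) :=
  h.of_iso (F.mapIso (hZ.iso hZ'))

namespace IsSubcatWithCof

variable {amb : MorphismProperty C} {A : Subcat C}

lemma obj_of_iso (hA : IsSubcatWithCof amb A) {X Y : C} (e : X ≅ Y) (h : A.obj X) : A.obj Y :=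
  A.target (hA.replete e h)

/-- A subcategory with cofibrations contains all zero objects, and these are zero objects of it. -/
lemma obj_of_isZero (hA : IsSubcatWithCof amb A) {Z : C} (hZ : IsZero Z) : A.obj Z := by
  obtain ⟨Z', hZ'⟩ := hA.isCatWithCof.exists_zero
  exact hA.obj_of_iso ((hA.preserves_zero Z' hZ').iso hZ) Z'.prop

lemma isZero_mk (hA : IsSubcatWithCof amb A) {Z : A.Obj} (hZ : IsZero (A.incl.obj Z)) :
    IsZero Z := by
  obtain ⟨Z', hZ'⟩ := hA.isCatWithCof.exists_zero
  have e : A.incl.obj Z ≅ A.incl.obj Z' := hZ.iso (hA.preserves_zero Z' hZ')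
  refine hZ'.of_iso ⟨homMk e.hom (hA.replete e Z.prop), homMk e.inv (hA.replete e.symm Z'.prop),
    obj_ext ?_, obj_ext ?_⟩
  · exact e.hom_inv_id
  · exact e.inv_hom_id

lemma hom_to_zero (hA : IsSubcatWithCof amb A) {X Z : C} (hX : A.obj X) (hZ : IsZero Z)
    (f : X ⟶ Z) : A.hom f := by
  have hZA := hA.isZero_mk (Z := ⟨Z, hA.obj_of_isZero hZ⟩) hZ
  rw [hZ.eq_of_tgt f (A.incl.map (hZA.from_ ⟨X, hX⟩))]
  exact hom_incl_map _

lemma hom_from_zero (hA : IsSubcatWithCof amb A) {X Z : C} (hX : A.obj X) (hZ : IsZero Z)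
    (f : Z ⟶ X) : A.hom f := by
  have hZA := hA.isZero_mk (Z := ⟨Z, hA.obj_of_isZero hZ⟩) hZ
  rw [hZ.eq_of_src f (A.incl.map (hZA.to_ ⟨X, hX⟩))]
  exact hom_incl_map _

/-- An ambient pushout of a cofibration of `A` along a morphism of `A` lies in `A`, including the
morphisms out of it induced by cocones in `A`. This uses that `A` is replete. -/
lemma of_isPushout (hA : IsSubcatWithCof amb A) {X Y X' : A.Obj} {f : X ⟶ Y} {g : X ⟶ X'}
    (hf : A.cof amb f) {P : C} {h : A.incl.obj Y ⟶ P} {k : A.incl.obj X' ⟶ P}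
    (H : IsPushout (A.incl.map f) (A.incl.map g) h k) :
    A.hom h ∧ A.hom k ∧ ∀ {V : C} (u : P ⟶ V), A.hom (h ≫ u) → A.hom (k ≫ u) → A.hom u := by
  obtain ⟨P', h', k', H'⟩ := hA.isCatWithCof.exists_pushout f g hf
  have HF := hA.preserves_pushout hf H'
  let e : A.incl.obj P' ≅ P := HF.isoIsPushout _ _ H
  have he : A.hom e.hom := hA.replete e P'.prop
  refine ⟨?_, ?_, fun {V} u hu hv => ?_⟩
  · rw [← HF.inl_isoIsPushout_hom _ _ H]
    exact A.comp (hom_incl_map h') he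
  · rw [← HF.inr_isoIsPushout_hom _ _ H]
    exact A.comp (hom_incl_map k') he
  · let V' : A.Obj := ⟨V, A.target hu⟩
    let a : Y ⟶ V' := homMk (h ≫ u) hu
    let b : X' ⟶ V' := homMk (k ≫ u) hv
    have hab : f ≫ a = g ≫ b := obj_ext (by
      rw [Functor.map_comp, Functor.map_comp]
      change A.incl.map f ≫ h ≫ u = A.incl.map g ≫ k ≫ u
      rw [← Category.assoc, H.w, Category.assoc])
    have h3 : e.hom ≫ u = A.incl.map (H'.desc a b hab) := by
      refine HF.hom_ext ?_ ?_
      · rw [← Category.assoc, HF.inl_isoIsPushout_hom _ _ H]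
        exact (congrArg A.incl.map (H'.inl_desc a b hab)).symm.trans (A.incl.map_comp _ _)
      · rw [← Category.assoc, HF.inr_isoIsPushout_hom _ _ H]
        exact (congrArg A.incl.map (H'.inr_desc a b hab)).symm.trans (A.incl.map_comp _ _)
    have h4 : A.hom (e.hom ≫ u) := (congrArg (fun t => A.hom t) h3).mpr (hom_incl_map _)
    rw [← e.inv_hom_id_assoc u]
    exact A.comp (hA.replete e.symm (A.target he)) h4

/-- Ambient pushouts of cofibrations of `A` are pushouts in `A`. -/
lemma isPushout_mk (hA : IsSubcatWithCof amb A) {X Y X' P : A.Obj} {f : X ⟶ Y} {g : X ⟶ X'}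
    {h : Y ⟶ P} {k : X' ⟶ P} (hf : A.cof amb f)
    (H : IsPushout (A.incl.map f) (A.incl.map g) (A.incl.map h) (A.incl.map k)) :
    IsPushout f g h k :=
  isPushout_of_incl H (hA.of_isPushout hf H).2.2

/-- An ambient cokernel of a cofibration of `A` lies in `A`. -/
lemma hom_of_isCokernelOf (hA : IsSubcatWithCof amb A) {X Y : A.Obj} {f : X ⟶ Y}
    (hf : A.cof amb f) {Q : C} {p : A.incl.obj Y ⟶ Q} (H : IsCokernelOf (A.incl.map f) p) :
    A.hom p := by
  obtain ⟨Z, t, s, hZ, H⟩ := H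
  exact (hA.of_isPushout (X' := ⟨Z, hA.obj_of_isZero hZ⟩)
    (g := homMk t (hA.hom_to_zero X.prop hZ t)) hf H).1

end IsSubcatWithCof

section

variable {amb S : MorphismProperty C}

lemma hom_generated {A : Subcat C} (hA : IsSubcatWithCof amb A) (hS : S ≤ A.hom)
    {X Y : (generated amb S).Obj} (f : X ⟶ Y) : A.hom ((generated amb S).incl.map f) :=
  hom_incl_map f A hA hS

/-- The inclusion of the intersection into one of the subcategories. -/
def generatedTo {A : Subcat C} (hA : IsSubcatWithCof amb A) (hS : S ≤ A.hom) :
    (generated amb S).Obj ⥤ A.Obj where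
  obj X := ⟨X.val, X.prop A hA hS⟩
  map f := homMk ((generated amb S).incl.map f) (hom_generated hA hS f)

lemma cof_generatedTo {A : Subcat C} (hA : IsSubcatWithCof amb A) (hS : S ≤ A.hom)
    {X Y : (generated amb S).Obj} {f : X ⟶ Y} (hf : (generated amb S).cof amb f) :
    A.cof amb ((generatedTo hA hS).map f) := by
  obtain ⟨h1, Q, p, hp⟩ := hf
  exact ⟨h1, (generatedTo hA hS).obj Q, (generatedTo hA hS).map p, hp⟩

/-- A morphism of the intersection is a cofibration as soon as it is one in every subcategory: its
cokernel in one of them is a cokernel in all of them. -/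
lemma cof_generated {A₀ : Subcat C} (hA₀ : IsSubcatWithCof amb A₀) (hS₀ : S ≤ A₀.hom)
    {X Y : (generated amb S).Obj} {f : X ⟶ Y}
    (hf : ∀ (A : Subcat C) (hA : IsSubcatWithCof amb A) (hS : S ≤ A.hom),
      A.cof amb ((generatedTo hA hS).map f)) : (generated amb S).cof amb f := by
  obtain ⟨h1, Q, p, hp⟩ := hf A₀ hA₀ hS₀
  have : (generated amb S).hom (A₀.incl.map p) := fun A hA hS =>
    hA.hom_of_isCokernelOf (hf A hA hS) hp
  exact ⟨h1, ⟨Q.val, fun A hA hS => A.target (this A hA hS)⟩, homMk (A₀.incl.map p) this, hp⟩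

/-- The intersection of all subcategories with cofibrations that contain a given class of
morphisms is a subcategory with cofibrations, provided there is one. A pushout formed in one of
them is an ambient pushout, hence lies in all of them. -/
lemma isSubcatWithCof_generated {A₀ : Subcat C} (hA₀ : IsSubcatWithCof amb A₀)
    (hS₀ : S ≤ A₀.hom) : IsSubcatWithCof amb (generated amb S) := by
  -- zero objects of the intersection
  obtain ⟨Z₀, hZ₀'⟩ := hA₀.isCatWithCof.exists_zero
  have hZ₀ := hA₀.preserves_zero Z₀ hZ₀'
  let Z : (generated amb S).Obj := ⟨Z₀.val, fun A hA hS => hA.obj_of_isZero hZ₀⟩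
  have hZ : IsZero Z := by
    refine ⟨fun Y => ⟨⟨⟨homMk (hZ₀.to_ Y.val) fun A hA hS =>
      hA.hom_from_zero (Y.prop A hA hS) hZ₀ _⟩, fun f => obj_ext (hZ₀.eq_of_src _ _)⟩⟩,
      fun Y => ⟨⟨⟨homMk (hZ₀.from_ Y.val) fun A hA hS =>
      hA.hom_to_zero (Y.prop A hA hS) hZ₀ _⟩, fun f => obj_ext (hZ₀.eq_of_tgt _ _)⟩⟩⟩
  have hzero : ∀ W : (generated amb S).Obj, IsZero W → IsZero ((generated amb S).incl.obj W) :=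
    fun W hW => isZero_of_iso_map _ hW hZ hZ₀
  -- pushouts of cofibrations of the intersection
  have hpush : ∀ {X Y X' : (generated amb S).Obj} (f : X ⟶ Y) (g : X ⟶ X'),
      (generated amb S).cof amb f → ∃ (P : (generated amb S).Obj) (h : Y ⟶ P) (k : X' ⟶ P),
        IsPushout f g h k ∧ IsPushout ((generated amb S).incl.map f) ((generated amb S).incl.map g)
          ((generated amb S).incl.map h) ((generated amb S).incl.map k) := by
    intro X Y X' f g hf
    have hf₀ := cof_generatedTo hA₀ hS₀ hf
    obtain ⟨P, h, k, H⟩ := hA₀.isCatWithCof.exists_pushout _ ((generatedTo hA₀ hS₀).map g) hf₀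
    have HF := hA₀.preserves_pushout hf₀ H
    have hh : (generated amb S).hom (A₀.incl.map h) := fun A hA hS =>
      (hA.of_isPushout (cof_generatedTo hA hS hf) (g := (generatedTo hA hS).map g) HF).1
    have hk : (generated amb S).hom (A₀.incl.map k) := fun A hA hS =>
      (hA.of_isPushout (cof_generatedTo hA hS hf) (g := (generatedTo hA hS).map g) HF).2.1
    exact ⟨⟨P.val, fun A hA hS => A.target (hh A hA hS)⟩, homMk (A₀.incl.map h) hh,
      homMk (A₀.incl.map k) hk, isPushout_of_incl HF fun u hu hv A hA hS =>
        (hA.of_isPushout (cof_generatedTo hA hS hf) (g := (generatedTo hA hS).map g) HF).2.2 u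
          (hu A hA hS) (hv A hA hS), HF⟩
  have hpres : ∀ {X Y X' P : (generated amb S).Obj} {f : X ⟶ Y} {g : X ⟶ X'} {h : Y ⟶ P}
      {k : X' ⟶ P}, (generated amb S).cof amb f → IsPushout f g h k →
        IsPushout ((generated amb S).incl.map f) ((generated amb S).incl.map g)
          ((generated amb S).incl.map h) ((generated amb S).incl.map k) := by
    intro X Y X' P f g h k hf H
    obtain ⟨P', h', k', H', HF⟩ := hpush f g hf
    exact isPushout_comparison _ H H' HF
  refine ⟨fun e hX A hA hS => hA.replete e (hX A hA hS), ⟨⟨Z, hZ⟩, fun {W B} f hW => ?_,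
    fun f hf => ?_, fun f g hf hg => ?_, fun f g hf => ?_, @fun X Y X' P f g h k H hf => ?_⟩,
    hzero, hpres⟩
  · exact cof_generated hA₀ hS₀ fun A hA hS => hA.isCatWithCof.of_isZero _
      (hA.isZero_mk (hzero W hW))
  · exact cof_generated hA₀ hS₀ fun A hA hS => hA.isCatWithCof.of_isIso _ inferInstance
  · refine cof_generated hA₀ hS₀ fun A hA hS => ?_
    exact hA.isCatWithCof.comp _ _ (cof_generatedTo hA hS hf) (cof_generatedTo hA hS hg)
  · obtain ⟨P', h', k', H', _⟩ := hpush f g hf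
    exact ⟨P', h', k', H'⟩
  · refine cof_generated hA₀ hS₀ fun A hA hS => ?_
    exact hA.isCatWithCof.of_isPushout (hA.isPushout_mk (g := (generatedTo hA hS).map g)
      (h := (generatedTo hA hS).map h) (cof_generatedTo hA hS hf) (hpres hf H))
      (cof_generatedTo hA hS hf)

end
end Generated

/-! ### The subcategory of complexes with even boundaries -/

namespace FinCW

variable {X Y Z X' P : FinCW}

instance (X : FinCW) : Fintype X.Cell := Fintype.ofFinite _

/-- A morphism is cell-preserving if it maps every open cell onto an open cell of the same
dimension or to the base point. -/
def CellPres (f : X ⟶ Y) : Prop :=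
  ∀ a : X.Cell, (∃ b : Y.Cell, b.1 = a.1 ∧ toFun f '' op a = op b) ∨ toFun f '' op a = {Y.base}

lemma cellPres_of_cof {f : X ⟶ Y} (hf : cof f) : CellPres f :=
  fun a => Or.inl ((cof_iff.1 hf).2 a)

lemma CellPres.comp {f : X ⟶ Y} {g : Y ⟶ Z} (hf : CellPres f) (hg : CellPres g) :
    CellPres (f ≫ g) := by
  have him : ∀ s : Set X, toFun (f ≫ g) '' s = toFun g '' (toFun f '' s) := fun s => by
    rw [Set.image_image]; rfl
  intro a
  rcases hf a with ⟨b, hb, hab⟩ | h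
  · rcases hg b with ⟨c, hc, hbc⟩ | h
    · exact Or.inl ⟨c, hc.trans hb, by rw [him, hab, hbc]⟩
    · exact Or.inr (by rw [him, hab, h])
  · exact Or.inr (by rw [him, h, Set.image_singleton, toFun_base])

/-- The 1-cells which meet the closure of a cell. For a 2-cell this is its boundary, regarded as a
set without multiplicities. -/
def bd (e : X.Cell) : Set X.Cell := {c | c.1 = 1 ∧ (cl e ∩ op c).Nonempty}

/-- The cells onto which a morphism maps the cells of a given set, preserving the dimension. -/
def push (f : X ⟶ Y) (B : Set X.Cell) : Set Y.Cell :=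
  {c | ∃ b ∈ B, c.1 = b.1 ∧ toFun f '' op b = op c}

lemma ncard_push_le (f : X ⟶ Y) (B : Set X.Cell) : (push f B).ncard ≤ B.ncard := by
  have : Nonempty Y.Cell := ⟨Y.baseCell⟩
  refine (Set.ncard_le_ncard ?_ (Set.toFinite _)).trans
    (Set.ncard_image_le (f := fun b => Function.invFun op (toFun f '' op b)) B.toFinite)
  rintro c ⟨b, hb, _, h⟩
  exact ⟨b, hb, by simp only [h, Function.leftInverse_invFun op_injective c]⟩

/-- The boundary of the image of a cell under a cell-preserving map. -/
lemma bd_image {f : X ⟶ Y} (hf : CellPres f) {e : X.Cell} {e' : Y.Cell}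
    (h : toFun f '' op e = op e') : bd e' = push f (bd e) := by
  ext c'
  constructor
  · rintro ⟨hc, y, hy, hyc⟩
    rw [← image_cl h] at hy
    obtain ⟨x, hx, rfl⟩ := hy
    obtain ⟨c, hxc⟩ := exists_mem_op x
    have hmem := Set.mem_image_of_mem (toFun f) hxc
    rcases hf c with ⟨c'', hd, hcc⟩ | hb
    · obtain rfl := cell_unique hyc (hcc ▸ hmem)
      exact ⟨c, ⟨hd.symm.trans hc, x, hx, hxc⟩, hd, hcc⟩
    · rw [hb] at hmem
      rw [Set.mem_singleton_iff.1 hmem] at hyc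
      have := cell_unique hyc (by rw [op_baseCell]; rfl : Y.base ∈ op Y.baseCell)
      rw [this, baseCell_dim] at hc
      omega
  · rintro ⟨c, ⟨hc, x, hx, hxc⟩, hd, hcc⟩
    exact ⟨hd.trans hc, toFun f x, image_cl h ▸ Set.mem_image_of_mem _ hx,
      hcc ▸ Set.mem_image_of_mem _ hxc⟩

/-- The 2-cells whose closure meets at least three 1-cells occur evenly often for every given set
of 1-cells. Equivalently, every function with values in `ℤ/2` on the sets of 1-cells which vanishes
on sets with less than three elements has sum zero over the boundaries of the 2-cells.

Sets with less than three elements are disregarded in order to admit the pinched triangle and the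
sphere, which have a single 2-cell. The three edges of a triangle of the torus still count. -/
def EvenBdry (X : FinCW) : Prop :=
  ∀ w : Set X.Cell → ZMod 2, (∀ B, B.ncard < 3 → w B = 0) →
    ∑ e : X.Cell, (if e.1 = 2 then w (bd e) else 0) = 0

section Cof

variable {f : X ⟶ Y}

/-- The cell which is the image of a given cell under a cofibration. -/
def cofCell (hf : cof f) (a : X.Cell) : Y.Cell := ((cof_iff.1 hf).2 a).choose

lemma cofCell_dim (hf : cof f) (a : X.Cell) : (cofCell hf a).1 = a.1 :=
  ((cof_iff.1 hf).2 a).choose_spec.1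

lemma image_op (hf : cof f) (a : X.Cell) : toFun f '' op a = op (cofCell hf a) :=
  ((cof_iff.1 hf).2 a).choose_spec.2

lemma cofCell_injective (hf : cof f) : Function.Injective (cofCell hf) := fun a b h => by
  refine op_injective (hf.1.image_injective ?_)
  rw [image_op hf, image_op hf, h]

/-- The cells of `Y` are the cells of `X` and the cells outside of `X`. -/
def cofCellEquiv (hf : cof f) : X.Cell ⊕ {b : Y.Cell // ∀ x, toFun f x ∉ op b} ≃ Y.Cell :=
  Equiv.ofBijective (Sum.elim (cofCell hf) Subtype.val) (by
    have key : ∀ (a : X.Cell) (b : {b : Y.Cell // ∀ x, toFun f x ∉ op b}),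
        cofCell hf a ≠ b.1 := fun a b h => by
      obtain ⟨x, hx⟩ := op_nonempty a
      exact b.2 x (h ▸ image_op hf a ▸ Set.mem_image_of_mem _ hx)
    constructor
    · rintro (a | b) (a' | b') h
      · exact congrArg Sum.inl (cofCell_injective hf h)
      · exact absurd h (key a b')
      · exact absurd h.symm (key a' b)
      · exact congrArg Sum.inr (Subtype.ext h)
    · intro b
      rcases cof_cell_cases hf b with ⟨a, ha, hab⟩ | hb
      · exact ⟨.inl a, op_injective ((image_op hf a).symm.trans hab)⟩
      · exact ⟨.inr ⟨b, hb⟩, rfl⟩)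

open Classical in
lemma sum_cof {M : Type*} [AddCommMonoid M] (hf : cof f) (F : Y.Cell → M) :
    ∑ b : Y.Cell, F b = ∑ a : X.Cell, F (cofCell hf a) +
      ∑ b : {b : Y.Cell // ∀ x, toFun f x ∉ op b}, F b.1 := by
  rw [← Fintype.sum_equiv (cofCellEquiv hf) (fun c => F (cofCellEquiv hf c)) F (fun _ => rfl),
    Fintype.sum_sum_type]
  rfl

open Classical in
lemma sum_po {M : Type*} [AddCommMonoid M] (hf : cof f) (g : X ⟶ X')
    (F : (po g hf).Cell → M) :
    ∑ c : (po g hf).Cell, F c = ∑ a : X'.Cell, F (cellInr g hf a) +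
      ∑ b : {b : Y.Cell // ∀ x, toFun f x ∉ op b}, F (cellInl g hf b.1 b.2) := by
  rw [← Fintype.sum_equiv (poCellEquiv hf).symm (fun c => F ((poCellEquiv hf).symm c)) F
    (fun _ => rfl), Fintype.sum_sum_type]
  rfl

lemma sum_iso {M : Type*} [AddCommMonoid M] (e : X ≅ Y) (F : Y.Cell → M) :
    ∑ b : Y.Cell, F b = ∑ a : X.Cell, F (cofCell (cof_of_iso e) a) := by
  rw [sum_cof (cof_of_iso e)]
  have : IsEmpty {b : Y.Cell // ∀ x, toFun e.hom x ∉ op b} := ⟨fun b => by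
    obtain ⟨y, hy⟩ := op_nonempty b.1
    refine b.2 (toFun e.inv y) ?_
    rw [← toFun_comp, e.inv_hom_id]
    exact hy⟩
  simp

/-- The condition of even boundaries passes to the images of the boundaries under any map. -/
lemma sum_bd_eq_zero (hX : EvenBdry X) {f : X ⟶ Y} (w : Set Y.Cell → ZMod 2)
    (hw : ∀ B, B.ncard < 3 → w B = 0) :
    ∑ e : X.Cell, (if e.1 = 2 then w (push f (bd e)) else 0) = 0 :=
  hX (fun B => w (push f B)) fun B hB => hw _ ((ncard_push_le f B).trans_lt hB)

lemma EvenBdry.of_iso (e : X ≅ Y) (hX : EvenBdry X) : EvenBdry Y := fun w hw => by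
  rw [sum_iso e]
  refine (Finset.sum_congr rfl fun a _ => ?_).trans (sum_bd_eq_zero hX (f := e.hom) w hw)
  rw [cofCell_dim, bd_image (cellPres_of_cof (cof_of_iso e)) (image_op (cof_of_iso e) a)]

lemma cellPres_poInl (hf : cof f) {g : X ⟶ X'} (hg : CellPres g) : CellPres (poInl g hf) := by
  intro b
  rcases cof_cell_cases hf b with ⟨a, ha, hab⟩ | hb
  · have h : toFun (poInl g hf) '' op b = toFun (g ≫ poInr g hf) '' op a := by
      rw [← hab, Set.image_image, ← (isPushout_po g hf).w]
      rfl
    rw [h, ← ha]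
    exact hg.comp (cellPres_of_cof (cof_poInr hf)) a
  · exact Or.inl ⟨cellInl g hf b hb, rfl, image_poInl hf b hb⟩

/-- The class of complexes with even boundaries is closed under pushouts of cofibrations along
cell-preserving maps: the sum over the pushout is the sum over `X'` plus the sum over `Y` minus the
sum over `X`, and pushing sets of 1-cells forward does not raise their cardinality. -/
lemma evenBdry_po (hf : cof f) {g : X ⟶ X'} (hg : CellPres g) (hX : EvenBdry X) (hY : EvenBdry Y)
    (hX' : EvenBdry X') : EvenBdry (po g hf) := by
  classical
  intro w hw
  let w' : Set Y.Cell → ZMod 2 := fun B => w (push (poInl g hf) B)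
  have hw' : ∀ B, B.ncard < 3 → w' B = 0 := fun B hB =>
    hw _ ((ncard_push_le _ B).trans_lt hB)
  have h1 := sum_bd_eq_zero hX' (f := poInr g hf) w hw
  have h2 := hY w' hw'
  have h3 := sum_bd_eq_zero hX (f := f) w' hw'
  rw [sum_cof hf] at h2
  have h4 : ∑ a : X.Cell, (if (cofCell hf a).1 = 2 then w' (bd (cofCell hf a)) else 0) =
      ∑ e : X.Cell, (if e.1 = 2 then w' (push f (bd e)) else 0) :=
    Finset.sum_congr rfl fun a _ => by
      rw [cofCell_dim, bd_image (cellPres_of_cof hf) (image_op hf a)]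
  rw [h4, h3, zero_add] at h2
  rw [sum_po hf g]
  have h5 : ∑ a : X'.Cell, (if (cellInr g hf a).1 = 2 then w (bd (cellInr g hf a)) else 0) =
      ∑ e : X'.Cell, (if e.1 = 2 then w (push (poInr g hf) (bd e)) else 0) :=
    Finset.sum_congr rfl fun a _ => by
      rw [bd_image (cellPres_of_cof (cof_poInr hf)) (image_poInr hf a)]
      rfl
  rw [h5, h1, zero_add]
  refine (Finset.sum_congr rfl fun b _ => ?_).trans h2
  rw [bd_image (cellPres_poInl hf hg) (image_poInl hf b.1 b.2)]
  rfl

variable {g : X ⟶ X'} {h : Y ⟶ P} {k : X' ⟶ P}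

/-- The comparison of an arbitrary pushout with the adjunction space. -/
def poIso (hf : cof f) (H : IsPushout f g h k) : po g hf ≅ P :=
  (isPushout_po g hf).isoIsPushout _ _ H

lemma poInl_poIso (hf : cof f) (H : IsPushout f g h k) :
    poInl g hf ≫ (poIso hf H).hom = h := IsPushout.inl_isoIsPushout_hom ..

lemma poInr_poIso (hf : cof f) (H : IsPushout f g h k) :
    poInr g hf ≫ (poIso hf H).hom = k := IsPushout.inr_isoIsPushout_hom ..

lemma cof_of_isPushout (hf : cof f) (H : IsPushout f g h k) : cof k := by
  rw [← poInr_poIso hf H]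
  exact cof_comp (cof_poInr hf) (cof_of_iso _)

lemma cellPres_of_isPushout (hf : cof f) (hg : CellPres g) (H : IsPushout f g h k) :
    CellPres h := by
  rw [← poInl_poIso hf H]
  exact (cellPres_poInl hf hg).comp (cellPres_of_cof (cof_of_iso _))

lemma evenBdry_of_isPushout (hf : cof f) (hg : CellPres g) (hX : EvenBdry X) (hY : EvenBdry Y)
    (hX' : EvenBdry X') (H : IsPushout f g h k) : EvenBdry P :=
  (evenBdry_po hf hg hX hY hX').of_iso (poIso hf H)

/-- A map out of a pushout is cell-preserving if its two restrictions are. -/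
lemma cellPres_desc (hf : cof f) (H : IsPushout f g h k) {V : FinCW} (u : P ⟶ V)
    (hh : CellPres (h ≫ u)) (hk : CellPres (k ≫ u)) : CellPres u := by
  have key : CellPres ((poIso hf H).hom ≫ u) := by
    have h1 : poInl g hf ≫ (poIso hf H).hom ≫ u = h ≫ u := by
      rw [← Category.assoc, poInl_poIso]
    have h2 : poInr g hf ≫ (poIso hf H).hom ≫ u = k ≫ u := by
      rw [← Category.assoc, poInr_poIso]
    intro c
    obtain ⟨a | b, rfl⟩ := (poCellEquiv hf).symm.surjective c
    · have := hk a
      rw [← h2] at this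
      change (∃ b : V.Cell, b.1 = (cellInr g hf a).1 ∧ _ '' op (cellInr g hf a) = op b) ∨
        _ '' op (cellInr g hf a) = _
      rw [← image_poInr hf a, Set.image_image]
      exact this
    · have := hh b.1
      rw [← h1] at this
      change (∃ c : V.Cell, c.1 = (cellInl g hf b.1 b.2).1 ∧
          _ '' op (cellInl g hf b.1 b.2) = op c) ∨
        _ '' op (cellInl g hf b.1 b.2) = _
      rw [← image_poInl hf b.1 b.2, Set.image_image]
      exact this
  have := (cellPres_of_cof (cof_of_iso (poIso hf H).symm)).comp key
  rwa [Iso.symm_hom, Iso.inv_hom_id_assoc] at this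

/-- The number of `n`-cells. The sum is finite because `X` has finitely many cells. -/
def numCells (X : FinCW) (n : ℕ) : ℕ := ∑ a : X.Cell, if a.1 = n then 1 else 0

lemma numCells_of_iso (e : X ≅ Y) (n : ℕ) : Y.numCells n = X.numCells n := by
  rw [numCells, sum_iso e]
  exact Finset.sum_congr rfl fun a _ => by rw [cofCell_dim]

/-- Additivity of the number of cells for pushouts. -/
lemma numCells_of_isPushout (hf : cof f) (H : IsPushout f g h k) (n : ℕ) :
    P.numCells n + X.numCells n = X'.numCells n + Y.numCells n := by
  classical
  rw [numCells_of_iso (poIso hf H), numCells, sum_po hf g, numCells, numCells, numCells,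
    sum_cof hf]
  simp only [cofCell_dim]
  have h1 : ∀ a : X'.Cell, (cellInr g hf a).1 = a.1 := fun _ => rfl
  have h2 : ∀ b : {b : Y.Cell // ∀ x, toFun f x ∉ op b}, (cellInl g hf b.1 b.2).1 = b.1.1 :=
    fun _ => rfl
  simp only [h1, h2]
  omega

/-- The points of a pushout come from the two complexes that are glued. -/
lemma exists_of_isPushout (hf : cof f) (H : IsPushout f g h k) (z : P) :
    (∃ x', toFun k x' = z) ∨ ∃ y, toFun h y = z := by
  have hz : toFun (poIso hf H).hom (toFun (poIso hf H).inv z) = z := by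
    rw [← toFun_comp, Iso.inv_hom_id]; rfl
  rcases po_cases hf (toFun (poIso hf H).inv z) with ⟨x', e⟩ | ⟨y, _, e⟩
  · left
    exact ⟨x', by rw [← hz, e, ← toFun_comp, poInr_poIso]⟩
  · right
    exact ⟨y, by rw [← hz, e, ← toFun_comp, poInl_poIso]⟩

end Cof

/-! #### The one-point complex -/

/-- The cell structure of a point. -/
def pointDecomp : CellDecomp PUnit where
  ι n := {_u : Unit // n = 0}
  map _ _ _ := ⟨⟩
  finite := by
    refine Finite.of_injective (β := Unit) (fun _ => ()) ?_
    rintro ⟨n, _, rfl⟩ ⟨m, _, rfl⟩ _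
    rfl
  cont _ _ := continuousOn_const
  inj := by
    rintro n ⟨_, rfl⟩ x _ y _ _
    exact Subsingleton.elim _ _
  unique := by
    rintro ⟨n, _, rfl⟩ ⟨m, _, rfl⟩ _ _ _ _ _
    rfl
  bdry := by
    rintro n ⟨_, rfl⟩ x hx
    rw [mem_sphere_zero_iff_norm, Subsingleton.elim x 0, norm_zero] at hx
    exact absurd hx zero_ne_one
  cover x := ⟨0, ⟨(), rfl⟩, 0, Metric.mem_ball_self one_pos, rfl⟩

/-- The one-point complex. -/
def point : FinCW := pointDecomp.toFinCW ⟨⟩ ⟨⟨(), rfl⟩, rfl⟩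

instance : Unique point.Cell where
  default := ⟨0, ⟨(), rfl⟩⟩
  uniq := by
    rintro ⟨n, _, rfl⟩
    rfl

lemma point_dim (a : point.Cell) : a.1 = 0 := by
  rw [Subsingleton.elim a default]; rfl

instance : Subsingleton point := inferInstanceAs (Subsingleton PUnit)

/-- The morphism to the one-point complex. -/
def toPoint (X : FinCW) : X ⟶ point :=
  Hom.mk (Y := point) ⟨fun _ => ⟨⟩, continuous_const⟩ rfl fun n x _ => by
    refine mem_skel.2 ⟨default, Nat.zero_le _, ?_⟩
    obtain ⟨y, hy⟩ := op_nonempty (default : point.Cell)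
    exact hy

/-- The morphism from the one-point complex. -/
def fromPoint (X : FinCW) : point ⟶ X :=
  Hom.mk (X := point) ⟨fun _ => X.base, continuous_const⟩ rfl fun n x _ =>
    mem_skel.2 ⟨X.baseCell, by rw [baseCell_dim]; omega, by rw [op_baseCell]; rfl⟩

lemma isZero_point : IsZero point := by
  refine ⟨fun X => ⟨⟨⟨fromPoint X⟩, fun f => hom_ext fun x => ?_⟩⟩,
    fun X => ⟨⟨⟨toPoint X⟩, fun f => hom_ext fun x => Subsingleton.elim _ _⟩⟩⟩
  rw [Subsingleton.elim x point.base, toFun_base]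
  exact (toFun_base _).symm

lemma cellPres_toPoint (X : FinCW) : CellPres (toPoint X) := fun a => Or.inr (by
  obtain ⟨x, hx⟩ := op_nonempty a
  ext y
  simp only [Set.mem_singleton_iff]
  exact ⟨fun _ => Subsingleton.elim _ _, fun _ => ⟨x, hx, Subsingleton.elim _ _⟩⟩)

lemma cof_fromPoint (X : FinCW) : cof (fromPoint X) := by
  refine cof_iff.2 ⟨fun _ _ _ => Subsingleton.elim _ _, fun a =>
    ⟨X.baseCell, by rw [baseCell_dim, point_dim], ?_⟩⟩
  rw [op_baseCell]
  obtain ⟨x, hx⟩ := op_nonempty a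
  ext y
  simp only [Set.mem_singleton_iff]
  constructor
  · rintro ⟨z, _, rfl⟩
    rfl
  · rintro rfl
    exact ⟨x, hx, rfl⟩

lemma cof_of_isZero (f : X ⟶ Y) (hX : IsZero X) : cof f := by
  have : f = (hX.iso isZero_point).hom ≫ fromPoint Y := hX.eq_of_src _ _
  rw [this]
  exact cof_comp (cof_of_iso _) (cof_fromPoint Y)

/-- With at most two 1-cells, every set of 1-cells is too small to count. -/
lemma evenBdry_of_numCells {X : FinCW} (h : X.numCells 1 < 3) : EvenBdry X := by
  intro w hw
  refine Finset.sum_eq_zero fun e _ => ?_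
  split_ifs
  · refine hw _ (lt_of_le_of_lt ?_ h)
    classical
    rw [numCells, Finset.sum_boole, Set.ncard_eq_toFinset_card' (bd e)]
    refine Finset.card_le_card fun c hc => ?_
    rw [Set.mem_toFinset] at hc
    simp [hc.1]
  · rfl

lemma numCells_point (n : ℕ) (hn : n ≠ 0) : point.numCells n = 0 :=
  Finset.sum_eq_zero fun a _ => by rw [point_dim, if_neg hn.symm]

lemma evenBdry_point : EvenBdry point := evenBdry_of_numCells (by
  rw [numCells_point 1 one_ne_zero]; norm_num)

/-- Complexes with even boundaries and cell-preserving maps. -/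
def evenSubcat : Subcat FinCW where
  obj := EvenBdry
  hom X Y f := CellPres f ∧ EvenBdry X ∧ EvenBdry Y
  source h := h.2.1
  target h := h.2.2
  id h := ⟨cellPres_of_cof (cof_of_iso (Iso.refl _)), h, h⟩
  comp hf hg := ⟨hf.1.comp hg.1, hf.2.1, hg.2.2⟩

lemma isCokernelOf_po {f : X ⟶ Y} (hf : cof f) : IsCokernelOf f (poInl (toPoint X) hf) :=
  ⟨point, _, _, isZero_point, isPushout_po (toPoint X) hf⟩

open Subcat

/-- In this subcategory the ambient cofibrations have cokernels, so they are its cofibrations. -/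
lemma cof_evenSubcat {X Y : evenSubcat.Obj} {f : X ⟶ Y} (hf : cof (evenSubcat.incl.map f)) :
    evenSubcat.cof cof f :=
  have hQ : EvenBdry (po (toPoint X.val) hf) :=
    evenBdry_po hf (cellPres_toPoint _) X.prop Y.prop evenBdry_point
  ⟨hf, ⟨_, hQ⟩, homMk (poInl (toPoint X.val) hf)
    ⟨cellPres_poInl hf (cellPres_toPoint _), Y.prop, hQ⟩, isCokernelOf_po hf⟩

/-- Pushouts formed in the ambient category stay in the subcategory, by `evenBdry_po`. -/
lemma isSubcatWithCof_evenSubcat : IsSubcatWithCof cof evenSubcat := by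
  have hcp : ∀ {X Y : evenSubcat.Obj} (f : X ⟶ Y), CellPres (evenSubcat.incl.map f) :=
    fun f => (hom_incl_map f).1
  have hpush : ∀ {X Y X' : evenSubcat.Obj} (f : X ⟶ Y) (g : X ⟶ X'),
      evenSubcat.cof cof f → ∃ (P : evenSubcat.Obj) (h : Y ⟶ P) (k : X' ⟶ P),
        IsPushout f g h k ∧ IsPushout (evenSubcat.incl.map f) (evenSubcat.incl.map g)
          (evenSubcat.incl.map h) (evenSubcat.incl.map k) := by
    intro X Y X' f g hf
    have hP : EvenBdry (po (evenSubcat.incl.map g) hf.1) :=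
      evenBdry_po hf.1 (hcp g) X.prop Y.prop X'.prop
    have H := isPushout_po (evenSubcat.incl.map g) hf.1
    exact ⟨⟨_, hP⟩, homMk (poInl _ hf.1) ⟨cellPres_poInl hf.1 (hcp g), Y.prop, hP⟩,
      homMk (poInr _ hf.1) ⟨cellPres_of_cof (cof_poInr hf.1), X'.prop, hP⟩,
      isPushout_of_incl H fun u hu hv => ⟨cellPres_desc hf.1 H u hu.1 hv.1, hP, hu.2.2⟩, H⟩
  have hpres : ∀ {X Y X' P : evenSubcat.Obj} {f : X ⟶ Y} {g : X ⟶ X'} {h : Y ⟶ P}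
      {k : X' ⟶ P}, evenSubcat.cof cof f → IsPushout f g h k →
        IsPushout (evenSubcat.incl.map f) (evenSubcat.incl.map g)
          (evenSubcat.incl.map h) (evenSubcat.incl.map k) := by
    intro X Y X' P f g h k hf H
    obtain ⟨P', h', k', H', HF⟩ := hpush f g hf
    exact isPushout_comparison _ H H' HF
  let Z : evenSubcat.Obj := ⟨point, evenBdry_point⟩
  have hZ : IsZero Z := by
    refine ⟨fun Y => ⟨⟨⟨homMk (fromPoint Y.val) ⟨cellPres_of_cof (cof_fromPoint _),
      evenBdry_point, Y.prop⟩⟩, fun f => obj_ext (isZero_point.eq_of_src _ _)⟩⟩,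
      fun Y => ⟨⟨⟨homMk (toPoint Y.val) ⟨cellPres_toPoint _, Y.prop, evenBdry_point⟩⟩,
      fun f => obj_ext (isZero_point.eq_of_tgt _ _)⟩⟩⟩
  have hzero : ∀ W : evenSubcat.Obj, IsZero W → IsZero (evenSubcat.incl.obj W) :=
    fun W hW => isZero_of_iso_map _ hW hZ isZero_point
  refine ⟨fun e hX => ⟨cellPres_of_cof (cof_of_iso e), hX, EvenBdry.of_iso e hX⟩,
    ⟨⟨Z, hZ⟩, fun f hW => ?_, fun f hf => ?_, fun f g hf hg => ?_, fun f g hf => ?_,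
    fun H hf => ?_⟩, hzero, hpres⟩
  · exact cof_evenSubcat (cof_of_isZero _ (hzero _ hW))
  · exact cof_evenSubcat (cof_of_iso (asIso (evenSubcat.incl.map f)))
  · refine cof_evenSubcat ?_
    rw [Functor.map_comp]
    exact cof_comp hf.1 hg.1
  · obtain ⟨P', h', k', H', _⟩ := hpush f g hf
    exact ⟨P', h', k', H'⟩
  · exact cof_evenSubcat (cof_of_isPushout hf.1 (hpres hf H))

end FinCW

/-! ### Subcomplexes -/

namespace FinCW

variable {X Y W : FinCW}

/-- A subset is (the underlying set of) a subcomplex if it is closed, contains the base point and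
is a union of open cells. -/
structure IsSub (X : FinCW) (E : Set X) : Prop where
  isClosed : IsClosed E
  base_mem : X.base ∈ E
  op_subset : ∀ (a : X.Cell) (x : X), x ∈ op a → x ∈ E → op a ⊆ E

section Sub

variable {E : Set X} (hE : X.IsSub E)

lemma IsSub.cl_subset (hE : X.IsSub E) {a : X.Cell} (ha : op a ⊆ E) : cl a ⊆ E := by
  rw [← closure_op]
  exact closure_minimal ha hE.isClosed

open Classical in
/-- The characteristic maps of a subcomplex; the values outside of the closed ball are
irrelevant. -/
def subChar (hE : X.IsSub E) (n : ℕ)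
    (i : {i : RelCWComplex.cell (Set.univ : Set X) n // op (⟨n, i⟩ : X.Cell) ⊆ E})
    (v : Fin n → ℝ) : E :=
  if h : RelCWComplex.map n i.1 v ∈ E then ⟨_, h⟩ else ⟨X.base, hE.base_mem⟩

lemma subChar_val (hE : X.IsSub E) {n : ℕ}
    (i : {i : RelCWComplex.cell (Set.univ : Set X) n // op (⟨n, i⟩ : X.Cell) ⊆ E})
    {v : Fin n → ℝ} (hv : v ∈ Metric.closedBall 0 1) :
    (subChar hE n i v).1 = RelCWComplex.map n i.1 v := by
  have : RelCWComplex.map n i.1 v ∈ E := hE.cl_subset i.2 (Set.mem_image_of_mem _ hv)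
  rw [subChar, dif_pos this]

lemma subChar_image (hE : X.IsSub E) {n : ℕ}
    (i : {i : RelCWComplex.cell (Set.univ : Set X) n // op (⟨n, i⟩ : X.Cell) ⊆ E}) (x : E) :
    x ∈ subChar hE n i '' Metric.ball 0 1 ↔ x.1 ∈ op (⟨n, i.1⟩ : X.Cell) := by
  constructor
  · rintro ⟨v, hv, rfl⟩
    rw [subChar_val hE i (Metric.ball_subset_closedBall hv)]
    exact Set.mem_image_of_mem _ hv
  · rintro ⟨v, hv, h⟩
    exact ⟨v, hv, Subtype.ext ((subChar_val hE i (Metric.ball_subset_closedBall hv)).trans h)⟩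

/-- The cell decomposition of a subcomplex. -/
def subDecomp (hE : X.IsSub E) : CellDecomp E where
  ι n := {i : RelCWComplex.cell (Set.univ : Set X) n // op (⟨n, i⟩ : X.Cell) ⊆ E}
  map := subChar hE
  finite := by
    refine Finite.of_injective (β := X.Cell) (fun a => ⟨a.1, a.2.1⟩) ?_
    rintro ⟨n, i, hi⟩ ⟨m, j, hj⟩ h
    cases h
    rfl
  cont n i := by
    rw [Topology.IsInducing.subtypeVal.continuousOn_iff]
    exact (RelCWComplex.continuousOn n i.1).congr fun v hv => subChar_val hE i hv
  inj n i x hx y hy h := by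
    have h' := congrArg Subtype.val h
    rw [subChar_val hE i (Metric.ball_subset_closedBall hx),
      subChar_val hE i (Metric.ball_subset_closedBall hy)] at h'
    rw [← RelCWComplex.source_eq n i.1] at hx hy
    exact (RelCWComplex.map n i.1).injOn hx hy h'
  unique a b x hx y hy h := by
    obtain ⟨n, i, hi⟩ := a
    obtain ⟨m, j, hj⟩ := b
    have h1 := (subChar_image hE ⟨i, hi⟩ _).1 ⟨x, hx, rfl⟩
    have h2 := (subChar_image hE ⟨j, hj⟩ _).1 ⟨y, hy, h.symm⟩
    cases cell_unique h1 h2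
    rfl
  bdry n i x hx := by
    obtain ⟨⟨m, j⟩, hm, hj⟩ := mem_skel_of_sphere i.1 hx
    have hx' := Metric.sphere_subset_closedBall hx
    rw [← subChar_val hE i hx'] at hj
    exact ⟨m, hm, ⟨j, hE.op_subset _ _ hj (subChar hE n i x).2⟩, (subChar_image hE _ _).2 hj⟩
  cover x := by
    obtain ⟨⟨n, i⟩, hi⟩ := exists_mem_op x.1
    exact ⟨n, ⟨i, hE.op_subset _ _ hi x.2⟩, (subChar_image hE _ _).2 hi⟩

/-- A subcomplex as a finite based CW complex. -/
def sub (hE : X.IsSub E) : FinCW :=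
  (subDecomp hE).toFinCW ⟨X.base, hE.base_mem⟩ (by
    obtain ⟨⟨n, i⟩, hn, h⟩ := X.exists_base_cell
    obtain rfl : n = 0 := hn
    have hi : op (⟨0, i⟩ : X.Cell) ⊆ E := by
      rw [h]
      exact Set.singleton_subset_iff.2 hE.base_mem
    refine ⟨⟨i, hi⟩, Subtype.ext ?_⟩
    have h1 : (subChar hE 0 ⟨i, hi⟩ 0).1 ∈ op (⟨0, i⟩ : X.Cell) :=
      (subChar_image hE ⟨i, hi⟩ _).1 ⟨0, Metric.mem_ball_self one_pos, rfl⟩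
    rw [h] at h1
    exact h1)

/-- The cells of a subcomplex. -/
def subCellEquiv (hE : X.IsSub E) : (sub hE).Cell ≃ {a : X.Cell // op a ⊆ E} where
  toFun a := ⟨⟨a.1, a.2.1⟩, a.2.2⟩
  invFun a := ⟨a.1.1, ⟨a.1.2, a.2⟩⟩
  left_inv _ := rfl
  right_inv _ := rfl

lemma mem_op_sub (hE : X.IsSub E) (a : (sub hE).Cell) (x : E) :
    (show sub hE from x) ∈ op a ↔ x.1 ∈ op (subCellEquiv hE a).1 :=
  subChar_image hE a.2 x

/-- The inclusion of a subcomplex. -/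
def subIncl (hE : X.IsSub E) : sub hE ⟶ X :=
  Hom.mk (X := sub hE) ⟨fun x : E => x.1, continuous_subtype_val⟩ rfl fun n x hx => by
    obtain ⟨a, ha, h⟩ := mem_skel.1 hx
    exact mem_skel.2 ⟨_, ha, (mem_op_sub hE a x).1 h⟩

lemma range_subIncl (hE : X.IsSub E) : Set.range (toFun (subIncl hE)) = E := Subtype.range_val

lemma cof_subIncl (hE : X.IsSub E) : cof (subIncl hE) := by
  refine cof_iff.2 ⟨Subtype.val_injective, fun a => ⟨(subCellEquiv hE a).1, rfl, ?_⟩⟩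
  ext y
  constructor
  · rintro ⟨x, hx, rfl⟩
    exact (mem_op_sub hE a x).1 hx
  · intro hy
    exact ⟨(⟨y, (subCellEquiv hE a).2 hy⟩ : E), (mem_op_sub hE a _).2 hy, rfl⟩

/-- The factorization of a morphism through a subcomplex. -/
def subLift (hE : X.IsSub E) (f : W ⟶ X) (hf : ∀ x, toFun f x ∈ E) : W ⟶ sub hE :=
  Hom.mk (Y := sub hE) ⟨fun x => (⟨toFun f x, hf x⟩ : E), (toFun f).continuous.subtype_mk hf⟩
    (Subtype.ext (toFun_base f)) fun n x hx => by
      obtain ⟨a, ha, h⟩ := mem_skel.1 (Hom.cellular f n hx)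
      exact mem_skel.2 ⟨(subCellEquiv hE).symm ⟨a, hE.op_subset a _ h (hf x)⟩, ha,
        (mem_op_sub hE _ _).2 h⟩

lemma cof_subLift (hE : X.IsSub E) (f : W ⟶ X) (hf : ∀ x, toFun f x ∈ E) (hc : cof f) :
    cof (subLift hE f hf) := by
  refine cof_iff.2 ⟨fun x y h => hc.1 (congrArg (toFun (subIncl hE)) h), fun a => ?_⟩
  obtain ⟨b, hb, hab⟩ := (cof_iff.1 hc).2 a
  have hbE : op b ⊆ E := by
    rw [← hab]
    rintro _ ⟨x, _, rfl⟩
    exact hf x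
  refine ⟨(subCellEquiv hE).symm ⟨b, hbE⟩, hb, ?_⟩
  ext y
  refine Iff.trans ?_ (mem_op_sub hE _ y).symm
  rw [Equiv.apply_symm_apply, ← hab]
  constructor
  · rintro ⟨x, hx, rfl⟩
    exact ⟨x, hx, rfl⟩
  · rintro ⟨x, hx, h⟩
    exact ⟨x, hx, Subtype.ext h⟩

open Classical in
lemma numCells_sub (hE : X.IsSub E) (n : ℕ) :
    (sub hE).numCells n = ∑ a : X.Cell, if op a ⊆ E then (if a.1 = n then 1 else 0) else 0 := by
  rw [numCells, ← Finset.sum_filter (fun a : X.Cell => op a ⊆ E),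
    Finset.sum_subtype (p := fun a => op a ⊆ E) _ (by simp)]
  exact Fintype.sum_equiv (subCellEquiv hE) _
    (fun a : {a : X.Cell // op a ⊆ E} => if a.1.1 = n then 1 else 0) fun a => rfl

end Sub

/-! ### The torus -/

/-- The quotient map from the plane to the torus. -/
def torusMk (p : ℝ × ℝ) : Torus := (p.1, p.2)

lemma continuous_torusMk : Continuous torusMk :=
  ((AddCircle.continuous_mk' 1).comp continuous_fst).prodMk
    ((AddCircle.continuous_mk' 1).comp continuous_snd)

lemma coe_one : ((1 : ℝ) : UnitAddCircle) = 0 := AddCircle.coe_period 1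

lemma coe_inj {x y : ℝ} (hx : 0 ≤ x) (hx' : x < 1) (hy : 0 ≤ y) (hy' : y < 1)
    (h : (x : UnitAddCircle) = y) : x = y :=
  (AddCircle.coe_eq_coe_iff_of_mem_Ico (a := 0) ⟨hx, by simpa⟩ ⟨hy, by simpa⟩).1 h

lemma exists_coe (p : UnitAddCircle) : ∃ x : ℝ, 0 ≤ x ∧ x < 1 ∧ (x : UnitAddCircle) = p := by
  have h : p ∈ ((↑) : ℝ → UnitAddCircle) '' Set.Ico 0 (0 + 1) := by
    rw [AddCircle.coe_image_Ico_eq]; trivial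
  obtain ⟨x, hx, h⟩ := h
  exact ⟨x, hx.1, by simpa using hx.2, h⟩

/-- The cells of the torus: one vertex, the vertical, horizontal and diagonal edge, and the two
triangles, above and below the diagonal. -/
inductive TCell : ℕ → Type
  | pt : TCell 0
  | ver : TCell 1
  | hor : TCell 1
  | diag : TCell 1
  | up : TCell 2
  | low : TCell 2

/-- The affine map from `[-1, 1]` to `[0, 1]`. -/
def half (t : ℝ) : ℝ := (t + 1) / 2

lemma continuous_half : Continuous half := by
  unfold half
  fun_prop

lemma half_mem {t : ℝ} (ht : |t| < 1) : 0 < half t ∧ half t < 1 := by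
  rw [abs_lt] at ht
  unfold half
  constructor <;> linarith

lemma half_abs {t : ℝ} (ht : |t| = 1) : half t = 0 ∨ half t = 1 := by
  unfold half
  rcases eq_or_eq_neg_of_abs_eq ht with rfl | rfl <;> norm_num

lemma half_inj {s t : ℝ} (h : half s = half t) : s = t := by
  unfold half at h
  linarith

lemma half_dbl (t : ℝ) : half (2 * t - 1) = t := by
  unfold half
  ring

lemma abs_dbl {t : ℝ} (h : 0 < t) (h' : t < 1) : |2 * t - 1| < 1 := by
  rw [abs_lt]
  constructor <;> linarith

/-- The characteristic maps of the torus, with values in the unit square. The square is mapped onto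
each of the two triangles by collapsing one side. -/
def planeChar : ∀ {n}, TCell n → (Fin n → ℝ) → ℝ × ℝ
  | _, .pt, _ => (0, 0)
  | _, .ver, v => (0, half (v 0))
  | _, .hor, v => (half (v 0), 0)
  | _, .diag, v => (half (v 0), half (v 0))
  | _, .up, v => (half (v 0) * half (v 1), half (v 1))
  | _, .low, v => (half (v 1), half (v 0) * half (v 1))

/-- The subset of `[0, 1)²` corresponding to a cell of the torus. -/
def Region : ∀ {n}, TCell n → ℝ × ℝ → Prop
  | _, .pt, p => p.1 = 0 ∧ p.2 = 0
  | _, .ver, p => p.1 = 0 ∧ 0 < p.2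
  | _, .hor, p => 0 < p.1 ∧ p.2 = 0
  | _, .diag, p => 0 < p.1 ∧ p.1 = p.2
  | _, .up, p => 0 < p.1 ∧ p.1 < p.2
  | _, .low, p => 0 < p.2 ∧ p.2 < p.1

/-- The half-open unit square, a fundamental domain for the torus. -/
def unitSquare : Set (ℝ × ℝ) := {p | 0 ≤ p.1 ∧ p.1 < 1 ∧ 0 ≤ p.2 ∧ p.2 < 1}

lemma region_unique {a b : Σ n, TCell n} {p : ℝ × ℝ} (ha : Region a.2 p) (hb : Region b.2 p) :
    a = b := by
  obtain ⟨n, a⟩ := a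
  obtain ⟨m, b⟩ := b
  cases a <;> cases b <;> first
    | rfl
    | (exfalso; obtain ⟨h1, h2⟩ := ha; obtain ⟨h3, h4⟩ := hb; linarith)

lemma exists_region {p : ℝ × ℝ} (hp : p ∈ unitSquare) : ∃ (n : ℕ) (a : TCell n), Region a p := by
  obtain ⟨h1, -, h2, -⟩ := hp
  rcases h1.eq_or_lt with h1 | h1 <;> rcases h2.eq_or_lt with h2 | h2
  · exact ⟨0, .pt, h1.symm, h2.symm⟩
  · exact ⟨1, .ver, h1.symm, h2⟩
  · exact ⟨1, .hor, h1, h2.symm⟩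
  · rcases lt_trichotomy p.1 p.2 with h | h | h
    · exact ⟨2, .up, h1, h⟩
    · exact ⟨1, .diag, h1, h⟩
    · exact ⟨2, .low, h2, h⟩

lemma mem_ball_pi {n : ℕ} {v : Fin n → ℝ} :
    v ∈ Metric.ball (0 : Fin n → ℝ) 1 ↔ ∀ i, |v i| < 1 := by
  rw [mem_ball_zero_iff, pi_norm_lt_iff one_pos]
  simp only [Real.norm_eq_abs]

/-- The characteristic maps identify the open cells with the pieces of the half-open square. -/
lemma planeChar_image {n : ℕ} (a : TCell n) (p : ℝ × ℝ) :
    p ∈ planeChar a '' Metric.ball 0 1 ↔ p ∈ unitSquare ∧ Region a p := by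
  constructor
  · rintro ⟨v, hv, rfl⟩
    rw [mem_ball_pi] at hv
    cases a with
    | pt => simp [planeChar, unitSquare, Region]
    | ver => have := half_mem (hv 0); simp [planeChar, unitSquare, Region, this, this.1.le]
    | hor => have := half_mem (hv 0); simp [planeChar, unitSquare, Region, this, this.1.le]
    | diag => have := half_mem (hv 0); simp [planeChar, unitSquare, Region, this, this.1.le]
    | up =>
      have h0 := half_mem (hv 0)
      have h1 := half_mem (hv 1)
      have h2 := mul_pos h0.1 h1.1
      have h3 : half (v 0) * half (v 1) < half (v 1) := by nlinarith
      exact ⟨⟨h2.le, h3.trans h1.2, h1.1.le, h1.2⟩, h2, h3⟩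
    | low =>
      have h0 := half_mem (hv 0)
      have h1 := half_mem (hv 1)
      have h2 := mul_pos h0.1 h1.1
      have h3 : half (v 0) * half (v 1) < half (v 1) := by nlinarith
      exact ⟨⟨h1.1.le, h1.2, h2.le, h3.trans h1.2⟩, h2, h3⟩
  · obtain ⟨x, y⟩ := p
    rintro ⟨⟨h1, h2, h3, h4⟩, h⟩
    cases a with
    | pt => exact ⟨0, Metric.mem_ball_self one_pos, Prod.ext h.1.symm h.2.symm⟩
    | ver => exact ⟨fun _ => 2 * y - 1, mem_ball_pi.2 fun _ => abs_dbl h.2 h4,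
        Prod.ext h.1.symm (half_dbl y)⟩
    | hor => exact ⟨fun _ => 2 * x - 1, mem_ball_pi.2 fun _ => abs_dbl h.1 h2,
        Prod.ext (half_dbl x) h.2.symm⟩
    | diag => exact ⟨fun _ => 2 * x - 1, mem_ball_pi.2 fun _ => abs_dbl h.1 h2,
        Prod.ext (half_dbl x) ((half_dbl x).trans h.2)⟩
    | up =>
      have hx : 0 < x := h.1
      have hxy : x < y := h.2
      have hy : 0 < y := hx.trans hxy
      refine ⟨![2 * (x / y) - 1, 2 * y - 1], mem_ball_pi.2 fun i => ?_, Prod.ext ?_ ?_⟩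
      · fin_cases i
        · exact abs_dbl (div_pos hx hy) ((div_lt_one hy).2 hxy)
        · exact abs_dbl hy h4
      · change half (2 * (x / y) - 1) * half (2 * y - 1) = x
        rw [half_dbl, half_dbl, div_mul_cancel₀ _ hy.ne']
      · exact half_dbl y
    | low =>
      have hy : 0 < y := h.1
      have hxy : y < x := h.2
      have hx : 0 < x := hy.trans hxy
      refine ⟨![2 * (y / x) - 1, 2 * x - 1], mem_ball_pi.2 fun i => ?_, Prod.ext ?_ ?_⟩
      · fin_cases i
        · exact abs_dbl (div_pos hy hx) ((div_lt_one hx).2 hxy)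
        · exact abs_dbl hx h2
      · exact half_dbl x
      · change half (2 * (y / x) - 1) * half (2 * x - 1) = y
        rw [half_dbl, half_dbl, div_mul_cancel₀ _ hx.ne']

lemma planeChar_inj {n : ℕ} (a : TCell n) : Set.InjOn (planeChar a) (Metric.ball 0 1) := by
  intro v hv w hw h
  rw [mem_ball_pi] at hv hw
  have hone : ∀ {v w : Fin 1 → ℝ}, half (v 0) = half (w 0) → v = w := fun {v w} e => by
    ext j
    rw [Subsingleton.elim j 0]
    exact half_inj e
  have htwo : ∀ {v w : Fin 2 → ℝ}, (∀ i, |w i| < 1) →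
      half (v 0) * half (v 1) = half (w 0) * half (w 1) → half (v 1) = half (w 1) →
        v = w := fun {v w} hw h e => by
    rw [e] at h
    have h0 := mul_right_cancel₀ (half_mem (hw 1)).1.ne' h
    ext j
    fin_cases j
    · exact half_inj h0
    · exact half_inj e
  cases a with
  | pt => exact Subsingleton.elim _ _
  | ver => exact hone (congrArg Prod.snd h)
  | hor => exact hone (congrArg Prod.fst h)
  | diag => exact hone (congrArg Prod.fst h)
  | up => exact htwo hw (congrArg Prod.fst h) (congrArg Prod.snd h)
  | low => exact htwo hw (congrArg Prod.snd h) (congrArg Prod.fst h)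

lemma continuous_planeChar {n : ℕ} (a : TCell n) : Continuous (planeChar a) := by
  have h : ∀ {m : ℕ} (i : Fin m), Continuous fun v : Fin m → ℝ => half (v i) :=
    fun i => continuous_half.comp (continuous_apply i)
  cases a with
  | pt => exact continuous_const
  | ver => exact continuous_const.prodMk (h 0)
  | hor => exact (h 0).prodMk continuous_const
  | diag => exact (h 0).prodMk (h 0)
  | up => exact ((h 0).mul (h 1)).prodMk (h 1)
  | low => exact (h 1).prodMk ((h 0).mul (h 1))

/-- The characteristic maps of the torus. -/
def torusChar (n : ℕ) (a : TCell n) (v : Fin n → ℝ) : Torus := torusMk (planeChar a v)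

lemma torusMk_inj {p q : ℝ × ℝ} (hp : p ∈ unitSquare) (hq : q ∈ unitSquare)
    (h : torusMk p = torusMk q) : p = q := by
  have h1 : (p.1 : UnitAddCircle) = q.1 := congrArg Prod.fst h
  have h2 : (p.2 : UnitAddCircle) = q.2 := congrArg Prod.snd h
  exact Prod.ext (coe_inj hp.1 hp.2.1 hq.1 hq.2.1 h1)
    (coe_inj hp.2.2.1 hp.2.2.2 hq.2.2.1 hq.2.2.2 h2)

lemma torusChar_image {n : ℕ} (a : TCell n) {p : ℝ × ℝ} (hp : p ∈ unitSquare) :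
    torusMk p ∈ torusChar n a '' Metric.ball 0 1 ↔ Region a p := by
  constructor
  · rintro ⟨v, hv, h⟩
    have := (planeChar_image a _).1 ⟨v, hv, rfl⟩
    rw [torusMk_inj this.1 hp h] at this
    exact this.2
  · intro h
    obtain ⟨v, hv, rfl⟩ := (planeChar_image a p).2 ⟨hp, h⟩
    exact ⟨v, hv, rfl⟩

lemma exists_torusMk (z : Torus) : ∃ p ∈ unitSquare, torusMk p = z := by
  obtain ⟨x, hx, hx', h1⟩ := exists_coe z.1
  obtain ⟨y, hy, hy', h2⟩ := exists_coe z.2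
  exact ⟨(x, y), ⟨hx, hx', hy, hy'⟩, Prod.ext h1 h2⟩

/-- A point on a side or on the diagonal of the square lies in a cell of dimension at most one. -/
lemma exists_edge {z : Torus} (hz : z ∈ torusOneSkeleton) :
    ∃ m < 2, ∃ a : TCell m, z ∈ torusChar m a '' Metric.ball 0 1 := by
  obtain ⟨p, hp, rfl⟩ := exists_torusMk z
  have key : p.1 = 0 ∨ p.2 = 0 ∨ p.1 = p.2 := by
    refine Or.imp (fun h => ?_) (Or.imp (fun h => ?_) fun h => ?_) hz
    · exact coe_inj hp.1 hp.2.1 le_rfl one_pos h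
    · exact coe_inj hp.2.2.1 hp.2.2.2 le_rfl one_pos h
    · exact coe_inj hp.1 hp.2.1 hp.2.2.1 hp.2.2.2 h
  obtain ⟨n, a, ha⟩ := exists_region hp
  refine ⟨n, ?_, a, (torusChar_image a hp).2 ha⟩
  cases a with
  | pt | ver | hor | diag => norm_num
  | up | low =>
    obtain ⟨h1, h2⟩ := ha
    rcases key with h | h | h <;> linarith

/-- The cell structure of the torus. -/
def torusDecomp : CellDecomp Torus where
  ι := TCell
  map := torusChar
  finite := by
    let f : Fin 6 → Σ n, TCell n :=
      ![⟨0, .pt⟩, ⟨1, .ver⟩, ⟨1, .hor⟩, ⟨1, .diag⟩, ⟨2, .up⟩, ⟨2, .low⟩]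
    refine Finite.of_surjective f ?_
    rintro ⟨n, a⟩
    cases a
    exacts [⟨0, rfl⟩, ⟨1, rfl⟩, ⟨2, rfl⟩, ⟨3, rfl⟩, ⟨4, rfl⟩, ⟨5, rfl⟩]
  cont n a := (continuous_torusMk.comp (continuous_planeChar a)).continuousOn
  inj n a v hv w hw h := planeChar_inj a hv hw (torusMk_inj
    ((planeChar_image a _).1 ⟨v, hv, rfl⟩).1 ((planeChar_image a _).1 ⟨w, hw, rfl⟩).1 h)
  unique a b v hv w hw h := by
    have h1 := (planeChar_image a.2 _).1 ⟨v, hv, rfl⟩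
    have h2 := (planeChar_image b.2 _).1 ⟨w, hw, rfl⟩
    rw [← torusMk_inj h1.1 h2.1 h] at h2
    exact region_unique h1.2 h2.2
  bdry n a v hv := by
    rw [mem_sphere_zero_iff_norm] at hv
    -- the norm on `Fin n → ℝ` is the maximum norm, so the ball is a cube
    have habs : ∃ i, |v i| = 1 := by
      by_contra hcon
      push Not at hcon
      have : ∀ i, |v i| < 1 := fun i => lt_of_le_of_ne (by
        have := norm_le_pi_norm v i
        rwa [hv, Real.norm_eq_abs] at this) (hcon i)
      have := (pi_norm_lt_iff (x := v) one_pos).2 this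
      linarith
    obtain ⟨i, hi⟩ := habs
    have hpt : ∀ z : Torus, z = 0 → z ∈ torusChar 0 .pt '' Metric.ball 0 1 := by
      rintro _ rfl
      exact ⟨0, Metric.mem_ball_self one_pos, rfl⟩
    cases a with
    | pt => exact i.elim0
    | ver =>
      refine ⟨0, by norm_num, .pt, hpt _ ?_⟩
      rw [Subsingleton.elim i 0] at hi
      rcases half_abs hi with h | h <;> simp [torusChar, planeChar, torusMk, h, coe_one]
    | hor =>
      refine ⟨0, by norm_num, .pt, hpt _ ?_⟩
      rw [Subsingleton.elim i 0] at hi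
      rcases half_abs hi with h | h <;> simp [torusChar, planeChar, torusMk, h, coe_one]
    | diag =>
      refine ⟨0, by norm_num, .pt, hpt _ ?_⟩
      rw [Subsingleton.elim i 0] at hi
      rcases half_abs hi with h | h <;> simp [torusChar, planeChar, torusMk, h, coe_one]
    | up =>
      apply exists_edge
      fin_cases i <;> rcases half_abs hi with h | h <;>
        simp_all [torusChar, planeChar, torusMk, torusOneSkeleton, coe_one]
    | low =>
      apply exists_edge
      fin_cases i <;> rcases half_abs hi with h | h <;>
        simp_all [torusChar, planeChar, torusMk, torusOneSkeleton, coe_one]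
  cover z := by
    obtain ⟨p, hp, rfl⟩ := exists_torusMk z
    obtain ⟨n, a, ha⟩ := exists_region hp
    exact ⟨n, a, (torusChar_image a hp).2 ha⟩

end FinCW

/-! ### The diagram of the torus, the circle, the pinched triangle and the sphere -/

namespace FinCW

variable {X Y : FinCW}

/-- The torus as a finite based CW complex. -/
def torus : FinCW :=
  torusDecomp.toFinCW (0 : Torus) ⟨.pt, by simp [torusDecomp, torusChar, planeChar, torusMk]⟩

/-- A cell of the torus, as a cell of the CW complex. -/
def tcell {n : ℕ} (a : TCell n) : torus.Cell := ⟨n, a⟩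

lemma mem_op_tcell {n : ℕ} (a : TCell n) {p : ℝ × ℝ} (hp : p ∈ unitSquare) :
    (torusMk p : torus) ∈ op (tcell a) ↔ Region a p := torusChar_image a hp

lemma exists_of_mem_op_tcell {n : ℕ} {a : TCell n} {z : torus} (hz : z ∈ op (tcell a)) :
    ∃ p ∈ unitSquare, Region a p ∧ torusMk p = z := by
  obtain ⟨p, hp, rfl⟩ := exists_torusMk z
  exact ⟨p, hp, (mem_op_tcell a hp).1 hz, rfl⟩

lemma mem_cl_tcell {n : ℕ} (a : TCell n) {v : Fin n → ℝ} (hv : ∀ i, |v i| ≤ 1) {z : torus}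
    (hz : torusMk (planeChar a v) = z) : z ∈ cl (tcell a) :=
  ⟨v, mem_closedBall_zero_iff.2 ((pi_norm_le_iff_of_nonneg zero_le_one).2 hv), hz⟩

open Classical in
lemma sum_torus {M : Type*} [AddCommMonoid M] (F : torus.Cell → M) :
    ∑ a : torus.Cell, F a = F (tcell .pt) + F (tcell .ver) + F (tcell .hor) + F (tcell .diag) +
      F (tcell .up) + F (tcell .low) := by
  let f : Fin 6 → torus.Cell :=
    ![tcell .pt, tcell .ver, tcell .hor, tcell .diag, tcell .up, tcell .low]
  have hf : Function.Bijective f := by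
    constructor
    · intro i j h
      fin_cases i <;> fin_cases j <;> first | rfl | (exfalso; revert h; intro h; cases h)
    · rintro ⟨n, a⟩
      change TCell n at a
      cases a
      exacts [⟨0, rfl⟩, ⟨1, rfl⟩, ⟨2, rfl⟩, ⟨3, rfl⟩, ⟨4, rfl⟩, ⟨5, rfl⟩]
  rw [← Fintype.sum_equiv (Equiv.ofBijective f hf) (fun i => F (f i)) F (fun _ => rfl),
    Fin.sum_univ_six]
  rfl

lemma numCells_torus_one : torus.numCells 1 = 3 := by
  rw [numCells, sum_torus]
  simp [tcell]

lemma numCells_torus_two : torus.numCells 2 = 2 := by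
  rw [numCells, sum_torus]
  simp [tcell]

/-- A cell of the torus of dimension one is one of the three edges. -/
lemma torus_edge {c : torus.Cell} (hc : c.1 = 1) :
    c = tcell .ver ∨ c = tcell .hor ∨ c = tcell .diag := by
  obtain ⟨n, a⟩ := c
  change TCell n at a
  cases a <;> first | (exfalso; revert hc; norm_num; done) | skip
  exacts [Or.inl rfl, Or.inr (Or.inl rfl), Or.inr (Or.inr rfl)]

lemma torus_triangle {c : torus.Cell} (hc : c.1 = 2) : c = tcell .up ∨ c = tcell .low := by
  obtain ⟨n, a⟩ := c
  change TCell n at a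
  cases a <;> first | (exfalso; revert hc; norm_num; done) | skip
  exacts [Or.inl rfl, Or.inr rfl]

lemma half_neg_one : half (-1) = 0 := by norm_num [half]
lemma half_one : half 1 = 1 := by norm_num [half]
lemma half_zero : half 0 = 1 / 2 := by norm_num [half]

lemma half_mem_unitSquare {a b : ℝ} (ha : a = 0 ∨ a = 1 / 2) (hb : b = 0 ∨ b = 1 / 2) :
    (a, b) ∈ unitSquare := by
  rcases ha with rfl | rfl <;> rcases hb with rfl | rfl <;> norm_num [unitSquare]

/-- The boundary of each of the two triangles consists of all three edges. -/
lemma bd_triangle {e : torus.Cell} (he : e.1 = 2) : bd e = {c | c.1 = 1} := by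
  -- the midpoints of the edges lie in the closures of both triangles
  have h01 : torusMk (0, 1 / 2) ∈ op (tcell .ver) :=
    (mem_op_tcell .ver (half_mem_unitSquare (Or.inl rfl) (Or.inr rfl))).2 ⟨rfl, by norm_num⟩
  have h10 : torusMk (1 / 2, 0) ∈ op (tcell .hor) :=
    (mem_op_tcell .hor (half_mem_unitSquare (Or.inr rfl) (Or.inl rfl))).2 ⟨by norm_num, rfl⟩
  have h11 : torusMk (1 / 2, 1 / 2) ∈ op (tcell .diag) :=
    (mem_op_tcell .diag (half_mem_unitSquare (Or.inr rfl) (Or.inr rfl))).2 ⟨by norm_num, rfl⟩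
  have hv : ∀ s t : ℝ, |s| ≤ 1 → |t| ≤ 1 → ∀ i, |(![s, t] : Fin 2 → ℝ) i| ≤ 1 := by
    intro s t hs ht i
    fin_cases i
    exacts [hs, ht]
  ext c
  refine ⟨fun h => h.1, fun h => ⟨h, ?_⟩⟩
  rcases torus_triangle he with rfl | rfl <;> rcases torus_edge h with rfl | rfl | rfl
  · refine ⟨_, mem_cl_tcell .up (hv (-1) 0 (by norm_num) (by norm_num)) ?_, h01⟩
    simp [planeChar, half_neg_one, half_zero, torusMk]
  · refine ⟨_, mem_cl_tcell .up (hv 0 1 (by norm_num) (by norm_num)) ?_, h10⟩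
    simp [planeChar, half_one, half_zero, torusMk, coe_one]
  · refine ⟨_, mem_cl_tcell .up (hv 1 0 (by norm_num) (by norm_num)) ?_, h11⟩
    simp [planeChar, half_one, half_zero, torusMk]
  · refine ⟨_, mem_cl_tcell .low (hv 0 1 (by norm_num) (by norm_num)) ?_, h01⟩
    simp [planeChar, half_one, half_zero, torusMk, coe_one]
  · refine ⟨_, mem_cl_tcell .low (hv (-1) 0 (by norm_num) (by norm_num)) ?_, h10⟩
    simp [planeChar, half_neg_one, half_zero, torusMk]
  · refine ⟨_, mem_cl_tcell .low (hv 1 0 (by norm_num) (by norm_num)) ?_, h11⟩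
    simp [planeChar, half_one, half_zero, torusMk]

/-- The two triangles of the torus have the same boundary, so they cancel. -/
lemma evenBdry_torus : EvenBdry torus := by
  intro w _
  rw [sum_torus, bd_triangle (e := tcell .up) rfl, bd_triangle (e := tcell .low) rfl]
  simp [tcell, CharTwo.add_self_eq_zero]

lemma ncard_edges : ({c : torus.Cell | c.1 = 1}).ncard = 3 := by
  classical
  rw [← numCells_torus_one, numCells, Finset.sum_boole, Set.ncard_eq_toFinset_card']
  simp

/-- No complex with even boundaries is a subcomplex of the torus whose complement is a single
2-cell. Such a complex would have a single 2-cell, whose boundary has three elements. -/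
lemma not_isCokernelOf_of_evenBdry {A T R : FinCW} (hA : EvenBdry A) (eT : torus ≅ T)
    (hR2 : R.numCells 2 = 1) {f : A ⟶ T} (hf : cof f) {p : T ⟶ R} :
    ¬ IsCokernelOf f p := by
  rintro ⟨Z, t, s, hZ, H⟩
  have hnZ : ∀ n, n ≠ 0 → Z.numCells n = 0 := fun n hn => by
    rw [numCells_of_iso (isZero_point.iso hZ), numCells_point n hn]
  have h2 := numCells_of_isPushout hf H 2
  rw [hR2, hnZ 2 two_ne_zero, numCells_of_iso eT, numCells_torus_two] at h2
  replace h2 : A.numCells 2 = 1 := by omega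
  -- the boundary of a 2-cell of `A` maps onto that of a triangle
  have hbd : ∀ e : A.Cell, e.1 = 2 → 3 ≤ (bd e).ncard := by
    intro e he
    let f' : A ⟶ torus := f ≫ eT.inv
    have hf' : cof f' := cof_comp hf (cof_of_iso eT.symm)
    have h := bd_image (cellPres_of_cof hf') (image_op hf' e)
    rw [bd_triangle ((cofCell_dim hf' e).trans he)] at h
    rw [← ncard_edges, h]
    exact ncard_push_le _ _
  have := hA (fun B => if B.ncard < 3 then 0 else 1) (fun B hB => if_pos hB)
  have h3 : ∑ e : A.Cell,
      (if e.1 = 2 then (if (bd e).ncard < 3 then (0 : ZMod 2) else 1) else 0) =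
        ((A.numCells 2 : ℕ) : ZMod 2) := by
    rw [numCells, Nat.cast_sum]
    refine Finset.sum_congr rfl fun e _ => ?_
    split_ifs with he hlt
    · exact absurd (hbd e he) (by omega)
    · simp
    · simp
  rw [h3, h2] at this
  exact absurd this (by decide)

lemma isSub_circle : torus.IsSub {p : Torus | p.1 = 0} where
  isClosed := isClosed_eq continuous_fst continuous_const
  base_mem := rfl
  op_subset := by
    have key : ∀ {n : ℕ} (a : TCell n) (p : ℝ × ℝ), p ∈ unitSquare → Region a p →
        (torusMk p).1 = 0 → ∀ q : ℝ × ℝ, q ∈ unitSquare → Region a q → q.1 = 0 := by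
      intro n a p hp hpa h q hq hqa
      have hp0 : p.1 = 0 := coe_inj hp.1 hp.2.1 le_rfl one_pos h
      cases a <;> obtain ⟨h1, h2⟩ := hpa <;> obtain ⟨h3, h4⟩ := hqa <;> linarith
    rintro ⟨n, a⟩ x hx hxE y hy
    obtain ⟨p, hp, hpa, rfl⟩ := exists_of_mem_op_tcell (a := a) hx
    obtain ⟨q, hq, hqa, rfl⟩ := exists_of_mem_op_tcell (a := a) hy
    change ((q.1 : ℝ) : UnitAddCircle) = 0
    rw [key a p hp hpa hxE q hq hqa]
    rfl

lemma mem_torusTriangle {p : ℝ × ℝ} (hp : p ∈ unitSquare) :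
    torusMk p ∈ torusTriangle ↔ p.1 ≤ p.2 ∨ p.2 = 0 := by
  obtain ⟨x, y⟩ := p
  obtain ⟨h1, h2, h3, h4⟩ := hp
  constructor
  · rintro ⟨x', y', hx', hxy, hy', h⟩
    have e1 : (x : UnitAddCircle) = x' := congrArg Prod.fst h
    have e2 : (y : UnitAddCircle) = y' := congrArg Prod.snd h
    rcases hy'.eq_or_lt with rfl | hy1
    · right
      exact coe_inj h3 h4 le_rfl one_pos (e2.trans coe_one)
    · left
      rw [coe_inj h1 h2 hx' (hxy.trans_lt hy1) e1, coe_inj h3 h4 (hx'.trans hxy) hy1 e2]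
      exact hxy
  · rintro (h | h)
    · exact ⟨x, y, h1, h, h4.le, rfl⟩
    · have hy : y = 0 := h
      refine ⟨x, 1, h1, h2.le, le_rfl, ?_⟩
      rw [torusMk, hy, coe_one]
      rfl

lemma isSub_triangle : torus.IsSub torusTriangle where
  isClosed := by
    have hK : IsCompact {p : ℝ × ℝ | 0 ≤ p.1 ∧ p.1 ≤ p.2 ∧ p.2 ≤ 1} := by
      refine (isCompact_Icc.prod isCompact_Icc : IsCompact (Set.Icc (0 : ℝ) 1 ×ˢ Set.Icc (0 : ℝ) 1))
        |>.of_isClosed_subset ?_ ?_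
      · exact (isClosed_le continuous_const continuous_fst).inter
          ((isClosed_le continuous_fst continuous_snd).inter
            (isClosed_le continuous_snd continuous_const))
      · rintro p ⟨h1, h2, h3⟩
        exact ⟨⟨h1, h2.trans h3⟩, ⟨h1.trans h2, h3⟩⟩
    have : torusTriangle = torusMk '' {p : ℝ × ℝ | 0 ≤ p.1 ∧ p.1 ≤ p.2 ∧ p.2 ≤ 1} := by
      ext z
      constructor
      · rintro ⟨x, y, h1, h2, h3, rfl⟩
        exact ⟨(x, y), ⟨h1, h2, h3⟩, rfl⟩
      · rintro ⟨p, ⟨h1, h2, h3⟩, rfl⟩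
        exact ⟨p.1, p.2, h1, h2, h3, rfl⟩
    rw [this]
    exact (hK.image continuous_torusMk).isClosed
  base_mem := ⟨0, 0, le_rfl, le_rfl, zero_le_one, rfl⟩
  op_subset := by
    have key : ∀ {n : ℕ} (a : TCell n) (p : ℝ × ℝ), Region a p →
        p.1 ≤ p.2 ∨ p.2 = 0 → ∀ q : ℝ × ℝ, Region a q → q.1 ≤ q.2 ∨ q.2 = 0 := by
      intro n a p hpa h q hqa
      cases a with
      | low =>
        obtain ⟨h1, h2⟩ := hpa
        rcases h with h | h <;> linarith
      | pt => exact Or.inr hqa.2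
      | ver => exact Or.inl (hqa.1.trans_le hqa.2.le)
      | hor => exact Or.inr hqa.2
      | diag => exact Or.inl hqa.2.le
      | up => exact Or.inl hqa.2.le
    rintro ⟨n, a⟩ x hx hxE y hy
    obtain ⟨p, hp, hpa, rfl⟩ := exists_of_mem_op_tcell (a := a) hx
    obtain ⟨q, hq, hqa, rfl⟩ := exists_of_mem_op_tcell (a := a) hy
    exact (mem_torusTriangle hq).2 (key a p hpa ((mem_torusTriangle hp).1 hxE) q hqa)

end FinCW

namespace FinCW

variable {X Y : FinCW}

lemma op_tcell_subset_iff {E : Set torus} (hE : torus.IsSub E) {n : ℕ} (a : TCell n) (p : ℝ × ℝ)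
    (hp : p ∈ unitSquare) (hr : Region a p) : op (tcell a) ⊆ E ↔ (torusMk p : torus) ∈ E :=
  ⟨fun h => h ((mem_op_tcell a hp).2 hr), fun h => hE.op_subset _ _ ((mem_op_tcell a hp).2 hr) h⟩

/-- The circle: the image of the vertical sides of the square. -/
def circle : FinCW := sub isSub_circle

/-- The subcomplex of the torus given by the closed triangle above the diagonal. -/
def triangle : FinCW := sub isSub_triangle

lemma circle_subset_triangle (x : circle) : toFun (subIncl isSub_circle) x ∈ torusTriangle := by
  obtain ⟨⟨x1, x2⟩, hx⟩ := x
  obtain ⟨y, hy, hy', rfl⟩ := exists_coe x2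
  exact ⟨0, y, le_rfl, hy, hy'.le, Prod.ext hx rfl⟩

/-- The inclusion of the circle into the closed triangle. -/
def circleToTriangle : circle ⟶ triangle :=
  subLift isSub_triangle (subIncl isSub_circle) circle_subset_triangle

lemma cof_circleToTriangle : cof circleToTriangle :=
  cof_subLift _ _ _ (cof_subIncl isSub_circle)

/-- The inclusion of the closed triangle into the torus. -/
def triangleToTorus : triangle ⟶ torus := subIncl isSub_triangle

lemma cof_triangleToTorus : cof triangleToTorus := cof_subIncl isSub_triangle

/-- The closed triangle with its vertical side collapsed. -/
def pinchedTriangle : FinCW := po (toPoint circle) cof_circleToTriangle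

/-- The map collapsing the vertical side of the closed triangle. -/
def pinch : triangle ⟶ pinchedTriangle := poInl (toPoint circle) cof_circleToTriangle

/-- The torus with a circle collapsed, constructed by gluing the pinched triangle to the torus.
By pasting of pushouts it is the cokernel of the inclusion of the circle, and in this form the
pinched triangle is a subcomplex by construction. -/
def pinchedTorus : FinCW := po pinch cof_triangleToTorus

/-- The inclusion of the circle into the torus. -/
def mapI : circle ⟶ torus := subIncl isSub_circle

/-- The map collapsing the circle in the torus. -/
def mapQ : torus ⟶ pinchedTorus := poInl pinch cof_triangleToTorus

/-- The inclusion of the pinched triangle into the pinched torus. -/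
def mapJ : pinchedTriangle ⟶ pinchedTorus := poInr pinch cof_triangleToTorus

lemma cof_mapJ : cof mapJ := cof_poInr _

/-- The sphere: the pinched torus with the pinched triangle collapsed. -/
def sphere : FinCW := po (toPoint pinchedTriangle) cof_mapJ

/-- The map collapsing the pinched triangle. -/
def mapR : pinchedTorus ⟶ sphere := poInl (toPoint pinchedTriangle) cof_mapJ

lemma isPushout_pinch :
    IsPushout circleToTriangle (toPoint circle) pinch
      (poInr (toPoint circle) cof_circleToTriangle) :=
  isPushout_po _ _

lemma isPushout_torus : IsPushout triangleToTorus pinch mapQ mapJ := isPushout_po _ _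

lemma isPushout_sphere : IsPushout mapJ (toPoint pinchedTriangle) mapR
    (poInr (toPoint pinchedTriangle) cof_mapJ) := isPushout_po _ _

lemma pinch_surjective : Function.Surjective (toFun pinch) := fun z => by
  rcases exists_of_isPushout cof_circleToTriangle isPushout_pinch z with ⟨x, rfl⟩ | h
  · refine ⟨triangle.base, ?_⟩
    rw [Subsingleton.elim x point.base, toFun_base]
    exact (toFun_base _).symm
  · exact h

lemma mem_skel_torus {z : torus} {m : ℕ} :
    z ∈ torus.skel m ↔ ∃ (n : ℕ) (a : TCell n), n ≤ m ∧ z ∈ op (tcell a) := by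
  rw [mem_skel]
  exact ⟨fun ⟨⟨n, a⟩, h, hz⟩ => ⟨n, a, h, hz⟩, fun ⟨n, a, h, hz⟩ => ⟨tcell a, h, hz⟩⟩

lemma isTorusDiagram : IsTorusDiagram mapI mapQ mapJ mapR where
  cof_i := cof_subIncl _
  coker_q := ⟨point, _, _, isZero_point, isPushout_pinch.paste_horiz isPushout_torus⟩
  cof_j := cof_mapJ
  coker_r := isCokernelOf_po cof_mapJ
  torus := by
    refine ⟨Homeomorph.refl Torus, ?_, ?_, ?_, ?_, ?_⟩
    · refine (Set.image_id _).trans ?_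
      ext z
      refine mem_skel_torus.trans ⟨?_, ?_⟩
      · rintro ⟨n, a, hn, hz⟩
        obtain ⟨p, hp, hpa, rfl⟩ := exists_of_mem_op_tcell hz
        cases a <;> first | (exfalso; revert hn; norm_num; done) | skip
        exact Prod.ext (by rw [torusMk, hpa.1]; rfl) (by rw [torusMk, hpa.2]; rfl)
      · intro hz
        have hz0 : z = (0 : Torus) := hz
        exact ⟨0, .pt, le_rfl, hz0 ▸ ⟨0, Metric.mem_ball_self one_pos, rfl⟩⟩
    · refine (Set.image_id _).trans ?_
      ext z
      refine mem_skel_torus.trans ⟨?_, ?_⟩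
      · rintro ⟨n, a, hn, hz⟩
        obtain ⟨p, hp, hpa, rfl⟩ := exists_of_mem_op_tcell hz
        cases a with
        | pt | ver => exact Or.inl (by rw [torusMk, hpa.1]; rfl)
        | hor => exact Or.inr (Or.inl (by rw [torusMk, hpa.2]; rfl))
        | diag => exact Or.inr (Or.inr (by rw [torusMk, hpa.2]))
        | up | low => norm_num at hn
      · intro hz
        obtain ⟨m, hm, a, ha⟩ := exists_edge hz
        exact ⟨m, a, by omega, ha⟩
    · refine Set.eq_univ_of_forall fun z => mem_skel_torus.2 ?_
      obtain ⟨⟨n, a⟩, hz⟩ := exists_mem_op z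
      change TCell n at a
      exact ⟨n, a, by cases a <;> norm_num, hz⟩
    · exact (Set.image_id _).trans (range_subIncl isSub_circle)
    · have h1 : Set.range (toFun mapJ) = Set.range (toFun (pinch ≫ mapJ)) :=
        (pinch_surjective.range_comp _).symm
      rw [h1, ← isPushout_torus.w]
      have h2 : Set.range (toFun (triangleToTorus ≫ mapQ)) =
          toFun mapQ '' Set.range (toFun triangleToTorus) :=
        Set.range_comp (toFun mapQ) (toFun triangleToTorus)
      rw [h2]
      exact congrArg _ (range_subIncl isSub_triangle)

lemma subset_circle_iff {n : ℕ} (a : TCell n) (p : ℝ × ℝ) (hp : p ∈ unitSquare)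
    (hr : Region a p) : op (tcell a) ⊆ {p : Torus | p.1 = 0} ↔ p.1 = 0 := by
  rw [op_tcell_subset_iff isSub_circle a p hp hr]
  exact ⟨fun h => coe_inj hp.1 hp.2.1 le_rfl one_pos h, fun h => by
    change ((p.1 : ℝ) : UnitAddCircle) = 0
    rw [h]
    rfl⟩

lemma subset_triangle_iff {n : ℕ} (a : TCell n) (p : ℝ × ℝ) (hp : p ∈ unitSquare)
    (hr : Region a p) : op (tcell a) ⊆ torusTriangle ↔ p.1 ≤ p.2 ∨ p.2 = 0 := by
  rw [op_tcell_subset_iff isSub_triangle a p hp hr]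
  exact mem_torusTriangle hp

lemma numCells_circle : circle.numCells 1 = 1 ∧ circle.numCells 2 = 0 := by
  have h0 := subset_circle_iff .pt (0, 0) (by norm_num [unitSquare]) (by norm_num [Region])
  have h1 := subset_circle_iff .ver (0, 1 / 2) (by norm_num [unitSquare]) (by norm_num [Region])
  have h2 := subset_circle_iff .hor (1 / 2, 0) (by norm_num [unitSquare]) (by norm_num [Region])
  have h3 := subset_circle_iff .diag (1 / 2, 1 / 2) (by norm_num [unitSquare])
    (by norm_num [Region])
  have h4 := subset_circle_iff .up (1 / 4, 1 / 2) (by norm_num [unitSquare]) (by norm_num [Region])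
  have h5 := subset_circle_iff .low (1 / 2, 1 / 4) (by norm_num [unitSquare])
    (by norm_num [Region])
  norm_num at h0 h1 h2 h3 h4 h5
  constructor
  · refine (numCells_sub isSub_circle 1).trans ((sum_torus _).trans ?_)
    rw [if_pos h0, if_pos h1, if_neg h2, if_neg h3, if_neg h4, if_neg h5]
    simp [tcell]
  · refine (numCells_sub isSub_circle 2).trans ((sum_torus _).trans ?_)
    rw [if_pos h0, if_pos h1, if_neg h2, if_neg h3, if_neg h4, if_neg h5]
    simp [tcell]

lemma numCells_triangle : triangle.numCells 1 = 3 ∧ triangle.numCells 2 = 1 := by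
  have h0 := subset_triangle_iff .pt (0, 0) (by norm_num [unitSquare]) (by norm_num [Region])
  have h1 := subset_triangle_iff .ver (0, 1 / 2) (by norm_num [unitSquare]) (by norm_num [Region])
  have h2 := subset_triangle_iff .hor (1 / 2, 0) (by norm_num [unitSquare]) (by norm_num [Region])
  have h3 := subset_triangle_iff .diag (1 / 2, 1 / 2) (by norm_num [unitSquare])
    (by norm_num [Region])
  have h4 := subset_triangle_iff .up (1 / 4, 1 / 2) (by norm_num [unitSquare])
    (by norm_num [Region])
  have h5 := subset_triangle_iff .low (1 / 2, 1 / 4) (by norm_num [unitSquare])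
    (by norm_num [Region])
  norm_num at h0 h1 h2 h3 h4 h5
  constructor
  · refine (numCells_sub isSub_triangle 1).trans ((sum_torus _).trans ?_)
    rw [if_pos h0, if_pos h1, if_pos h2, if_pos h3, if_pos h4, if_neg h5]
    simp [tcell]
  · refine (numCells_sub isSub_triangle 2).trans ((sum_torus _).trans ?_)
    rw [if_pos h0, if_pos h1, if_pos h2, if_pos h3, if_pos h4, if_neg h5]
    simp [tcell]

lemma numCells_pinchedTriangle :
    pinchedTriangle.numCells 1 = 2 ∧ pinchedTriangle.numCells 2 = 1 := by
  have h1 := numCells_of_isPushout cof_circleToTriangle isPushout_pinch 1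
  have h2 := numCells_of_isPushout cof_circleToTriangle isPushout_pinch 2
  rw [numCells_circle.1, numCells_triangle.1, numCells_point 1 one_ne_zero] at h1
  rw [numCells_circle.2, numCells_triangle.2, numCells_point 2 two_ne_zero] at h2
  omega

lemma numCells_sphere : sphere.numCells 2 = 1 := by
  have h1 := numCells_of_isPushout cof_triangleToTorus isPushout_torus 2
  have h2 := numCells_of_isPushout cof_mapJ isPushout_sphere 2
  rw [numCells_triangle.2, numCells_pinchedTriangle.2, numCells_torus_two] at h1
  rw [numCells_pinchedTriangle.2, numCells_point 2 two_ne_zero] at h2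
  omega

lemma evenBdry_circle : EvenBdry circle := evenBdry_of_numCells (by
  rw [numCells_circle.1]; norm_num)

lemma evenBdry_pinchedTriangle : EvenBdry pinchedTriangle := evenBdry_of_numCells (by
  rw [numCells_pinchedTriangle.1]; norm_num)

lemma isCokernelOf_mapQ : IsCokernelOf mapI mapQ := isTorusDiagram.coker_q

/-- The four morphisms of the diagram belong to the subcategory of complexes with even
boundaries. -/
lemma arrows_le : Arrows mapI mapQ mapJ mapR ≤ evenSubcat.hom := by
  have hI : cof mapI := isTorusDiagram.cof_i
  obtain ⟨Z, t, s, hZ, H⟩ := isCokernelOf_mapQ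
  have ht : CellPres t := by
    have : t = toPoint _ ≫ (isZero_point.iso hZ).hom := hZ.eq_of_tgt _ _
    rw [this]
    exact (cellPres_toPoint _).comp (cellPres_of_cof (cof_of_iso _))
  have hQ : EvenBdry pinchedTorus := evenBdry_of_isPushout hI ht evenBdry_circle evenBdry_torus
    (evenBdry_point.of_iso (isZero_point.iso hZ)) H
  have hR : EvenBdry sphere := evenBdry_of_isPushout cof_mapJ (cellPres_toPoint _)
    evenBdry_pinchedTriangle hQ evenBdry_point isPushout_sphere
  intro X Y f hf
  cases hf with
  | i => exact ⟨cellPres_of_cof hI, evenBdry_circle, evenBdry_torus⟩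
  | q => exact ⟨cellPres_of_isPushout hI ht H, evenBdry_torus, hQ⟩
  | j => exact ⟨cellPres_of_cof cof_mapJ, evenBdry_pinchedTriangle, hQ⟩
  | r => exact ⟨cellPres_of_isPushout cof_mapJ (cellPres_toPoint _) isPushout_sphere, hQ, hR⟩

end FinCW

/-! ### Partial simplices of the `S_•`-construction -/

section Partial

variable {C : Type u} [Category.{v} C]

/-- Two cofibration sequences `S ↣ T ↠ Q` and `H ↣ Q ↠ R`, with a fixed zero object `Z`. -/
structure SeqPair (cof : MorphismProperty C) where
  {Z S T Q H R : C}
  hZ : IsZero Z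
  i : S ⟶ T
  q : T ⟶ Q
  j : H ⟶ Q
  r : Q ⟶ R
  cof_i : cof i
  cof_j : cof j
  push_i : IsPushout i (hZ.from_ S) q (hZ.to_ Q)
  push_j : IsPushout j (hZ.from_ H) r (hZ.to_ R)

namespace SeqPair

variable {cof : MorphismProperty C} (D : SeqPair cof)

/-- The row `Z S S T` of the grid; the second `S` is a placeholder. -/
def row0 : ComposableArrows C 3 := .mk₃ (D.hZ.to_ D.S) (𝟙 D.S) D.i

/-- The row `Z Z H Q` of the grid. -/
def row1 : ComposableArrows C 3 := .mk₃ (𝟙 D.Z) (D.hZ.to_ D.H) D.j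

/-- The row `Z Z Z R` of the grid. -/
def row2 : ComposableArrows C 3 := .mk₃ (𝟙 D.Z) (𝟙 D.Z) (D.hZ.to_ D.R)

/-- The row `Z Z Z Z` of the grid. -/
def row3 : ComposableArrows C 3 := .mk₃ (𝟙 D.Z) (𝟙 D.Z) (𝟙 D.Z)

/-- The vertical maps from the first to the second row. -/
def row01 : D.row0 ⟶ D.row1 :=
  ComposableArrows.homMk₃ (𝟙 D.Z) (D.hZ.from_ D.S) (D.hZ.from_ D.S ≫ D.hZ.to_ D.H) D.q
    (D.hZ.eq_of_src _ _) (Category.id_comp _)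
    (D.push_i.w.trans (by
      change _ = (D.hZ.from_ D.S ≫ D.hZ.to_ D.H) ≫ D.j
      rw [Category.assoc, D.hZ.eq_of_src (D.hZ.to_ D.H ≫ D.j) (D.hZ.to_ D.Q)]))

/-- The vertical maps from the second to the third row. -/
def row12 : D.row1 ⟶ D.row2 :=
  ComposableArrows.homMk₃ (𝟙 D.Z) (𝟙 D.Z) (D.hZ.from_ D.H) D.r
    rfl (D.hZ.eq_of_src _ _) D.push_j.w

/-- The vertical maps from the third to the fourth row. -/
def row23 : D.row2 ⟶ D.row3 :=
  ComposableArrows.homMk₃ (𝟙 D.Z) (𝟙 D.Z) (𝟙 D.Z) (D.hZ.from_ D.R)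
    rfl rfl (D.hZ.eq_of_src _ _)

/-- The grid as a functor on `[3] × [3]`, in curried form. -/
def grid : Fin 4 ⥤ Fin 4 ⥤ C :=
  ComposableArrows.mk₃ D.row01 D.row12 D.row23

/-- The part of the grid above the diagonal. It restricts to the two given cofibration sequences
on the faces `{0,1,3}` and `{1,2,3}`; the object at `(0,2)` is a placeholder. -/
def diagram : Ar (SimplexCategory.mk 3) ⥤ C :=
  Functor.prod'
    (Monotone.functor (X := Ar (SimplexCategory.mk 3)) (Y := Fin 4) (f := fun p => p.1.1)
      fun _ _ h => h.1)
    (Monotone.functor (X := Ar (SimplexCategory.mk 3)) (Y := Fin 4) (f := fun p => p.1.2)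
      fun _ _ h => h.2) ⋙
  Functor.uncurry.obj D.grid

lemma isZero_diagram (x : Fin 4) : IsZero (D.diagram.obj ⟨(x, x), le_rfl⟩) := by
  fin_cases x <;> exact D.hZ

/-- The morphism of the diagram from the entry `(a, b)` to the entry `(a', b')`. -/
def dmap (a b a' b' : Fin 4) (h : a ≤ b) (h' : a' ≤ b') (ha : a ≤ a') (hb : b ≤ b') :
    D.diagram.obj ⟨(a, b), h⟩ ⟶ D.diagram.obj ⟨(a', b'), h'⟩ :=
  D.diagram.map (arHom (n := SimplexCategory.mk 3) h h' ha hb)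

lemma dmap_i : D.dmap 0 1 0 3 (by decide) (by decide) (by decide) (by decide) = D.i :=
  (Category.id_comp _).trans (Category.id_comp _)

lemma dmap_q : D.dmap 0 3 1 3 (by decide) (by decide) (by decide) (by decide) = D.q :=
  Category.comp_id _

lemma dmap_j : D.dmap 1 2 1 3 (by decide) (by decide) (by decide) (by decide) = D.j :=
  Category.id_comp _

lemma dmap_r : D.dmap 1 3 2 3 (by decide) (by decide) (by decide) (by decide) = D.r :=
  Category.comp_id _

/-- The cofibration sequences of the diagram on triples which do not involve the placeholder. -/
lemma diagram_good_strict (x y z : Fin 4) (hxy : x < y) (hyz : y < z)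
    (h : ¬ (x = 0 ∧ (y = 2 ∨ z = 2))) :
    cof (D.dmap x y x z hxy.le (hxy.trans hyz).le le_rfl hyz.le) ∧
    IsPushout (D.dmap x y x z hxy.le (hxy.trans hyz).le le_rfl hyz.le)
      (D.dmap x y y y hxy.le le_rfl hxy.le le_rfl)
      (D.dmap x z y z (hxy.trans hyz).le hyz.le hxy.le le_rfl)
      (D.dmap y y y z le_rfl hyz.le le_rfl hyz.le) := by
  have key : (x = 0 ∧ y = 1 ∧ z = 3) ∨ (x = 1 ∧ y = 2 ∧ z = 3) := by
    revert x y z; decide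
  rcases key with ⟨rfl, rfl, rfl⟩ | ⟨rfl, rfl, rfl⟩
  · refine ⟨D.dmap_i ▸ D.cof_i, ?_⟩
    have e := D.push_i
    rw [← D.dmap_i, ← D.dmap_q] at e
    rw [D.hZ.eq_of_tgt (D.dmap 0 1 1 1 _ _ _ _) (D.hZ.from_ D.S),
      D.hZ.eq_of_src (D.dmap 1 1 1 3 _ _ _ _) (D.hZ.to_ D.Q)]
    exact e
  · refine ⟨D.dmap_j ▸ D.cof_j, ?_⟩
    have e := D.push_j
    rw [← D.dmap_j, ← D.dmap_r] at e
    rw [D.hZ.eq_of_tgt (D.dmap 1 2 2 2 _ _ _ _) (D.hZ.from_ D.H),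
      D.hZ.eq_of_src (D.dmap 2 2 2 3 _ _ _ _) (D.hZ.to_ D.R)]
    exact e

/-- As `diagram_good_strict`, with degenerate triples allowed; these are needed for the pullbacks of
the diagram along maps `[m] → [3]` which are not injective. -/
lemma diagram_good [IsCatWithCof cof] {x y z : Fin 4} (hxy : x ≤ y) (hyz : y ≤ z)
    (h : ¬ (x = 0 ∧ (y = 2 ∨ z = 2))) :
    cof (D.dmap x y x z hxy (hxy.trans hyz) le_rfl hyz) ∧
    IsPushout (D.dmap x y x z hxy (hxy.trans hyz) le_rfl hyz)
      (D.dmap x y y y hxy le_rfl hxy le_rfl)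
      (D.dmap x z y z (hxy.trans hyz) hyz hxy le_rfl)
      (D.dmap y y y z le_rfl hyz le_rfl hyz) := by
  have sq : CommSq (D.dmap x y x z hxy (hxy.trans hyz) le_rfl hyz)
      (D.dmap x y y y hxy le_rfl hxy le_rfl)
      (D.dmap x z y z (hxy.trans hyz) hyz hxy le_rfl)
      (D.dmap y y y z le_rfl hyz le_rfl hyz) :=
    ⟨by simp only [dmap]; rw [← D.diagram.map_comp, ← D.diagram.map_comp]; rfl⟩
  rcases hxy.eq_or_lt with rfl | hxy'
  · refine ⟨IsCatWithCof.of_isZero _ (D.isZero_diagram x), ?_⟩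
    have := isIso_of_le (n := SimplexCategory.mk 3) (arHom (a := x) hxy le_rfl hxy le_rfl)
      ⟨le_rfl, le_rfl⟩
    have := isIso_of_le (n := SimplexCategory.mk 3) (arHom (hxy.trans hyz) hyz hxy le_rfl)
      ⟨le_rfl, le_rfl⟩
    have : IsIso (D.dmap x x x x hxy le_rfl hxy le_rfl) := by unfold dmap; infer_instance
    have : IsIso (D.dmap x z x z (hxy.trans hyz) hyz hxy le_rfl) := by
      unfold dmap; infer_instance
    exact IsPushout.of_vert_isIso sq
  · rcases hyz.eq_or_lt with rfl | hyz'
    · have := isIso_of_le (n := SimplexCategory.mk 3) (arHom hxy (hxy.trans hyz) le_rfl hyz)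
        ⟨le_rfl, le_rfl⟩
      have := isIso_of_le (n := SimplexCategory.mk 3) (arHom (le_refl y) hyz le_rfl hyz)
        ⟨le_rfl, le_rfl⟩
      have : IsIso (D.dmap x y x y hxy (hxy.trans hyz) le_rfl hyz) := by
        unfold dmap; infer_instance
      have : IsIso (D.dmap y y y y le_rfl hyz le_rfl hyz) := by unfold dmap; infer_instance
      exact ⟨IsCatWithCof.of_isIso _ inferInstance, IsPushout.of_horiz_isIso sq⟩
    · exact D.diagram_good_strict x y z hxy' hyz' h

/-- A simplex of `Δ³` is admissible if it does not have both `0` and `2` as vertices. -/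
def _root_.TwoSegal.Admissible {m : SimplexCategory} (β : m ⟶ SimplexCategory.mk 3) : Prop :=
  ∀ x y, β.toOrderHom x = (0 : Fin 4) → β.toOrderHom y = (2 : Fin 4) → False

lemma _root_.TwoSegal.Admissible.comp {k m : SimplexCategory} {β : m ⟶ SimplexCategory.mk 3}
    (h : Admissible β) (γ : k ⟶ m) : Admissible (γ ≫ β) :=
  fun x y hx hy => h (γ.toOrderHom x) (γ.toOrderHom y) hx hy

variable [IsCatWithCof cof]

lemma isSObj_partial {m : SimplexCategory} {β : m ⟶ SimplexCategory.mk 3} (h : Admissible β) :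
    IsSObj cof m (arMap β ⋙ D.diagram) :=
  ⟨fun a => D.isZero_diagram (β.toOrderHom a), fun a b c hab hbc =>
    D.diagram_good (β.toOrderHom.monotone hab.le) (β.toOrderHom.monotone hbc.le)
      (fun e => e.2.elim (h a b e.1) (h a c e.1))⟩

/-- The simplices of `S_•` obtained by restricting the diagram along admissible simplices
of `Δ³`. -/
def partObj {m : SimplexCategory} (β : m ⟶ SimplexCategory.mk 3) (h : Admissible β) :
    SCat cof m :=
  ⟨arMap β ⋙ D.diagram, D.isSObj_partial h⟩

lemma partObj_congr {m : SimplexCategory} {β β' : m ⟶ SimplexCategory.mk 3}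
    (e : β = β') (h : Admissible β) (h' : Admissible β') : D.partObj β h = D.partObj β' h' := by
  subst e; rfl

/-- The entry at `(a, b)` of an object of `S_n`. -/
def _root_.TwoSegal.entry {n : ℕ} (X : SCat cof (SimplexCategory.mk n)) {a b : Fin (n + 1)}
    (h : a ≤ b) : C := X.obj.obj ⟨(a, b), h⟩

/-- If the restriction of `X` to the face on `I` is the restriction of the diagram along `φ`,
then so are the entries of `X` at the vertices in `I`. -/
lemma entry_iso {n : ℕ} (X : SCat cof (SimplexCategory.mk n))
    (φ : SimplexCategory.mk n ⟶ SimplexCategory.mk 3) {I : Finset (Fin (n + 1))}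
    (hI : I.Nonempty) (h : Admissible (faceIncl I hI ≫ φ))
    (e : (SMap cof (faceIncl I hI)).obj X ≅ D.partObj (faceIncl I hI ≫ φ) h)
    {a b : Fin (n + 1)} (hab : a ≤ b) (ha : a ∈ I) (hb : b ∈ I) :
    Nonempty (entry X hab ≅
      D.diagram.obj ⟨(φ.toOrderHom a, φ.toOrderHom b), φ.toOrderHom.monotone hab⟩) := by
  obtain ⟨x, rfl⟩ : ∃ x, (faceIncl I hI).toOrderHom x = a := by
    have : a ∈ Set.range (I.orderEmbOfFin (card_eq hI)) := by
      rw [Finset.range_orderEmbOfFin]; exact ha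
    exact this
  obtain ⟨y, rfl⟩ : ∃ x, (faceIncl I hI).toOrderHom x = b := by
    have : b ∈ Set.range (I.orderEmbOfFin (card_eq hI)) := by
      rw [Finset.range_orderEmbOfFin]; exact hb
    exact this
  have hxy : x ≤ y := (I.orderEmbOfFin (card_eq hI)).le_iff_le.1 hab
  exact ⟨((IsSObj cof _).ι.mapIso e).app ⟨(x, y), hxy⟩⟩

/-- No cofibration sequence has middle term `T` and quotient `R`. -/
def Obstructed : Prop :=
  ∀ (A T' R' : C) (f : A ⟶ T') (p : T' ⟶ R'), cof f → IsCokernelOf f p →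
    Nonempty (T' ≅ D.T) → Nonempty (R' ≅ D.R) → False

/-- An `n`-simplex of `S_•` cannot restrict to the diagram both on a face containing vertices
over `0` and `3` and on a face containing vertices over `2` and `3`. -/
lemma Obstructed.not_extend (hD : D.Obstructed) {n : ℕ} (X : SCat cof (SimplexCategory.mk n))
    (φ : SimplexCategory.mk n ⟶ SimplexCategory.mk 3) {I J : Finset (Fin (n + 1))}
    (hI : I.Nonempty) (hJ : J.Nonempty)
    (hφI : Admissible (faceIncl I hI ≫ φ)) (hφJ : Admissible (faceIncl J hJ ≫ φ))
    (eI : Nonempty ((SMap cof (faceIncl I hI)).obj X ≅ D.partObj (faceIncl I hI ≫ φ) hφI))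
    (eJ : Nonempty ((SMap cof (faceIncl J hJ)).obj X ≅ D.partObj (faceIncl J hJ ≫ φ) hφJ))
    {a b c : Fin (n + 1)} (hab : a < b) (hbc : b < c)
    (ha : a ∈ I) (hc : c ∈ I) (hb : b ∈ J) (hc' : c ∈ J)
    (ha0 : φ.toOrderHom a = (0 : Fin 4)) (hb2 : φ.toOrderHom b = (2 : Fin 4))
    (hc3 : φ.toOrderHom c = (3 : Fin 4)) : False := by
  obtain ⟨e₁⟩ := eI
  obtain ⟨e₂⟩ := eJ
  have e₁ := D.entry_iso X φ hI hφI e₁ (hab.trans hbc).le ha hc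
  have e₂ := D.entry_iso X φ hJ hφJ e₂ hbc.le hb hc'
  have h := X.property.2 a b c hab hbc
  refine hD _ _ _ _ _ h.1 ⟨_, _, _, X.property.1 b, h.2⟩ ?_ ?_
  · have : (⟨(φ.toOrderHom a, φ.toOrderHom c), φ.toOrderHom.monotone (hab.trans hbc).le⟩ :
        Ar (SimplexCategory.mk 3)) = ⟨((0 : Fin 4), (3 : Fin 4)), by decide⟩ :=
      Subtype.ext (Prod.ext ha0 hc3)
    rw [this] at e₁
    exact e₁
  · have : (⟨(φ.toOrderHom b, φ.toOrderHom c), φ.toOrderHom.monotone hbc.le⟩ :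
        Ar (SimplexCategory.mk 3)) = ⟨((2 : Fin 4), (3 : Fin 4)), by decide⟩ :=
      Subtype.ext (Prod.ext hb2 hc3)
    rw [this] at e₂
    exact e₂

end SeqPair
end Partial

/-! ### Diagonals which do not separate off the vertex `0` -/

section Combinatorics

variable {n : ℕ}

namespace PolySubdiv

variable (P : PolySubdiv n)

lemma unsplit_diagonal {e : Fin (n + 1) × Fin (n + 1)} (he : e ∈ P.diagonals) :
    P.Unsplit {e.1, e.2} := by
  intro d hd
  have h₁ := P.noncrossing d hd e he
  have h₂ := P.noncrossing e he d hd
  have h₃ := (P.isDiagonal d hd).1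
  have h₄ := (P.isDiagonal e he).1
  simp only [Finset.mem_insert, Finset.mem_singleton, forall_eq_or_imp, forall_eq]
  simp only [Fin.lt_def, Fin.le_def] at *
  omega

lemma unsplit_cell (I : P.Cells) : P.Unsplit I.verts := by
  rcases I.mem with h | ⟨d, hd, h⟩
  · exact h.1
  · rw [h]; exact P.unsplit_diagonal hd

lemma exists_polygon {I : Finset (Fin (n + 1))} (hI : P.Unsplit I) :
    ∃ J : P.Cells, I ⊆ J.verts := by
  obtain ⟨J, hIJ, hJ⟩ := Finite.exists_le_maximal hI
  exact ⟨⟨J, Or.inl hJ⟩, hIJ⟩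

/-- A polygon which does not contain the vertex `0` is separated from `0` by a diagonal, and
neither of the ends of this diagonal is `0`. -/
lemma exists_diagonal (h : ∃ I ∈ P.polygons, 0 ∉ I) : ∃ d ∈ P.diagonals, 0 < d.1 := by
  obtain ⟨I, hI, h0⟩ := h
  by_contra hne
  push Not at hne
  refine h0 (hI.2 (y := insert 0 I) ?_ (Finset.subset_insert 0 I) (Finset.mem_insert_self 0 I))
  intro d hd
  have hd0 : d.1 = 0 := le_antisymm (hne d hd) (Fin.zero_le _)
  rcases hI.1 d hd with h | h
  · left
    intro x hx
    rcases Finset.mem_insert.1 hx with rfl | hx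
    · exact ⟨hne d hd, Fin.zero_le _⟩
    · exact h x hx
  · right
    intro x hx
    rcases Finset.mem_insert.1 hx with rfl | hx
    · exact Or.inl (Fin.zero_le _)
    · exact h x hx

/-- Among the diagonals not ending at `0` there is a longest one. -/
lemma exists_longest_diagonal (h : ∃ I ∈ P.polygons, 0 ∉ I) :
    ∃ d ∈ P.diagonals, 0 < d.1 ∧
      ∀ e ∈ P.diagonals, 0 < e.1 → e.2.val - e.1.val ≤ d.2.val - d.1.val := by
  obtain ⟨d, hd, h0⟩ := P.exists_diagonal h
  obtain ⟨d', hd', hmax⟩ := Set.exists_max_image {d ∈ P.diagonals | 0 < d.1}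
    (fun e => e.2.val - e.1.val) (Set.toFinite _) ⟨d, hd, h0⟩
  exact ⟨d', hd'.1, hd'.2, fun e he he0 => hmax e ⟨he, he0⟩⟩

end PolySubdiv

/-- The map `[n] → [3]` attached to a diagonal from `p` to `r`, which is `0` below `p`, `1` on
`[p, r - 1)`, `2` at `r - 1`, and `3` from `r` on. -/
def cutMap (n p r : ℕ) : SimplexCategory.mk n ⟶ SimplexCategory.mk 3 :=
  SimplexCategory.Hom.mk
    { toFun := fun x => if x.val < p then (0 : Fin 4) else if x.val + 1 < r then (1 : Fin 4)
        else if x.val < r then (2 : Fin 4) else (3 : Fin 4)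
      monotone' := by
        intro x y hxy
        have h : x.val ≤ y.val := hxy
        dsimp only
        split_ifs <;> first | omega | decide }

lemma cutMap_apply (n p r : ℕ) (x : Fin (n + 1)) : (cutMap n p r).toOrderHom x =
    if x.val < p then (0 : Fin 4) else if x.val + 1 < r then (1 : Fin 4)
        else if x.val < r then (2 : Fin 4) else (3 : Fin 4) := rfl

lemma cutMap_eq_zero {n p r : ℕ} {x : Fin (n + 1)} :
    (cutMap n p r).toOrderHom x = (0 : Fin 4) ↔ x.val < p := by
  rw [cutMap_apply]; split_ifs <;> simp_all

lemma cutMap_eq_two {n p r : ℕ} {x : Fin (n + 1)} :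
    (cutMap n p r).toOrderHom x = (2 : Fin 4) ↔ p ≤ x.val ∧ r ≤ x.val + 1 ∧ x.val < r := by
  rw [cutMap_apply]; split_ifs <;> simp <;> omega

lemma cutMap_eq_three {n p r : ℕ} {x : Fin (n + 1)} :
    (cutMap n p r).toOrderHom x = (3 : Fin 4) ↔ p ≤ x.val ∧ r ≤ x.val := by
  rw [cutMap_apply]; split_ifs <;> simp <;> omega

lemma faceIncl_mem (I : Finset (Fin (n + 1))) (hI : I.Nonempty) (x) :
    (faceIncl I hI).toOrderHom x ∈ I :=
  I.orderEmbOfFin_mem (card_eq hI) x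

lemma admissible_face {φ : SimplexCategory.mk n ⟶ SimplexCategory.mk 3} {I : Finset (Fin (n + 1))}
    (hI : I.Nonempty)
    (h : ∀ x ∈ I, ∀ y ∈ I, φ.toOrderHom x = (0 : Fin 4) → φ.toOrderHom y = (2 : Fin 4) → False) :
    Admissible (faceIncl I hI ≫ φ) :=
  fun x y hx hy => h _ (faceIncl_mem I hI x) _ (faceIncl_mem I hI y) hx hy

end Combinatorics

/-! ### Failure of the 2-Segal conditions -/

section NotSegal

variable {C : Type u} [Category.{v} C] {cof : MorphismProperty C} [IsCatWithCof cof]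
  {D : SeqPair cof}

namespace SeqPair

variable (D) in
lemma SMap_faceMap {n : ℕ} {I J : Finset (Fin (n + 1))} (hI : I.Nonempty) (hJ : J.Nonempty)
    (h : I ⊆ J) (φ : SimplexCategory.mk n ⟶ SimplexCategory.mk 3)
    (h₁ : Admissible (faceIncl I hI ≫ φ)) (h₂ : Admissible (faceIncl J hJ ≫ φ)) :
    (SMap cof (faceMap hI hJ h)).obj (D.partObj (faceIncl J hJ ≫ φ) h₂) =
      D.partObj (faceIncl I hI ≫ φ) h₁ :=
  D.partObj_congr (congrArg (· ≫ φ) (faceMap_incl hI hJ h)) (h₂.comp (faceMap hI hJ h)) h₁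

/-- If some polygon does not contain `0`, then the faces on the cells of the subdivision can be
mapped compatibly to `S_•` in such a way that no simplex of `S_n` restricts to them. -/
lemma Obstructed.exists_not_restrict (hD : D.Obstructed) {n : ℕ} (P : PolySubdiv n)
    (hP : ∃ I ∈ P.polygons, 0 ∉ I) :
    ∃ (φ : SimplexCategory.mk n ⟶ SimplexCategory.mk 3)
      (hφ : ∀ I : P.Cells, Admissible (faceIncl I.verts I.nonempty ≫ φ)),
      ∀ X : SCat cof (SimplexCategory.mk n),
        ¬ ∀ I : P.Cells, Nonempty ((SMap cof (faceIncl I.verts I.nonempty)).obj X ≅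
          D.partObj (faceIncl I.verts I.nonempty ≫ φ) (hφ I)) := by
  obtain ⟨⟨p, r⟩, hd, h0, hmax⟩ := P.exists_longest_diagonal hP
  have hpr : p.val + 1 < r.val := (P.isDiagonal _ hd).1
  have h0' : 0 < p.val := h0
  have hφ : ∀ I : P.Cells, Admissible (faceIncl I.verts I.nonempty ≫ cutMap n p r) := by
    intro I
    refine admissible_face _ fun x hx y hy hx0 hy2 => ?_
    rw [cutMap_eq_zero] at hx0
    rw [cutMap_eq_two] at hy2
    rcases P.unsplit_cell I _ hd with h | h
    · have := (h x hx).1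
      simp only [Fin.le_def] at this
      omega
    · have := h y hy
      simp only [Fin.le_def] at this
      omega
  refine ⟨cutMap n p r, hφ, fun X hX => ?_⟩
  -- A diagonal separating `0` from `r` would not end at `0` and, as it does not cross `(p, r)`,
  -- would be longer than `(p, r)`.
  have u₁ : P.Unsplit {0, r} := by
    intro e he
    have h₁ := P.noncrossing _ hd e he
    have h₂ := hmax e he
    have h₃ := (P.isDiagonal e he).1
    simp only [Finset.mem_insert, Finset.mem_singleton, forall_eq_or_imp, forall_eq]
    simp only [Fin.lt_def, Fin.le_def, Fin.val_zero] at *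
    omega
  -- The neighbour of `r` on the side of `(p, r)` away from `0`. As `s` and `r` span an edge of the
  -- polygon, no diagonal separates them.
  let s : Fin (n + 1) := ⟨r.val - 1, by omega⟩
  have hs : s.val = r.val - 1 := rfl
  have u₂ : P.Unsplit {s, r} := by
    intro e he
    have h₃ := (P.isDiagonal e he).1
    simp only [Finset.mem_insert, Finset.mem_singleton, forall_eq_or_imp, forall_eq]
    simp only [Fin.le_def, hs] at *
    omega
  obtain ⟨I, hI⟩ := P.exists_polygon u₁
  obtain ⟨J, hJ⟩ := P.exists_polygon u₂
  refine hD.not_extend D X (cutMap n p r) I.nonempty J.nonempty (hφ I) (hφ J) (hX I) (hX J)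
    (a := 0) (b := s) (c := r) ?_ ?_ (hI (by simp)) (hI (by simp)) (hJ (by simp)) (hJ (by simp))
    (cutMap_eq_zero.2 h0) (cutMap_eq_two.2 ⟨?_, ?_, ?_⟩) (cutMap_eq_three.2 ⟨?_, le_rfl⟩)
  all_goals first | (rw [Fin.lt_def]; simp only [Fin.val_zero]; omega) | omega

end SeqPair

/-- An object of the projective 2-limit given by a strictly compatible family. -/
def strictTwoLim {J : Type w} [Category.{w} J] {F : J ⥤ Cat.{v, u}} (y : ∀ a, F.obj a)
    (h : ∀ {a b : J} (f : a ⟶ b), (F.map f).toFunctor.obj (y a) = y b) : TwoLim F where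
  obj := y
  iso f := eqToIso (h f)
  iso_comp f g := by simp [eqToHom_map]

/-- The components of an isomorphism in the projective 2-limit. -/
def TwoLim.appIso {J : Type w} [Category.{w} J] {F : J ⥤ Cat.{v, u}} {y z : TwoLim F}
    (e : y ≅ z) (a : J) : y.obj a ≅ z.obj a where
  hom := TwoLim.Hom.app e.hom a
  inv := TwoLim.Hom.app e.inv a
  hom_inv_id := congrFun (congrArg TwoLim.Hom.app e.hom_inv_id) a
  inv_hom_id := congrFun (congrArg TwoLim.Hom.app e.inv_hom_id) a

/-- The first component of an isomorphism in a strict fibre product. -/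
def StrictPullback.fstIso {A B E : Type u} [Category.{v} A] [Category.{v} B] [Category.{v} E]
    {F : A ⥤ E} {G : B ⥤ E} {x y : StrictPullback F G} (e : x ≅ y) : x.fst ≅ y.fst where
  hom := StrictPullback.Hom.fst e.hom
  inv := StrictPullback.Hom.fst e.inv
  hom_inv_id := congrArg StrictPullback.Hom.fst e.hom_inv_id
  inv_hom_id := congrArg StrictPullback.Hom.fst e.inv_hom_id

/-- The second component of an isomorphism in a strict fibre product. -/
def StrictPullback.sndIso {A B E : Type u} [Category.{v} A] [Category.{v} B] [Category.{v} E]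
    {F : A ⥤ E} {G : B ⥤ E} {x y : StrictPullback F G} (e : x ≅ y) : x.snd ≅ y.snd where
  hom := StrictPullback.Hom.snd e.hom
  inv := StrictPullback.Hom.snd e.inv
  hom_inv_id := congrArg StrictPullback.Hom.snd e.hom_inv_id
  inv_hom_id := congrArg StrictPullback.Hom.snd e.inv_hom_id

namespace SeqPair

/-- The family of restrictions of the diagram is an object of the 2-limit which is not in the
essential image. -/
lemma Obstructed.not_isEquivalence (hD : D.Obstructed) {n : ℕ} (P : PolySubdiv n)
    (hP : ∃ I ∈ P.polygons, 0 ∉ I) : ¬ (segalFunctor (SDot cof) P).IsEquivalence := by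
  intro hE
  obtain ⟨φ, hφ, h⟩ := hD.exists_not_restrict P hP
  let y : TwoLim ((faceFunctor P).op ⋙ SDot cof) := strictTwoLim
    (fun I => D.partObj (faceIncl I.unop.verts I.unop.nonempty ≫ φ) (hφ I.unop))
    (fun {I J} f => D.SMap_faceMap J.unop.nonempty I.unop.nonempty (leOfHom f.unop) φ _ _)
  obtain ⟨X, ⟨e⟩⟩ := hE.essSurj.mem_essImage y
  exact h X fun I => ⟨TwoLim.appIso e (op I)⟩

/-- An isomorphism in the 2-limit is levelwise an isomorphism in `S_•`, whatever the weak
equivalences are, so the argument of `not_isEquivalence` applies. -/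
lemma Obstructed.not_isEquivalence_weq (hD : D.Obstructed) (wEq : MorphismProperty C)
    [wEq.IsMultiplicative] {n : ℕ} (P : PolySubdiv n)
    (hP : ∃ I ∈ P.polygons, 0 ∉ I) : ¬ (segalFunctor (WSDot cof wEq) P).IsEquivalence := by
  intro hE
  obtain ⟨φ, hφ, h⟩ := hD.exists_not_restrict P hP
  let y : TwoLim ((faceFunctor P).op ⋙ WSDot cof wEq) := strictTwoLim
    (fun I => (⟨D.partObj (faceIncl I.unop.verts I.unop.nonempty ≫ φ) (hφ I.unop)⟩ :
      WSCat cof wEq (faceObj I.unop.verts)))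
    (fun {I J} f => congrArg WideSubcategory.mk
      (D.SMap_faceMap J.unop.nonempty I.unop.nonempty (leOfHom f.unop) φ (hφ J.unop) (hφ I.unop)))
  obtain ⟨X, ⟨e⟩⟩ := hE.essSurj.mem_essImage y
  exact h X.obj fun I => ⟨(wideSubcategoryInclusion (SWeq cof wEq (faceObj I.verts))).mapIso
    (TwoLim.appIso e (op I))⟩

/-- The two faces of the diagram given by `I` and `J` do not come from an `n`-simplex. -/
lemma Obstructed.not_essSurj (hD : D.Obstructed) {n : ℕ} {I J K : Finset (Fin (n + 1))}
    (hI : I.Nonempty) (hJ : J.Nonempty) (hK : K.Nonempty) (hKI : K ⊆ I) (hKJ : K ⊆ J)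
    (φ : SimplexCategory.mk n ⟶ SimplexCategory.mk 3)
    (hφI : Admissible (faceIncl I hI ≫ φ)) (hφJ : Admissible (faceIncl J hJ ≫ φ))
    {a b c : Fin (n + 1)} (hab : a < b) (hbc : b < c)
    (ha : a ∈ I) (hc : c ∈ I) (hb : b ∈ J) (hc' : c ∈ J)
    (ha0 : φ.toOrderHom a = (0 : Fin 4)) (hb2 : φ.toOrderHom b = (2 : Fin 4))
    (hc3 : φ.toOrderHom c = (3 : Fin 4)) :
    ¬ (toStrictPullback (SDot cof) hI hJ hK hKI hKJ).EssSurj := by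
  intro hE
  have hφK : Admissible (faceIncl K hK ≫ φ) := by
    rw [← faceMap_incl hK hI hKI, Category.assoc]
    exact hφI.comp _
  let y : StrictPullback ((SDot cof).map (faceMap hK hI hKI).op).toFunctor
      ((SDot cof).map (faceMap hK hJ hKJ).op).toFunctor :=
    { fst := D.partObj (faceIncl I hI ≫ φ) hφI
      snd := D.partObj (faceIncl J hJ ≫ φ) hφJ
      eq := (D.SMap_faceMap hK hI hKI φ hφK hφI).trans (D.SMap_faceMap hK hJ hKJ φ hφK hφJ).symm }
  obtain ⟨X, ⟨e⟩⟩ := hE.mem_essImage y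
  exact hD.not_extend D X φ hI hJ hφI hφJ ⟨StrictPullback.fstIso e⟩ ⟨StrictPullback.sndIso e⟩
    hab hbc ha hc hb hc' ha0 hb2 hc3

/-- The case of the faces `{0, 1, n}` and `{1, …, n}`, where the vertex `2` maps to `2 ∈ [3]` and
lies in the second face only. -/
lemma Obstructed.not_essSurj_corner (hD : D.Obstructed) (n : ℕ) (hn : 3 ≤ n) (h1 : 1 ≤ n) :
    ¬ (cornerFunctor (SDot cof) n h1).EssSurj := by
  refine hD.not_essSurj _ _ _ _ _ (cutMap n 1 3) (admissible_face _ fun x hx y hy hx0 hy2 => ?_)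
    (admissible_face _ fun x hx y hy hx0 hy2 => ?_)
    (a := 0) (b := ⟨2, by omega⟩) (c := Fin.last n) ?_ ?_ (by simp)
    (by simp) (by simp [Fin.le_def]) (by simp [Fin.le_last]) (cutMap_eq_zero.2 (by simp))
    (cutMap_eq_two.2 (by simp)) (cutMap_eq_three.2 ⟨h1, hn⟩)
  · rw [cutMap_eq_two] at hy2
    simp only [Finset.mem_insert, Finset.mem_singleton] at hy
    rcases hy with rfl | rfl | rfl <;> simp at hy2
    omega
  · rw [cutMap_eq_zero] at hx0
    rw [Finset.mem_Ici, Fin.le_def] at hx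
    simp only at hx
    omega
  · simp [Fin.lt_def]
  · rw [Fin.lt_def]; exact hn

/-- The triangulation of the square by the diagonal from `1` to `3`. -/
def _root_.TwoSegal.squareCut : PolySubdiv 3 where
  diagonals := {(1, 3)}
  isDiagonal d hd := by
    rw [Set.mem_singleton_iff] at hd
    subst hd
    decide
  noncrossing d hd e he := by
    rw [Set.mem_singleton_iff] at hd he
    subst hd he
    decide

lemma Obstructed.not_isTwoSegalCat (hD : D.Obstructed) : ¬ IsTwoSegalCat (SDot cof) := by
  intro h
  refine hD.not_isEquivalence squareCut ?_ (h 3 (by norm_num) squareCut)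
  have u : squareCut.Unsplit {1, 2, 3} := by
    intro d hd
    obtain rfl : d = (1, 3) := hd
    left
    decide
  obtain ⟨I, hI, hmax⟩ := Finite.exists_le_maximal u
  refine ⟨I, hmax, fun h0 => ?_⟩
  have h2 : (2 : Fin 4) ∈ I := hI (by decide)
  rcases hmax.1 (1, 3) rfl with h | h
  · exact absurd (h 0 h0).1 (by decide)
  · exact absurd (h 2 h2) (by decide)

end SeqPair

/-- The inverse of the map glued from isomorphisms is glued from their inverses. -/
lemma isWaldhausen_isomorphisms {cof : MorphismProperty C} :
    IsWaldhausen cof (MorphismProperty.isomorphisms C) where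
  of_isIso f hf := hf
  gluing {A B X P A' B' X' P' f g h k f' g' h' k' a b x p} H H' _ _ e₁ e₂ e₃ e₄ ha hb hx := by
    have : IsIso a := ha
    have : IsIso b := hb
    have : IsIso x := hx
    refine ⟨H'.desc (inv b ≫ h) (inv x ≫ k) ?_, ?_, ?_⟩
    · rw [← cancel_epi a, ← reassoc_of% e₁, ← reassoc_of% e₂]
      simp [H.w]
    · apply H.hom_ext
      · rw [reassoc_of% e₃, H'.inl_desc]; simp
      · rw [reassoc_of% e₄, H'.inr_desc]; simp
    · apply H'.hom_ext
      · rw [H'.inl_desc_assoc, Category.assoc, e₃]; simp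
      · rw [H'.inr_desc_assoc, Category.assoc, e₄]; simp

end NotSegal

/-! ### Contractible spaces and homotopy limits -/

section Contraction

open unitInterval

/-- A contraction of a space to a point. -/
structure Contraction (X : Type u) [TopologicalSpace X] where
  pt : X
  H : C(X × I, X)
  H_zero : ∀ x, H (x, 0) = x
  H_one : ∀ x, H (x, 1) = pt

namespace Contraction

variable {X : Type u} [TopologicalSpace X]

lemma joined (c : Contraction X) (x : X) : Joined x c.pt :=
  ⟨{ toFun := fun t => c.H (x, t)
     source' := c.H_zero x
     target' := c.H_one x }⟩

lemma subsingleton_zerothHomotopy (c : Contraction X) : Subsingleton (ZerothHomotopy X) :=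
  ⟨by
    rintro ⟨x⟩ ⟨y⟩
    exact Quotient.sound ((c.joined x).trans (c.joined y).symm)⟩

/-- The homotopy that expands the cube radially from its centre by the factor `1 + s`, pushing
everything which leaves the cube to the boundary. -/
def expand {N : Type} (y : N → I) (s : I) : N → I :=
  fun i => Set.projIcc 0 1 zero_le_one ((1 / 2 : ℝ) + (1 + (s : ℝ)) * ((y i : ℝ) - 1 / 2))

lemma expand_zero {N : Type} (y : N → I) : expand y 0 = y := by
  funext i
  have : (1 / 2 : ℝ) + (1 + ((0 : I) : ℝ)) * ((y i : ℝ) - 1 / 2) = y i := by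
    rw [Set.Icc.coe_zero]; ring
  rw [expand, this, Set.projIcc_val]

lemma expand_mem_boundary {N : Type} {y : N → I} {s : I} {i : N}
    (h : (1 + (s : ℝ)) * (y i : ℝ) ≤ s / 2 ∨ (1 + (s : ℝ)) * (1 - (y i : ℝ)) ≤ s / 2) :
    expand y s ∈ Cube.boundary N := by
  refine ⟨i, h.imp (fun h => ?_) fun h => ?_⟩
  · exact Set.projIcc_of_le_left _ (by nlinarith)
  · exact Set.projIcc_of_right_le _ (by nlinarith)

lemma expand_boundary {N : Type} {y : N → I} (hy : y ∈ Cube.boundary N) (s : I) :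
    expand y s ∈ Cube.boundary N := by
  obtain ⟨i, hi⟩ := hy
  refine expand_mem_boundary (i := i) (hi.imp (fun h => ?_) fun h => ?_)
  · rw [h]; simpa using div_nonneg s.2.1 zero_le_two
  · rw [h]; simpa using div_nonneg s.2.1 zero_le_two

lemma continuous_expand {N : Type} : Continuous fun p : (N → I) × I => expand p.1 p.2 := by
  unfold expand
  fun_prop

/-- A function on the cube which vanishes on the boundary and is `1` on the cube of half
the size. -/
def bump {N : Type} [Fintype N] (y : N → I) : I :=
  ∏ i, Set.projIcc 0 1 zero_le_one (4 * min (y i : ℝ) (1 - y i))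

lemma continuous_bump {N : Type} [Fintype N] : Continuous (bump (N := N)) := by
  unfold bump
  fun_prop

lemma bump_boundary {N : Type} [Fintype N] {y : N → I} (hy : y ∈ Cube.boundary N) :
    bump y = 0 := by
  obtain ⟨i, hi⟩ := hy
  refine Finset.prod_eq_zero (Finset.mem_univ i) (Set.projIcc_of_le_left _ ?_)
  rcases hi with h | h <;> simp [h]

lemma bump_eq_one_or {N : Type} [Fintype N] (y : N → I) :
    bump y = 1 ∨ expand y 1 ∈ Cube.boundary N := by
  by_cases h : ∀ i, 1 ≤ 4 * min (y i : ℝ) (1 - y i)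
  · exact Or.inl (Finset.prod_eq_one fun i _ => Set.projIcc_of_right_le _ (h i))
  · push Not at h
    obtain ⟨i, hi⟩ := h
    refine Or.inr (expand_mem_boundary (i := i) ?_)
    rw [Set.Icc.coe_one]
    rcases min_choice (y i : ℝ) (1 - y i) with h | h <;> rw [h] at hi
    · left; linarith
    · right; linarith

/-- The homotopy groups of a contractible space vanish at all base points. The loop is first moved
along the contraction while it is concentrated in the middle of the cube; this leaves a loop which
factors through a path starting at the base point. -/
lemma subsingleton_homotopyGroup (c : Contraction X) (N : Type) [Fintype N] (x : X) :
    Subsingleton (HomotopyGroup N X x) := by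
  classical
  suffices h : ∀ p : GenLoop N X x, GenLoop.Homotopic p GenLoop.const from
    ⟨by
      rintro ⟨p⟩ ⟨q⟩
      exact Quotient.sound ((h p).trans (h q).symm)⟩
  intro p
  let g : C(N → I, X) := ⟨fun y => c.H (x, bump y),
    c.H.continuous.comp (continuous_const.prodMk continuous_bump)⟩
  have h₁ : p.1.HomotopicRel g (Cube.boundary N) := ⟨{
    toFun := fun q => c.H (p.1 (expand q.2 q.1), q.1 * bump q.2)
    continuous_toFun := by
      refine c.H.continuous.comp (Continuous.prodMk (p.1.continuous.comp ?_) ?_)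
      · exact continuous_expand.comp continuous_swap
      · exact continuous_fst.mul (continuous_bump.comp continuous_snd)
    map_zero_left := fun y => by
      change c.H (p.1 (expand y 0), 0 * bump y) = p.1 y
      rw [expand_zero, zero_mul, c.H_zero]
    map_one_left := fun y => by
      change c.H (p.1 (expand y 1), 1 * bump y) = c.H (x, bump y)
      rw [one_mul]
      rcases bump_eq_one_or y with h | h
      · rw [h, c.H_one, c.H_one]
      · rw [p.2 _ h]
    prop' := fun t y hy => by
      change c.H (p.1 (expand y t), t * bump y) = p.1 y
      rw [bump_boundary hy, mul_zero, c.H_zero, p.2 _ (expand_boundary hy t), p.2 _ hy] }⟩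
  have h₂ : g.HomotopicRel (GenLoop.const (N := N) (x := x)).1 (Cube.boundary N) := ⟨{
    toFun := fun q => c.H (x, σ q.1 * bump q.2)
    continuous_toFun := by
      refine c.H.continuous.comp (Continuous.prodMk continuous_const ?_)
      exact (unitInterval.continuous_symm.comp continuous_fst).mul
        (continuous_bump.comp continuous_snd)
    map_zero_left := fun y => by
      change c.H (x, σ 0 * bump y) = c.H (x, bump y)
      rw [unitInterval.symm_zero, one_mul]
    map_one_left := fun y => by
      change c.H (x, σ 1 * bump y) = x
      rw [unitInterval.symm_one, zero_mul, c.H_zero]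
    prop' := fun t y hy => by
      change c.H (x, σ t * bump y) = c.H (x, bump y)
      rw [bump_boundary hy, mul_zero] }⟩
  exact h₁.trans h₂

variable {Y : Type v} [TopologicalSpace Y]

/-- Any map between contractible spaces is a weak homotopy equivalence. -/
lemma isWeakEquiv (c : Contraction X) (d : Contraction Y) (f : C(X, Y)) : IsWeakEquiv f := by
  refine ⟨?_, fun n x _ => ?_⟩
  · have := c.subsingleton_zerothHomotopy
    have := d.subsingleton_zerothHomotopy
    exact ⟨Function.injective_of_subsingleton _, fun y => ⟨Quotient.mk _ c.pt,
      Subsingleton.elim _ _⟩⟩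
  · have := c.subsingleton_homotopyGroup (Fin n) x
    have := d.subsingleton_homotopyGroup (Fin n) (f x)
    exact ⟨Function.injective_of_subsingleton _, fun y => ⟨Quotient.mk _ GenLoop.const,
      Subsingleton.elim _ _⟩⟩

/-- A map which carries one contraction to another. -/
def Compatible (c : Contraction X) (d : Contraction Y) (f : C(X, Y)) : Prop :=
  f c.pt = d.pt ∧ ∀ x t, f (c.H (x, t)) = d.H (f x, t)

/-- The homotopy limit of a diagram of compatibly contracted spaces is contractible: a point of it
is a compatible family of maps, to which the contractions are applied pointwise. -/
def holim {J : Type} [SmallCategory J] {F : J ⥤ TopCat.{u}} (c : ∀ a, Contraction (F.obj a))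
    (hc : ∀ {a b : J} (f : a ⟶ b), Compatible (c a) (c b) (F.map f).hom) :
    Contraction (Holim F) where
  pt := ⟨fun a => ContinuousMap.const _ (c a).pt, fun a b f => by
    ext y
    exact (hc f).1⟩
  H :=
    { toFun := fun p => ⟨fun a => (c a).H.comp
          (((p.1.1 a).prodMk (ContinuousMap.const _ p.2))), fun a b f => by
        ext y
        refine ((hc f).2 _ _).trans ?_
        exact congrArg (fun z => (c b).H (z, p.2)) (DFunLike.congr_fun (p.1.2 a b f) y)⟩
      continuous_toFun := Continuous.subtype_mk (continuous_pi fun a => by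
        refine (ContinuousMap.continuous_postcomp (c a).H).comp ?_
        have h₁ : Continuous fun p : Holim F × I =>
            ContinuousMap.prodMk (ContinuousMap.const (overSpace a) p.2) (p.1.1 a) :=
          ContinuousMap.continuous_prodMk_const.comp (continuous_snd.prodMk
            ((continuous_apply a).comp (continuous_subtype_val.comp continuous_fst)))
        exact (ContinuousMap.continuous_postcomp
          (ContinuousMap.mk (Prod.swap : I × F.obj a → F.obj a × I) continuous_swap)).comp h₁) _ }
  H_zero p := by
    refine Subtype.ext (funext fun a => ?_)
    ext y
    exact (c a).H_zero _
  H_one p := by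
    refine Subtype.ext (funext fun a => ?_)
    ext y
    exact (c a).H_one _

end Contraction
end Contraction

/-! ### Geometric realizations of cones -/

section Realization

open unitInterval

/-- The continuous map from the topological simplex to the realization given by a simplex, obtained
from the unit of the adjunction between realization and singular simplicial set. -/
def charMap (X : SSet.{u}) {n : SimplexCategory} (x : X.obj (op n)) :
    C(stdSimplex ℝ (Fin (n.len + 1)), SSet.toTop.obj X) :=
  TopCat.toSSetObjEquiv _ (op n) ((sSetTopAdj.unit.app X).app (op n) x)

lemma charMap_map {X : SSet.{u}} {m n : SimplexCategory} (θ : m ⟶ n) (x : X.obj (op n))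
    (t : stdSimplex ℝ (Fin (m.len + 1))) :
    charMap X (X.map θ.op x) t = charMap X x (stdSimplex.map θ.toOrderHom t) := by
  have h := ConcreteCategory.congr_hom ((sSetTopAdj.unit.app X).naturality θ.op) x
  exact congrArg (fun z => TopCat.toSSetObjEquiv _ (op m) z t) h

lemma map_charMap {X Y : SSet.{u}} (f : X ⟶ Y) {n : SimplexCategory} (x : X.obj (op n))
    (t : stdSimplex ℝ (Fin (n.len + 1))) :
    (SSet.toTop.map f).hom (charMap X x t) = charMap Y (f.app (op n) x) t := by
  have h := sSetTopAdj.unit.naturality f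
  have h' := ConcreteCategory.congr_hom (congrArg (fun g => NatTrans.app g (op n)) h) x
  exact (congrArg (fun z => TopCat.toSSetObjEquiv _ (op n) z t) h').symm

/-- Maps out of a realization are determined by their values on the simplices. -/
lemma realization_hom_ext {X : SSet.{u}} {Z : TopCat.{u}} {g g' : SSet.toTop.obj X ⟶ Z}
    (h : ∀ (n : SimplexCategory) (x : X.obj (op n)) (t : stdSimplex ℝ (Fin (n.len + 1))),
      g.hom (charMap X x t) = g'.hom (charMap X x t)) : g = g' := by
  refine (sSetTopAdj.homEquiv X Z).injective ?_
  rw [Adjunction.homEquiv_unit, Adjunction.homEquiv_unit]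
  ext n x
  refine (TopCat.toSSetObjEquiv _ n).injective (ContinuousMap.ext fun t => ?_)
  exact h n.unop x t

/-- A compatible family of maps on the simplices induces a map on the realization. -/
lemma exists_realization_hom (X : SSet.{u}) (Z : TopCat.{u})
    (φ : ∀ n : SimplexCategory, X.obj (op n) → C(stdSimplex ℝ (Fin (n.len + 1)), Z))
    (hφ : ∀ {m n : SimplexCategory} (θ : m ⟶ n) (x : X.obj (op n)) t,
      φ m (X.map θ.op x) t = φ n x (stdSimplex.map θ.toOrderHom t)) :
    ∃ g : SSet.toTop.obj X ⟶ Z, ∀ (n : SimplexCategory) (x : X.obj (op n)) t,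
      g.hom (charMap X x t) = φ n x t := by
  let ψ : X ⟶ TopCat.toSSet.obj Z :=
    { app := fun n => ↾fun x => (TopCat.toSSetObjEquiv Z n).symm (φ n.unop x)
      naturality := fun n m θ => by
        ext x
        refine (TopCat.toSSetObjEquiv _ m).injective (ContinuousMap.ext fun t => ?_)
        exact (congrFun (congrArg DFunLike.coe (Equiv.apply_symm_apply _ _)) t).trans
          (hφ θ.unop x t) }
  refine ⟨(sSetTopAdj.homEquiv X Z).symm ψ, fun n x t => ?_⟩
  have h := (sSetTopAdj.homEquiv X Z).apply_symm_apply ψ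
  rw [Adjunction.homEquiv_unit] at h
  have h' := ConcreteCategory.congr_hom (congrArg (fun g => NatTrans.app g (op n)) h) x
  refine (congrArg (fun z => TopCat.toSSetObjEquiv _ (op n) z t) h').trans ?_
  exact congrFun (congrArg DFunLike.coe ((TopCat.toSSetObjEquiv Z (op n)).apply_symm_apply _)) t

/-- The map of cones induced by a map of simplices. -/
def coneMap {m n : SimplexCategory} (θ : m ⟶ n) :
    SimplexCategory.mk (m.len + 1) ⟶ SimplexCategory.mk (n.len + 1) :=
  SimplexCategory.Hom.mk
    { toFun := Fin.cases 0 fun i => (θ.toOrderHom i).succ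
      monotone' := by
        intro i j hij
        induction i using Fin.cases with
        | zero => exact Fin.zero_le _
        | succ i =>
          induction j using Fin.cases with
          | zero => exact absurd hij (by simp)
          | succ j =>
            exact Fin.succ_le_succ_iff.2 (θ.toOrderHom.monotone (Fin.succ_le_succ_iff.1 hij)) }

/-- The inclusion of the base of a cone. -/
def coneBase (n : SimplexCategory) : n ⟶ SimplexCategory.mk (n.len + 1) :=
  SimplexCategory.Hom.mk ⟨Fin.succ, fun _ _ h => Fin.succ_le_succ_iff.2 h⟩

/-- The inclusion of the apex of a cone. -/
def coneApex (n : SimplexCategory) : SimplexCategory.mk 0 ⟶ SimplexCategory.mk (n.len + 1) :=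
  SimplexCategory.Hom.mk ⟨fun _ => 0, fun _ _ _ => le_rfl⟩

/-- The point of the cone over the simplex which divides the segment from `t` to the apex in the
ratio `s : 1 - s`. -/
def conePoint (n : ℕ) : C(stdSimplex ℝ (Fin (n + 1)) × I, stdSimplex ℝ (Fin (n + 2))) where
  toFun p := ⟨Fin.cons (p.2 : ℝ) fun i => (1 - (p.2 : ℝ)) * p.1 i, by
    constructor
    · intro i
      induction i using Fin.cases with
      | zero => exact p.2.2.1
      | succ i => exact mul_nonneg (sub_nonneg.2 p.2.2.2) (p.1.2.1 i)
    · rw [Fin.sum_univ_succ]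
      simp only [Fin.cons_zero, Fin.cons_succ]
      rw [← Finset.mul_sum, stdSimplex.sum_eq_one]
      ring⟩
  continuous_toFun := Continuous.subtype_mk (continuous_pi fun i => by
    induction i using Fin.cases with
    | zero => exact continuous_subtype_val.comp continuous_snd
    | succ i =>
      simp only [Fin.cons_succ]
      refine Continuous.mul (continuous_const.sub (continuous_subtype_val.comp continuous_snd)) ?_
      exact (continuous_apply i).comp (continuous_subtype_val.comp continuous_fst)) _

lemma conePoint_zero {n : ℕ} (p : stdSimplex ℝ (Fin (n + 1)) × I) :
    conePoint n p 0 = p.2 := rfl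

lemma conePoint_succ {n : ℕ} (p : stdSimplex ℝ (Fin (n + 1)) × I) (i : Fin (n + 1)) :
    conePoint n p i.succ = (1 - (p.2 : ℝ)) * p.1 i := rfl

lemma map_apply {m n : ℕ} (f : Fin m → Fin n) (t : stdSimplex ℝ (Fin m)) (j : Fin n) :
    stdSimplex.map f t j = ∑ i, if f i = j then t i else 0 := by
  rw [stdSimplex.map_coe, FunOnFinite.linearMap_apply_apply, Finset.sum_filter]

lemma map_conePoint {m n : SimplexCategory} (θ : m ⟶ n) (t : stdSimplex ℝ (Fin (m.len + 1)))
    (s : I) : stdSimplex.map (coneMap θ).toOrderHom (conePoint m.len (t, s)) =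
      conePoint n.len (stdSimplex.map θ.toOrderHom t, s) := by
  refine stdSimplex.ext (funext fun j => ?_)
  refine (map_apply _ _ _).trans ?_
  refine (Fin.sum_univ_succ _).trans ?_
  have h0 : (coneMap θ).toOrderHom (0 : Fin (m.len + 2)) = (0 : Fin (n.len + 2)) := rfl
  have hs : ∀ i : Fin (m.len + 1), (coneMap θ).toOrderHom i.succ = (θ.toOrderHom i).succ :=
    fun _ => rfl
  induction j using Fin.cases with
  | zero =>
    simp only [h0, hs, conePoint_zero, if_true, Fin.succ_ne_zero, if_false, Finset.sum_const_zero,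
      add_zero]
  | succ j =>
    simp only [h0, hs, conePoint_succ, (Fin.succ_ne_zero j).symm, if_false, zero_add,
      Fin.succ_inj, map_apply, Finset.mul_sum, mul_ite, mul_zero]

lemma conePoint_base (n : SimplexCategory) (t : stdSimplex ℝ (Fin (n.len + 1))) :
    conePoint n.len (t, 0) = stdSimplex.map (coneBase n).toOrderHom t := by
  refine stdSimplex.ext (funext fun j => ?_)
  refine Eq.trans ?_ (map_apply _ _ _).symm
  have hs : ∀ i : Fin (n.len + 1), (coneBase n).toOrderHom i = i.succ := fun _ => rfl
  induction j using Fin.cases with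
  | zero => simp [hs, conePoint_zero]
  | succ j => simp [hs, conePoint_succ]

lemma conePoint_apex (n : SimplexCategory) (t : stdSimplex ℝ (Fin (n.len + 1)))
    (t₀ : stdSimplex ℝ (Fin 1)) :
    conePoint n.len (t, 1) = stdSimplex.map (coneApex n).toOrderHom t₀ := by
  refine stdSimplex.ext (funext fun j => ?_)
  refine Eq.trans ?_ (map_apply _ _ _).symm
  have hs : ∀ i : Fin 1, (coneApex n).toOrderHom i = (0 : Fin (n.len + 2)) := fun _ => rfl
  induction j using Fin.cases with
  | zero => simp [hs, conePoint_zero]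
  | succ j => simp [hs, conePoint_succ, (Fin.succ_ne_zero j).symm]

/-- An extra degeneracy of a simplicial set: a natural way to extend every simplex to a cone with
a fixed apex. -/
structure Coning (X : SSet.{u}) where
  apex : X.obj (op (SimplexCategory.mk 0))
  cone : ∀ n : SimplexCategory, X.obj (op n) → X.obj (op (SimplexCategory.mk (n.len + 1)))
  cone_map : ∀ {m n : SimplexCategory} (θ : m ⟶ n) (x : X.obj (op n)),
    cone m (X.map θ.op x) = X.map (coneMap θ).op (cone n x)
  map_base : ∀ (n : SimplexCategory) (x : X.obj (op n)), X.map (coneBase n).op (cone n x) = x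
  map_apex : ∀ (n : SimplexCategory) (x : X.obj (op n)), X.map (coneApex n).op (cone n x) = apex

namespace Coning

variable {X : SSet.{u}} (c : Coning X)

/-- The only point of the zero simplex. -/
def _root_.TwoSegal.zeroSimplex : stdSimplex ℝ (Fin ((SimplexCategory.mk 0).len + 1)) :=
  stdSimplex.vertex 0

lemma exists_curried : ∃ g : SSet.toTop.obj X ⟶ TopCat.of C(I, SSet.toTop.obj X),
    ∀ (n : SimplexCategory) (x : X.obj (op n)) t (s : I),
      (g.hom (charMap X x t) : C(I, SSet.toTop.obj X)) s =
        charMap X (c.cone n x) (conePoint n.len (t, s)) := by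
  obtain ⟨g, hg⟩ := exists_realization_hom X (TopCat.of C(I, SSet.toTop.obj X))
    (fun n x => ((charMap X (c.cone n x)).comp (conePoint n.len)).curry)
    (fun {m n} θ x t => by
      refine ContinuousMap.ext fun s => ?_
      change charMap X (c.cone m (X.map θ.op x)) (conePoint m.len (t, s)) =
        charMap X (c.cone n x) (conePoint n.len (stdSimplex.map θ.toOrderHom t, s))
      rw [c.cone_map, charMap_map, map_conePoint])
  exact ⟨g, fun n x t s => congrArg (fun f : C(I, SSet.toTop.obj X) => f s) (hg n x t)⟩

/-- The contraction of the realization onto the apex, as a map to a path space. In this form it can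
be defined on the realization simplex by simplex. -/
def curried : SSet.toTop.obj X ⟶ TopCat.of C(I, SSet.toTop.obj X) := c.exists_curried.choose

lemma curried_charMap (n : SimplexCategory) (x : X.obj (op n)) (t) (s : I) :
    (c.curried.hom (charMap X x t) : C(I, SSet.toTop.obj X)) s =
      charMap X (c.cone n x) (conePoint n.len (t, s)) :=
  c.exists_curried.choose_spec n x t s

/-- Evaluation at a point of the interval. -/
def _root_.TwoSegal.evalAt (Z : TopCat.{u}) (s : I) : TopCat.of C(I, Z) ⟶ Z :=
  TopCat.ofHom ⟨fun f : C(I, Z) => f s, continuous_eval_const s⟩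

/-- The realization of a simplicial set with an extra degeneracy is contractible. -/
def contraction : Contraction (SSet.toTop.obj X) where
  pt := charMap X c.apex zeroSimplex
  H := ContinuousMap.uncurry c.curried.hom
  H_zero := fun z => by
    have h : c.curried ≫ evalAt _ 0 = 𝟙 _ := realization_hom_ext fun n x t => by
      refine (c.curried_charMap n x t 0).trans ?_
      rw [conePoint_base, ← charMap_map, c.map_base]
      rfl
    exact ConcreteCategory.congr_hom h z
  H_one := fun z => by
    have h : c.curried ≫ evalAt _ 1 = TopCat.ofHom (ContinuousMap.const _
        (charMap X c.apex zeroSimplex)) := realization_hom_ext fun n x t => by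
      refine (c.curried_charMap n x t 1).trans ?_
      rw [conePoint_apex n t zeroSimplex, ← charMap_map, c.map_apex]
      rfl
    exact ConcreteCategory.congr_hom h z

/-- The realization of a map of simplicial sets which respects the extra degeneracies carries one
contraction to the other. -/
lemma compatible {Y : SSet.{u}} (d : Coning Y) (f : X ⟶ Y)
    (h₀ : f.app _ c.apex = d.apex) (h : ∀ (n : SimplexCategory) (x : X.obj (op n)),
      f.app _ (c.cone n x) = d.cone n (f.app _ x)) :
    Contraction.Compatible c.contraction d.contraction (SSet.toTop.map f).hom := by
  constructor
  · exact (map_charMap f c.apex zeroSimplex).trans (by rw [h₀]; rfl)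
  · intro z s
    have e : (c.curried ≫ evalAt _ s) ≫ SSet.toTop.map f =
        SSet.toTop.map f ≫ d.curried ≫ evalAt _ s := realization_hom_ext fun n x t => by
      refine (congrArg (SSet.toTop.map f).hom (c.curried_charMap n x t s)).trans ?_
      refine (map_charMap f _ _).trans ?_
      rw [h]
      refine (d.curried_charMap n _ t s).symm.trans ?_
      exact congrArg (fun z => (d.curried.hom z : C(I, SSet.toTop.obj Y)) s)
        (map_charMap f x t).symm
    exact ConcreteCategory.congr_hom e z

end Coning
end Realization

/-! ### Contractibility of the realizations -/

section Nerve

variable {A : Type u} [Category.{v} A]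

lemma composableArrows_ext_of_initial {n : ℕ} {F G : ComposableArrows A (n + 1)}
    (hF : IsInitial (F.obj 0)) (h₀ : F.obj 0 = G.obj 0) (h : F.δ₀ = G.δ₀) : F = G :=
  ComposableArrows.ext_succ h₀ h (hF.hom_ext _ _)

/-- An initial object gives an extra degeneracy of the nerve. -/
def nerveConing {z : A} (hz : IsInitial z) : Coning (nerve A) where
  apex := ComposableArrows.mk₀ z
  cone n F := ComposableArrows.precomp (n := n.len) F (hz.to _)
  cone_map _ _ := composableArrows_ext_of_initial hz rfl rfl
  map_base _ _ := rfl
  map_apex _ _ := ComposableArrows.ext₀ rfl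

variable {B : Type u} [Category.{v} B]

lemma nerveMap_compatible {z : A} (hz : IsInitial z) {z' : B} (hz' : IsInitial z') (G : A ⥤ B)
    (h : G.obj z = z') : Contraction.Compatible (nerveConing hz).contraction
      (nerveConing hz').contraction (SSet.toTop.map (nerveMap G)).hom := by
  subst h
  exact Coning.compatible _ _ _ (ComposableArrows.ext₀ rfl)
    fun n x => composableArrows_ext_of_initial hz' rfl rfl

end Nerve

section SDotZero

variable {C : Type u} [Category.{v} C] (cof : MorphismProperty C) [IsCatWithCof cof]

/-- The object of `S_n` all of whose entries are a fixed zero object. -/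
def zeroObj {Z : C} (hZ : IsZero Z) (n : SimplexCategory) : SCat cof n :=
  ⟨(Functor.const _).obj Z, fun _ => hZ, fun _ _ _ _ _ =>
    ⟨IsCatWithCof.of_isIso _ (inferInstanceAs (IsIso (𝟙 Z))),
      IsPushout.id_horiz (𝟙 Z)⟩⟩

/-- These objects are initial. -/
def isInitialZeroObj {Z : C} (hZ : IsZero Z) (n : SimplexCategory) :
    IsInitial (zeroObj cof hZ n) :=
  IsInitial.ofUniqueHom
    (fun A => ObjectProperty.homMk
      { app := fun x => hZ.to_ (A.obj.obj x)
        naturality := fun _ _ _ => hZ.eq_of_src _ _ })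
    (fun A f => by
      ext x
      exact hZ.eq_of_src _ _)

/-- The spaces `|S_n|` are contractible, compatibly with the simplicial structure, so that all
homotopy limits formed from them are contractible as well. -/
lemma isTwoSegalTop_realization_SDot : IsTwoSegalTop (realization (SDot cof)) := by
  intro n _ P
  obtain ⟨Z, hZ⟩ := IsCatWithCof.exists_zero cof
  let c : ∀ m : SimplexCategoryᵒᵖ, Contraction ((realization (SDot cof)).obj m) :=
    fun m => (nerveConing (isInitialZeroObj cof hZ m.unop)).contraction
  have hc : ∀ {m k : SimplexCategoryᵒᵖ} (θ : m ⟶ k),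
      Contraction.Compatible (c m) (c k) ((realization (SDot cof)).map θ).hom :=
    fun {m k} θ => nerveMap_compatible (isInitialZeroObj cof hZ m.unop)
      (isInitialZeroObj cof hZ k.unop) (SMap cof θ.unop) rfl
  exact (c _).isWeakEquiv (Contraction.holim (fun I => c ((faceFunctor P).op.obj I))
    fun f => hc ((faceFunctor P).op.map f)) _

end SDotZero

/-! ### The category generated by the torus diagram -/

section Assembly

variable {C : Type u} [Category.{v} C]

lemma IsCokernelOf.isPushout {A B Q : C} {f : A ⟶ B} {p : B ⟶ Q} (h : IsCokernelOf f p) {Z : C}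
    (hZ : IsZero Z) : IsPushout f (hZ.from_ A) p (hZ.to_ Q) := by
  obtain ⟨Z', t, s, hZ', H⟩ := h
  exact H.of_iso (Iso.refl _) (Iso.refl _) (hZ'.iso hZ) (Iso.refl _) (by simp)
    (hZ.eq_of_tgt _ _) (by simp) (hZ'.eq_of_src _ _)

namespace IsSubcatWithCof

variable {amb : MorphismProperty C} {A : Subcat C}

lemma isCokernelOf_incl (hA : IsSubcatWithCof amb A) {X Y Q : A.Obj} {f : X ⟶ Y} {p : Y ⟶ Q}
    (hf : A.cof amb f) (h : IsCokernelOf f p) : IsCokernelOf (A.incl.map f) (A.incl.map p) := by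
  obtain ⟨Z, t, s, hZ, H⟩ := h
  exact ⟨_, _, _, hA.preserves_zero Z hZ, hA.preserves_pushout hf H⟩

lemma isPushout_of_isCokernelOf (hA : IsSubcatWithCof amb A) {X Y Q Z : A.Obj} {f : X ⟶ Y}
    {p : Y ⟶ Q} (hf : A.cof amb f) (hZ : IsZero Z)
    (h : IsCokernelOf (A.incl.map f) (A.incl.map p)) :
    IsPushout f (hZ.from_ X) p (hZ.to_ Q) := by
  have H := h.isPushout (hA.preserves_zero Z hZ)
  refine hA.isPushout_mk hf ?_
  rwa [(hA.preserves_zero Z hZ).eq_of_tgt (A.incl.map (hZ.from_ X))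
      ((hA.preserves_zero Z hZ).from_ _),
    (hA.preserves_zero Z hZ).eq_of_src (A.incl.map (hZ.to_ Q)) ((hA.preserves_zero Z hZ).to_ _)]

end IsSubcatWithCof

namespace FinCW

/-- The category with cofibrations generated by the torus diagram. -/
def torusCat : Subcat FinCW := generated cof (Arrows mapI mapQ mapJ mapR)

lemma isSubcatWithCof_torusCat : IsSubcatWithCof cof torusCat :=
  isSubcatWithCof_generated isSubcatWithCof_evenSubcat arrows_le

instance : IsCatWithCof (torusCat.cof cof) := isSubcatWithCof_torusCat.isCatWithCof

lemma torusCat_hom {X Y : FinCW} {f : X ⟶ Y} (hf : Arrows mapI mapQ mapJ mapR f) :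
    torusCat.hom f := fun _ _ hS => hS _ hf

lemma evenBdry_of_torusCat (X : torusCat.Obj) : EvenBdry (torusCat.incl.obj X) :=
  X.prop evenSubcat isSubcatWithCof_evenSubcat arrows_le

/-- The inclusion of the circle into the torus, as a morphism of the generated category. -/
def genI : (⟨circle, torusCat.source (torusCat_hom .i)⟩ : torusCat.Obj) ⟶
    ⟨torus, torusCat.source (torusCat_hom .q)⟩ :=
  Subcat.homMk (A := torusCat) (X := ⟨circle, _⟩) (Y := ⟨torus, _⟩) mapI (torusCat_hom .i)

/-- The map of the generated category from the torus to the pinched torus. -/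
def genQ : (⟨torus, torusCat.source (torusCat_hom .q)⟩ : torusCat.Obj) ⟶
    ⟨pinchedTorus, torusCat.source (torusCat_hom .r)⟩ :=
  Subcat.homMk (A := torusCat) (X := ⟨torus, _⟩) (Y := ⟨pinchedTorus, _⟩) mapQ (torusCat_hom .q)

/-- The map of the generated category from the pinched triangle to the pinched torus. -/
def genJ : (⟨pinchedTriangle, torusCat.source (torusCat_hom .j)⟩ : torusCat.Obj) ⟶
    ⟨pinchedTorus, torusCat.source (torusCat_hom .r)⟩ :=
  Subcat.homMk (A := torusCat) (X := ⟨pinchedTriangle, _⟩) (Y := ⟨pinchedTorus, _⟩) mapJ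
    (torusCat_hom .j)

/-- The map of the generated category from the pinched torus to the sphere. -/
def genR : (⟨pinchedTorus, torusCat.source (torusCat_hom .r)⟩ : torusCat.Obj) ⟶
    ⟨sphere, torusCat.target (torusCat_hom .r)⟩ :=
  Subcat.homMk (A := torusCat) (X := ⟨pinchedTorus, _⟩) (Y := ⟨sphere, _⟩) mapR (torusCat_hom .r)

lemma cof_genI : torusCat.cof cof genI := ⟨isTorusDiagram.cof_i, _, genQ, isTorusDiagram.coker_q⟩

lemma cof_genJ : torusCat.cof cof genJ := ⟨isTorusDiagram.cof_j, _, genR, isTorusDiagram.coker_r⟩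

/-- The torus diagram as a pair of cofibration sequences of the generated category. -/
def torusSeqPair : SeqPair (torusCat.cof cof) where
  Z := ⟨point, isSubcatWithCof_torusCat.obj_of_isZero isZero_point⟩
  hZ := isSubcatWithCof_torusCat.isZero_mk isZero_point
  i := genI
  q := genQ
  j := genJ
  r := genR
  cof_i := cof_genI
  cof_j := cof_genJ
  push_i := isSubcatWithCof_torusCat.isPushout_of_isCokernelOf cof_genI _ isTorusDiagram.coker_q
  push_j := isSubcatWithCof_torusCat.isPushout_of_isCokernelOf cof_genJ _ isTorusDiagram.coker_r

/-- The complement of an open triangle in the torus does not belong to the generated category. -/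
lemma torusSeqPair_obstructed : torusSeqPair.Obstructed := by
  rintro A T' R' f p hf hp ⟨eT⟩ ⟨eR⟩
  have e₁ : torus ≅ torusCat.incl.obj T' := torusCat.incl.mapIso eT.symm
  have e₂ : sphere ≅ torusCat.incl.obj R' := torusCat.incl.mapIso eR.symm
  exact not_isCokernelOf_of_evenBdry (evenBdry_of_torusCat A) e₁
    ((numCells_of_iso e₂ 2).trans numCells_sphere) hf.1
    (isSubcatWithCof_torusCat.isCokernelOf_incl hf hp)

end FinCW
end Assembly

end TwoSegal

end

open TwoSegal in
theorem mainTheorem6 :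
    ∃ (S T Q H R : FinCW) (i : S ⟶ T) (q : T ⟶ Q) (j : H ⟶ Q) (r : Q ⟶ R),
      FinCW.IsTorusDiagram i q j r ∧
      ∃ D : Subcat FinCW,
        D = generated FinCW.cof (FinCW.Arrows i q j r) ∧
        IsSubcatWithCof FinCW.cof D ∧
        ∃ _ : IsCatWithCof (D.cof FinCW.cof),
          (∀ (n : ℕ) (hn : 3 ≤ n),
            ¬ (cornerFunctor (SDot (D.cof FinCW.cof)) n (Nat.le_of_succ_le
              (Nat.le_of_succ_le hn))).EssSurj) ∧
          (∀ (n : ℕ) (P : PolySubdiv n), P.IsTriangulation → (∃ I ∈ P.polygons, 0 ∉ I) →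
            ¬ (segalFunctor (SDot (D.cof FinCW.cof)) P).IsEquivalence) ∧
          IsWaldhausen (D.cof FinCW.cof) (MorphismProperty.isomorphisms D.Obj) ∧
          (∀ (wEq : MorphismProperty D.Obj) [IsWaldhausen (D.cof FinCW.cof) wEq],
            ∀ (n : ℕ) (P : PolySubdiv n), P.IsTriangulation → (∃ I ∈ P.polygons, 0 ∉ I) →
              ¬ (segalFunctor (WSDot (D.cof FinCW.cof) wEq) P).IsEquivalence) ∧
          ¬ IsTwoSegalCat (SDot (D.cof FinCW.cof)) ∧
          IsTwoSegalTop (realization (SDot (D.cof FinCW.cof))) := by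
  have hO := FinCW.torusSeqPair_obstructed
  exact ⟨_, _, _, _, _, FinCW.mapI, FinCW.mapQ, FinCW.mapJ, FinCW.mapR, FinCW.isTorusDiagram,
    FinCW.torusCat, rfl, FinCW.isSubcatWithCof_torusCat, inferInstance,
    fun n hn => hO.not_essSurj_corner n hn _,
    fun _ P _ hP => hO.not_isEquivalence P hP,
    isWaldhausen_isomorphisms,
    fun wEq _ _ P _ hP => hO.not_isEquivalence_weq wEq P hP,
    hO.not_isTwoSegalCat,
    isTwoSegalTop_realization_SDot _⟩
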